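/- Let $d\in\{1,2,3\}$, $\beta>0$, $\alpha\in\mathbb R$, and let $\mathcal H=L^2(\mathbb R^d)\otimes\mathbb C^2$, with vectors $\Psi=\sum_{\sigma=\pm}\psi_\sigma\otimes\chi_\sigma$, where $\chi_\pm$ are the normalized eigenvectors of the Pauli matrix $\hat\sigma^{(1)}$, $\hat\sigma^{(1)}\chi_\sigma=\sigma\chi_\sigma$. Let $H=-\Delta\otimes 1+1\otimes\beta\hat\sigma^{(1)}$ on $D(H)=H^2(\mathbb R^d)\otimes\mathbb C^2$. For $w\in\mathbb C\setminus[0,\infty)$ let $\sqrt w$ be the root with $\operatorname{Im}\sqrt w>0$, and let $G^w$ be the integral kernel of $(-\Delta-w)^{-1}$: $$G^w(x)=\frac{i e^{i\sqrt w|x|}}{2\sqrt w}\ (d=1),\qquad \frac i4H^{(1)}_0(\sqrt w|x|)\ (d=2),\qquad \frac{e^{i\sqrt w|x|}}{4\pi|x|}\ (d=3).$$ For $\varepsilon\ge 0$ let $\hat H_\varepsilon$ be the operator in $\mathcal H$ whose domain consists of the $\Psi$ with $$\Psi=\Psi^z+\sum_\sigma q_\sigma\,G^{z-\beta\sigma}\otimes\chi_\sigma,\qquad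 \Psi^z\in D(H),\ q_\pm\in\mathbb C,\ z\in\mathbb C\setminus\mathbb R,$$ subject to $q_\pm=-\alpha f_\pm-\varepsilon f_\mp$ for $d=1$ and $\alpha q_\pm+\varepsilon q_\mp=f_\pm$ for $d=2,3$, where $f_\sigma=\psi_\sigma(0)$ for $d=1$, $f_\sigma=\lim_{x\to0}\big[\psi_\sigma(x)+\frac{q_\sigma}{2\pi}\ln|x|\big]$ for $d=2$, and $f_\sigma=\lim_{x\to0}\big[\psi_\sigma(x)-\frac{q_\sigma}{4\pi|x|}\big]$ for $d=3$; and $\hat H_\varepsilon\Psi=H\Psi^z+z\sum_\sigma q_\sigma G^{z-\beta\sigma}\otimes\chi_\sigma$ (domain and action do not depend on $z$). Put $\mu=\frac14e^{2(\gamma+2\pi\alpha)}$, with $\gamma$ Euler's constant, and let $$E_{0,+}=\beta-\frac{\alpha^2}4\ (d=1),\qquad E_{0,+}=\beta-\frac1\mu\ (d=2),\qquad E_{0,+}=\beta-(4\pi\alpha)^2\ (d=3)$$ be the upper eigenvalue of $\hat H_0$. **Theorem.** Assume $-2\sqrt{2\beta}<\alpha<0$ if $d=1$; $1<2\beta\mu$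 if $d=2$; $-\sqrt{2\beta}/(4\pi)<\alpha<0$ if $d=3$. Then there are $\varepsilon_0>0$ and $C>0$, depending only on $d,\alpha,\beta$, such that for all $0<\varepsilon<\varepsilon_0$ the operator $\hat H_\varepsilon$ is self-adjoint and: 1. The essential spectrum of $\hat H_\varepsilon$ is only absolutely continuous, $\sigma_{ess}(\hat H_\varepsilon)=\sigma_{ac}(\hat H_\varepsilon)=[-\beta,\infty)$; in particular the singular continuous spectrum is empty and, by 2, no eigenvalue is embedded in $[-\beta,\infty)$. 2. The point spectrum of $\hat H_\varepsilon$ consists of a single eigenvalue $E_{\varepsilon,-}<-\beta$. 3. There is $E^{res}_\varepsilon\in\mathbb C$ with $\operatorname{Im}E^{res}_\varepsilon<0$ and $|E^{res}_\varepsilon-E_{0,+}|\le C\varepsilon^2$ at which the continuation of the resolvent from $\operatorname{Im}z>0$ through the real axis has a simple pole. Precisely: for every $r>0$, with $1_r$ the multiplication by the indicator function of the ball $\{|x|<r\}$, the operator-valued function $z\mapsto 1_r(\hat H_\varepsilon-z)^{-1}1_r$ on $\{\operatorname{Im}z>0\}$ has a meromorphic continuation through $(-\beta,\beta)$ to $\mathbb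 C\setminus\big((-\infty,-\beta]\cup[\beta,\infty)\big)$; this continuation is analytic at the points of $(-\beta,\beta)$ and has a pole of order exactly one at $E^{res}_\varepsilon$. -/

import Mathlib

open MeasureTheory Filter Topology
open scoped SchwartzMap Laplacian

noncomputable section

namespace TwoChannel

/-! ### Spectral notions for a densely defined operator -/

section Spectral

variable {E : Type*} [NormedAddCommGroup E] [InnerProductSpace ℂ E]

/-- The bounded operator `R` is the (two-sided) inverse of `A - z`. -/
def IsResolventAt (A : E →ₗ.[ℂ] E) (z : ℂ) (R : E →L[ℂ] E) : Prop :=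
  (∀ ψ : E, ∃ h : R ψ ∈ A.domain, A ⟨R ψ, h⟩ - z • R ψ = ψ) ∧
    ∀ φ : A.domain, R (A φ - z • (φ : E)) = φ

/-- The spectrum: the complement of the resolvent set. -/
def opSpectrum (A : E →ₗ.[ℂ] E) : Set ℂ :=
  {z | ¬ ∃ R : E →L[ℂ] E, IsResolventAt A z R}

/-- The kernel of `A - z`, as a subspace of the domain. -/
def eigenKer (A : E →ₗ.[ℂ] E) (z : ℂ) : Submodule ℂ A.domain :=
  LinearMap.ker (A.toFun - z • A.domain.subtype)

/-- The point spectrum: the set of all eigenvalues. -/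
def pointSpectrum (A : E →ₗ.[ℂ] E) : Set ℂ :=
  {z | eigenKer A z ≠ ⊥}

/-- The discrete spectrum: eigenvalues of finite multiplicity that are isolated points of the
spectrum. -/
def discreteSpectrum (A : E →ₗ.[ℂ] E) : Set ℂ :=
  {z | z ∈ pointSpectrum A ∧ FiniteDimensional ℂ (eigenKer A z) ∧
    ∃ δ : ℝ, 0 < δ ∧ Metric.ball z δ ∩ opSpectrum A = {z}}

/-- The essential spectrum: the complement of the discrete spectrum in the spectrum. -/
def essentialSpectrum (A : E →ₗ.[ℂ] E) : Set ℂ :=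
  opSpectrum A \ discreteSpectrum A

/-- `μ` is the spectral measure of `A` at the vector `ψ`, i.e. the finite measure with
`⟨ψ, (A - z)⁻¹ ψ⟩ = ∫ (t - z)⁻¹ dμ(t)` for all non-real `z` (it is unique, and it exists when
`A` is self-adjoint). -/
def IsSpectralMeasure (A : E →ₗ.[ℂ] E) (ψ : E) (μ : Measure ℝ) : Prop :=
  IsFiniteMeasure μ ∧ ∀ z : ℂ, z.im ≠ 0 →
    ∃ R : E →L[ℂ] E, IsResolventAt A z R ∧
      inner ℂ ψ (R ψ) = ∫ t : ℝ, ((t : ℂ) - z)⁻¹ ∂μ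

/-- The absolutely continuous subspace: vectors with absolutely continuous spectral measure.
For self-adjoint `A` these already form a closed subspace, so taking the span adds nothing. -/
def acSubspace (A : E →ₗ.[ℂ] E) : Submodule ℂ E :=
  Submodule.span ℂ {ψ | ∃ μ : Measure ℝ, IsSpectralMeasure A ψ μ ∧ μ ≪ volume}

/-- The singular continuous subspace: vectors whose spectral measure has no atoms and is singular
with respect to Lebesgue measure. For self-adjoint `A` these already form a closed subspace. -/
def scSubspace (A : E →ₗ.[ℂ] E) : Submodule ℂ E :=
  Submodule.span ℂ {ψ | ∃ μ : Measure ℝ, IsSpectralMeasure A ψ μ ∧ (∀ t : ℝ, μ {t} = 0) ∧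
    μ ⟂ₘ volume}

/-- The part of `A` in the subspace `K`: its domain consists of the `u ∈ K ∩ D(A)` with
`A u ∈ K`, and it acts as `A`. -/
def partOn (A : E →ₗ.[ℂ] E) (K : Submodule ℂ E) : K →ₗ.[ℂ] K :=
  (A.graph.comap (K.subtype.prodMap K.subtype)).toLinearPMap

/-- The absolutely continuous spectrum: the spectrum of the part of `A` in its absolutely
continuous subspace. -/
def acSpectrum (A : E →ₗ.[ℂ] E) : Set ℂ :=
  opSpectrum (partOn A (acSubspace A))

/-- The singular continuous spectrum. -/
def scSpectrum (A : E →ₗ.[ℂ] E) : Set ℂ :=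
  opSpectrum (partOn A (scSubspace A))

end Spectral

/-! ### The Hilbert space and the free Green functions -/

/-- `L²(ℝᵈ)`. -/
abbrev L2 (d : ℕ) : Type :=
  Lp ℂ 2 (volume : Measure (EuclideanSpace ℝ (Fin d)))

/-- `L²(ℝᵈ) ⊗ ℂ²`, through the components in the orthonormal basis `χ₊, χ₋` of `ℂ²`;
the index `0` stands for `+` and the index `1` for `-`. -/
abbrev State (d : ℕ) : Type :=
  PiLp 2 (fun _ : Fin 2 => L2 d)

/-- The sign `σ = ±1` of a channel. -/
def sgn : Fin 2 → ℝ := ![1, -1]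

/-- The square root with positive imaginary part, for `w ∉ [0, ∞)`. -/
def sqrtUp (w : ℂ) : ℂ := Complex.I * (-w) ^ (1 / 2 : ℂ)

/-- The Hankel function `H₀⁽¹⁾(η)` for `Im η > 0`, by its integral representation
`(π i)⁻¹ ∫ exp (i η cosh t) dt` over the real line. -/
def hankel (η : ℂ) : ℂ :=
  (Real.pi * Complex.I)⁻¹ * ∫ t : ℝ, Complex.exp (Complex.I * η * (Real.cosh t : ℂ))

/-- The integral kernel `G^w(x)` of `(-Δ - w)⁻¹` on `ℝᵈ`, `d = 1, 2, 3`, for `w ∉ [0, ∞)`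
(a dummy value in other dimensions). -/
def green (d : ℕ) (w : ℂ) (x : EuclideanSpace ℝ (Fin d)) : ℂ :=
  match d with
  | 1 => Complex.I * Complex.exp (Complex.I * sqrtUp w * (‖x‖ : ℂ)) / (2 * sqrtUp w)
  | 2 => Complex.I / 4 * hankel (sqrtUp w * (‖x‖ : ℂ))
  | 3 => Complex.exp (Complex.I * sqrtUp w * (‖x‖ : ℂ)) / (4 * Real.pi * (‖x‖ : ℂ))
  | _ => 0

/-- The singularity of `G^w` at the origin, to be removed before evaluating there:
`0`, `-log |x| / 2π`, `1 / (4π|x|)` for `d = 1, 2, 3`. -/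
def singularPart (d : ℕ) (x : EuclideanSpace ℝ (Fin d)) : ℂ :=
  match d with
  | 2 => ((-(Real.log ‖x‖) / (2 * Real.pi) : ℝ) : ℂ)
  | 3 => ((1 / (4 * Real.pi * ‖x‖) : ℝ) : ℂ)
  | _ => 0

/-! ### The Hamiltonians -/

/-- `φ` lies in the domain `H²(ℝᵈ) ⊗ ℂ²` of the free Hamiltonian
`H = -Δ ⊗ 1 + 1 ⊗ β σ⁽¹⁾`, and `H φ = h`. -/
def IsFreeAction (d : ℕ) (β : ℝ) (φ h : State d) : Prop :=
  ∀ σ : Fin 2,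
    TemperedDistribution.MemSobolev 2 2 (φ σ : 𝓢'(EuclideanSpace ℝ (Fin d), ℂ)) ∧
    (h σ : 𝓢'(EuclideanSpace ℝ (Fin d), ℂ)) =
      -(Δ (φ σ : 𝓢'(EuclideanSpace ℝ (Fin d), ℂ))) +
        ((β * sgn σ : ℝ) : ℂ) • (φ σ : 𝓢'(EuclideanSpace ℝ (Fin d), ℂ))

/-- The boundary condition between the charges `q₊, q₋` and the values `f₊, f₋` at the origin:
`q_± = -α f_± - ε f_∓` for `d = 1`, and `α q_± + ε q_∓ = f_±` for `d = 2, 3`. -/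
def BoundaryCondition (d : ℕ) (α ε : ℝ) (q f : Fin 2 → ℂ) : Prop :=
  match d with
  | 1 => q 0 = -α * f 0 - ε * f 1 ∧ q 1 = -α * f 1 - ε * f 0
  | _ => α * q 0 + ε * q 1 = f 0 ∧ α * q 1 + ε * q 0 = f 1

/-- `Ψ` lies in the domain of the point-interaction Hamiltonian and is mapped to `Ξ`, where `q` are
the charges of `Ψ` and `f` the values at the origin of its regular parts. For all non-real `z`,
`Ψ = Ψᶻ + ∑ q_σ G^{z - βσ} ⊗ χ_σ` with `Ψᶻ ∈ D(H)` and
`Ξ = H Ψᶻ + z ∑ q_σ G^{z - βσ} ⊗ χ_σ`. The filter `𝓝 0 ⊓ ae volume` makes the limit at the origin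
independent of the representative of the `L²` class. -/
def IsHamAction (d : ℕ) (β : ℝ) (Ψ Ξ : State d) (q f : Fin 2 → ℂ) : Prop :=
  (∀ σ : Fin 2, Tendsto (fun x => Ψ σ x - q σ * singularPart d x)
    (𝓝 0 ⊓ ae (volume : Measure (EuclideanSpace ℝ (Fin d)))) (𝓝 (f σ))) ∧
  ∀ z : ℂ, z.im ≠ 0 → ∃ φ h : State d, IsFreeAction d β φ h ∧ ∀ σ : Fin 2,
    (∀ᵐ x, Ψ σ x = φ σ x + q σ * green d (z - (β * sgn σ : ℝ)) x) ∧
    (∀ᵐ x, Ξ σ x = h σ x + z * (q σ * green d (z - (β * sgn σ : ℝ)) x))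

lemma IsFreeAction.add {d : ℕ} {β : ℝ} {φ h φ' h' : State d}
    (H : IsFreeAction d β φ h) (H' : IsFreeAction d β φ' h') :
    IsFreeAction d β (φ + φ') (h + h') := by
  intro σ
  obtain ⟨h1, h2⟩ := H σ
  obtain ⟨h1', h2'⟩ := H' σ
  have key : ∀ u v : L2 d, ((u + v : L2 d) : 𝓢'(EuclideanSpace ℝ (Fin d), ℂ)) =
      (u : 𝓢'(EuclideanSpace ℝ (Fin d), ℂ)) + (v : 𝓢'(EuclideanSpace ℝ (Fin d), ℂ)) := by
    intro u v
    simp only [← Lp.toTemperedDistributionCLM_apply, map_add]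
  rw [PiLp.add_apply, PiLp.add_apply, key, key, h2, h2']
  refine ⟨h1.add h1', ?_⟩
  simp only [← TemperedDistribution.laplacianCLM_apply, map_add, smul_add]
  abel

lemma IsFreeAction.smul {d : ℕ} {β : ℝ} {φ h : State d} (c : ℂ)
    (H : IsFreeAction d β φ h) : IsFreeAction d β (c • φ) (c • h) := by
  intro σ
  obtain ⟨h1, h2⟩ := H σ
  have key : ∀ u : L2 d, ((c • u : L2 d) : 𝓢'(EuclideanSpace ℝ (Fin d), ℂ)) =
      c • (u : 𝓢'(EuclideanSpace ℝ (Fin d), ℂ)) := by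
    intro u
    simp only [← Lp.toTemperedDistributionCLM_apply, map_smul]
  rw [PiLp.smul_apply, PiLp.smul_apply, key, key, h2]
  refine ⟨h1.smul c, ?_⟩
  simp only [← TemperedDistribution.laplacianCLM_apply, map_smul, smul_add, smul_neg]
  rw [smul_comm]

lemma IsHamAction.add {d : ℕ} {β : ℝ} {Ψ Ξ Ψ' Ξ' : State d} {q f q' f' : Fin 2 → ℂ}
    (H : IsHamAction d β Ψ Ξ q f) (H' : IsHamAction d β Ψ' Ξ' q' f') :
    IsHamAction d β (Ψ + Ψ') (Ξ + Ξ') (q + q') (f + f') := by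
  refine ⟨fun σ => ?_, fun z hz => ?_⟩
  · refine ((H.1 σ).add (H'.1 σ)).congr' ?_
    refine Eventually.filter_mono inf_le_right ?_
    filter_upwards [Lp.coeFn_add (Ψ σ) (Ψ' σ)] with x hx
    simp only [PiLp.add_apply, hx, Pi.add_apply]
    ring
  · obtain ⟨φ, h, hf, he⟩ := H.2 z hz
    obtain ⟨φ', h', hf', he'⟩ := H'.2 z hz
    refine ⟨φ + φ', h + h', hf.add hf', fun σ => ⟨?_, ?_⟩⟩
    · filter_upwards [(he σ).1, (he' σ).1, Lp.coeFn_add (Ψ σ) (Ψ' σ),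
        Lp.coeFn_add (φ σ) (φ' σ)] with x h1 h2 h3 h4
      simp only [PiLp.add_apply, h3, h4, Pi.add_apply, h1, h2]
      ring
    · filter_upwards [(he σ).2, (he' σ).2, Lp.coeFn_add (Ξ σ) (Ξ' σ),
        Lp.coeFn_add (h σ) (h' σ)] with x h1 h2 h3 h4
      simp only [PiLp.add_apply, h3, h4, Pi.add_apply, h1, h2]
      ring

lemma IsHamAction.smul {d : ℕ} {β : ℝ} {Ψ Ξ : State d} {q f : Fin 2 → ℂ} (c : ℂ)
    (H : IsHamAction d β Ψ Ξ q f) :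
    IsHamAction d β (c • Ψ) (c • Ξ) (c • q) (c • f) := by
  refine ⟨fun σ => ?_, fun z hz => ?_⟩
  · refine ((H.1 σ).const_smul c).congr' ?_
    refine Eventually.filter_mono inf_le_right ?_
    filter_upwards [Lp.coeFn_smul c (Ψ σ)] with x hx
    simp only [PiLp.smul_apply, hx, Pi.smul_apply, smul_eq_mul]
    ring
  · obtain ⟨φ, h, hf, he⟩ := H.2 z hz
    refine ⟨c • φ, c • h, hf.smul c, fun σ => ⟨?_, ?_⟩⟩
    · filter_upwards [(he σ).1, Lp.coeFn_smul c (Ψ σ), Lp.coeFn_smul c (φ σ)] with x h1 h2 h3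
      simp only [PiLp.smul_apply, h2, h3, Pi.smul_apply, h1, smul_eq_mul]
      ring
    · filter_upwards [(he σ).2, Lp.coeFn_smul c (Ξ σ), Lp.coeFn_smul c (h σ)] with x h1 h2 h3
      simp only [PiLp.smul_apply, h2, h3, Pi.smul_apply, h1, smul_eq_mul]
      ring

lemma IsHamAction.zero (d : ℕ) (β : ℝ) : IsHamAction d β 0 0 0 0 := by
  have hz : ((0 : L2 d) : 𝓢'(EuclideanSpace ℝ (Fin d), ℂ)) = 0 := by
    simp only [← Lp.toTemperedDistributionCLM_apply, map_zero]
  refine ⟨fun σ => ?_, fun z _ => ⟨0, 0, fun σ => ?_, fun σ => ⟨?_, ?_⟩⟩⟩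
  · refine (tendsto_const_nhds (x := (0 : ℂ))).congr' ?_
    refine Eventually.filter_mono inf_le_right ?_
    filter_upwards with x
    simp
  · rw [PiLp.zero_apply, hz]
    refine ⟨TemperedDistribution.memSobolev_fun_zero _ _ _ _, ?_⟩
    simp only [← TemperedDistribution.laplacianCLM_apply, map_zero, smul_zero, neg_zero, add_zero]
  · filter_upwards with x
    simp
  · filter_upwards with x
    simp

lemma BoundaryCondition.add {d : ℕ} {α ε : ℝ} {q f q' f' : Fin 2 → ℂ}
    (H : BoundaryCondition d α ε q f) (H' : BoundaryCondition d α ε q' f') :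
    BoundaryCondition d α ε (q + q') (f + f') := by
  unfold BoundaryCondition at *
  split at H <;> simp only [Pi.add_apply] at * <;>
    refine ⟨?_, ?_⟩ <;>
    first
      | linear_combination H.1 + H'.1
      | linear_combination H.2 + H'.2

lemma BoundaryCondition.smul {d : ℕ} {α ε : ℝ} {q f : Fin 2 → ℂ} (c : ℂ)
    (H : BoundaryCondition d α ε q f) :
    BoundaryCondition d α ε (c • q) (c • f) := by
  unfold BoundaryCondition at *
  split at H <;> simp only [Pi.smul_apply, smul_eq_mul] <;>
    exact ⟨by linear_combination c * H.1, by linear_combination c * H.2⟩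

lemma BoundaryCondition.zero (d : ℕ) (α ε : ℝ) : BoundaryCondition d α ε 0 0 := by
  unfold BoundaryCondition
  split <;> simp

/-- The graph of the Hamiltonian with boundary parameters `α, ε`. -/
def hamGraph (d : ℕ) (β α ε : ℝ) : Submodule ℂ (State d × State d) where
  carrier := {p | ∃ q f : Fin 2 → ℂ,
    BoundaryCondition d α ε q f ∧ IsHamAction d β p.1 p.2 q f}
  add_mem' := by
    rintro _ _ ⟨q, f, hb, ha⟩ ⟨q', f', hb', ha'⟩
    exact ⟨q + q', f + f', hb.add hb', ha.add ha'⟩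
  zero_mem' := ⟨0, 0, BoundaryCondition.zero d α ε, IsHamAction.zero d β⟩
  smul_mem' := by
    rintro c _ ⟨q, f, hb, ha⟩
    exact ⟨c • q, c • f, hb.smul c, ha.smul c⟩

/-- The Hamiltonian `Ĥ_ε` (and `Ĥ₀` for `ε = 0`). -/
def hamiltonian (d : ℕ) (β α ε : ℝ) : State d →ₗ.[ℂ] State d :=
  (hamGraph d β α ε).toLinearPMap

/-- `μ = exp (2 (γ + 2πα)) / 4`, with `γ` Euler's constant. -/
def muConst (α : ℝ) : ℝ :=
  Real.exp (2 * (Real.eulerMascheroniConstant + 2 * Real.pi * α)) / 4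

/-- The upper eigenvalue `E_{0,+}` of `Ĥ₀` (a dummy value for `d ≠ 1, 2, 3`). -/
def upperEigenvalue (d : ℕ) (β α : ℝ) : ℝ :=
  match d with
  | 1 => β - α ^ 2 / 4
  | 2 => β - 1 / muConst α
  | 3 => β - (4 * Real.pi * α) ^ 2
  | _ => 0

/-! ### Continuation of the resolvent -/

/-- Multiplication of both components by the indicator function of the ball of radius `r`. -/
def cutoff {d : ℕ} (r : ℝ) (Ψ : State d) : State d :=
  WithLp.toLp 2 fun σ =>
    ((Lp.memLp (Ψ σ)).indicator (measurableSet_ball (x := 0) (ε := r))).toLp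

/-- The plane cut along `(-∞, -β]` and `[β, ∞)`: the upper and the lower half-plane glued together
along the interval `(-β, β)`. -/
def cutPlane (β : ℝ) : Set ℂ := {z | z.im ≠ 0 ∨ |z.re| < β}

/-- `F` is the meromorphic continuation of the resolvent of `A`, cut off to the ball of radius `r`
on both sides, from `Im z > 0` through `(-β, β)` to the cut plane; it is analytic
up to and across `(-β, β)`. -/
def IsResolventContinuation {d : ℕ} (A : State d →ₗ.[ℂ] State d) (β r : ℝ)
    (F : ℂ → State d →L[ℂ] State d) : Prop :=
  MeromorphicOn F (cutPlane β) ∧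
  (∀ z ∈ cutPlane β, 0 ≤ z.im → AnalyticAt ℂ F z) ∧
  ∀ z : ℂ, 0 < z.im → ∃ R : State d →L[ℂ] State d, IsResolventAt A z R ∧
    ∀ Ψ : State d, F z Ψ = cutoff r (R (cutoff r Ψ))

end TwoChannel

end

/-!
Write `κ_σ = √(βσ - z)` for the square roots of the channel energies. In the Fourier
representation the Hamiltonian sends a state with charges `q` to `(|2πξ|² + βσ) Ψ̂_σ - q_σ`
(`isHamAction_iff`; the Fourier transform of the Green function, `fourier_gk`, comes from writing
the Green function as the Laplace transform of the heat kernel). Solving the boundary conditions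
for the charges then gives Krein's formula (`isResolventAt_kreinOp`): the resolvent is the free
resolvent plus an operator of rank two built from the Green functions, whose coefficients have the
denominator `kdet = (α + n(κ₊)) (α + n(κ₋)) - ε²`. The function `n` is explicit (`nfun`), increasing
on the positive reals, and maps the lower half-plane into itself.

The last property drives the argument. Two numbers with nonpositive imaginary parts, one of them
negative, never have the product `ε² > 0` (`mul_ne_sq_of_im`). For `Im z > 0` both roots `κ_σ`
lie in the lower half-plane, and on the real axis above `-β`, approached from above, the root
`κ₋` still does. Hence `kdet` has no zeros there. This gives a resolvent at every nonreal point,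
hence self-adjointness, and a limiting absorption principle: on states of bounded support the
resolvent form stays bounded up to the real axis, apart from the points `±β` and the eigenvalue
(`exists_bound_inner_resolvent`).

*Spectrum.* Below `-β` both factors of `kdet` are decreasing functions of the energy, and `kdet` has
exactly one zero (`existsUnique_kdet_eq_zero`), which is the eigenvalue. An eigenvector at an energy
`≥ -β` would have no charge in the lower channel, since `1 / (p - s)` is not square integrable for
`s ≥ 0`; the coupling `ε ≠ 0` then removes the charge in the upper channel as well
(`notMem_pointSpectrum_of_le`). Functions in the lower channel with odd Fourier transform do not
feel the point interaction and provide Weyl vectors at all energies `≥ -β` (`exists_weyl_vector`).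
The absence of singular spectrum is the abstract statement `spectral_types`: the spectral measure
of a vector has the resolvent form as its Stieltjes transform, so that bounds for this form on a
dense set of vectors make all spectral measures absolutely continuous off the exceptional points,
which carry no mass unless they are eigenvalues. The spectral measures themselves come from the
continuous functional calculus of a resolvent at a real point, through the Riesz–Markov theorem.

*Resonance.* Between cut-offs to a ball, the Green functions and the free resolvents are holomorphic
in `κ` on the whole plane cut along the negative real axis, not only for `Re κ > 0`. Continuing
`κ₋` across `(-β, β)` by `κ₋ = -i √(z + β)` (`kres`) therefore continues Krein's formula to the
second sheet (`isResolventContinuation_cutKrein`). For `ε = 0` the continued determinant has a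
simple zero at `upperEigenvalue`, so that by the inverse function theorem it has, for small
`ε`, a simple zero at a distance `O(ε²)` (`exists_resonance`). This zero has negative imaginary
part, for `kdet` does not vanish when `Im z ≥ 0`; it is a pole of order exactly one because an
off-diagonal coefficient in the numerator is a nonzero multiple of `ε` (`polarPart_ne_zero`).
-/

noncomputable section

namespace TwoChannel

/-! ### Operators, resolvents and graphs -/

section Operators

variable {E : Type*} [NormedAddCommGroup E] [InnerProductSpace ℂ E]

lemma isResolventAt_iff_graph {A : E →ₗ.[ℂ] E} {z : ℂ} {R : E →L[ℂ] E} :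
    IsResolventAt A z R ↔ (∀ ψ, (R ψ, ψ + z • R ψ) ∈ A.graph) ∧
      ∀ x y, (x, y) ∈ A.graph → R (y - z • x) = x := by
  constructor
  · rintro ⟨h1, h2⟩
    refine ⟨fun ψ => ?_, fun x y h => ?_⟩
    · obtain ⟨h, e⟩ := h1 ψ
      rw [LinearPMap.mem_graph_iff]
      exact ⟨⟨R ψ, h⟩, rfl, eq_add_of_sub_eq e⟩
    · obtain ⟨u, rfl, rfl⟩ := (LinearPMap.mem_graph_iff A).1 h
      exact h2 u
  · rintro ⟨h1, h2⟩
    refine ⟨fun ψ => ?_, fun φ => h2 _ _ (A.mem_graph φ)⟩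
    obtain ⟨u, hu, hv⟩ := (LinearPMap.mem_graph_iff A).1 (h1 ψ)
    simp only at hu hv
    have hm : R ψ ∈ A.domain := hu ▸ u.2
    refine ⟨hm, ?_⟩
    have : (⟨R ψ, hm⟩ : A.domain) = u := Subtype.ext hu.symm
    rw [this, hv]; abel

lemma IsResolventAt.unique {A : E →ₗ.[ℂ] E} {z : ℂ} {R R' : E →L[ℂ] E}
    (h : IsResolventAt A z R) (h' : IsResolventAt A z R') : R = R' := by
  rw [isResolventAt_iff_graph] at h h'
  ext ψ
  have := h'.2 _ _ (h.1 ψ)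
  rw [add_sub_cancel_right] at this
  exact this.symm

/-- The first resolvent identity. -/
lemma IsResolventAt.sub_apply {A : E →ₗ.[ℂ] E} {z w : ℂ} {R S : E →L[ℂ] E}
    (h : IsResolventAt A z R) (h' : IsResolventAt A w S) (ψ : E) :
    R ψ - S ψ = (z - w) • R (S ψ) := by
  rw [isResolventAt_iff_graph] at h h'
  have := h.2 _ _ (h'.1 ψ)
  have e : ψ + w • S ψ - z • S ψ = ψ - (z - w) • S ψ := by rw [sub_smul]; abel
  rw [e, map_sub, map_smul] at this
  rw [sub_eq_iff_eq_add, ← sub_eq_iff_eq_add', this]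

/-- An operator with mutually adjoint resolvents at `z` and at `z̄` is self-adjoint. -/
lemma isSelfAdjoint_of_resolvent [CompleteSpace E] {A : E →ₗ.[ℂ] E} {z : ℂ} {R S : E →L[ℂ] E}
    (h : IsResolventAt A z R) (h' : IsResolventAt A (starRingEnd ℂ z) S)
    (hRS : ∀ φ ψ, inner ℂ (S φ) ψ = inner ℂ φ (R ψ)) : IsSelfAdjoint A := by
  rw [isResolventAt_iff_graph] at h h'
  have hdense : Dense (A.domain : Set E) := by
    rw [Submodule.dense_iff_topologicalClosure_eq_top,
      Submodule.topologicalClosure_eq_top_iff, Submodule.eq_bot_iff]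
    intro u hu
    have hS : S u = 0 := by
      refine ext_inner_right ℂ fun ψ => ?_
      rw [hRS, inner_zero_left]
      refine inner_eq_zero_symm.1 ?_
      exact (Submodule.mem_orthogonal _ _).1 hu _ (LinearPMap.mem_domain_of_mem_graph (h.1 ψ))
    have := h'.1 u
    rw [hS, smul_zero, add_zero] at this
    exact A.graph_fst_eq_zero_snd this rfl
  have hsymm : ∀ x y x' y', (x, y) ∈ A.graph → (x', y') ∈ A.graph →
      inner ℂ y x' = (inner ℂ x y' : ℂ) := by
    intro x y x' y' hx hx'
    have e1 := h'.2 _ _ hx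
    have e2 := h.2 _ _ hx'
    have : inner ℂ x (y' - z • x') = (inner ℂ (y - (starRingEnd ℂ z) • x) x' : ℂ) := by
      conv_lhs => rw [← e1]
      conv_rhs => rw [← e2]
      exact hRS _ _
    rw [inner_sub_left, inner_sub_right, inner_smul_left, inner_smul_right, Complex.conj_conj]
      at this
    linear_combination -this
  rw [LinearPMap.isSelfAdjoint_def]
  refine le_antisymm ?_ ?_
  · rw [← LinearPMap.le_graph_iff]
    rintro ⟨x, y⟩ hxy
    rw [LinearPMap.adjoint_graph_eq_graph_adjoint hdense, Submodule.mem_adjoint_iff] at hxy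
    have hx : S (y - (starRingEnd ℂ z) • x) = x := by
      refine ext_inner_right ℂ fun ψ => ?_
      have e := hxy _ _ (h.1 ψ)
      rw [hRS, inner_sub_left, inner_smul_left, Complex.conj_conj]
      simp only [inner_add_left, inner_smul_left] at e
      have e2 := congrArg (starRingEnd ℂ) e
      simp only [map_sub, map_add, map_mul, inner_conj_symm, Complex.conj_conj, map_zero] at e2
      linear_combination -e2
    have := h'.1 (y - (starRingEnd ℂ z) • x)
    rw [hx, sub_add_cancel] at this
    exact this
  · refine LinearPMap.IsFormalAdjoint.le_adjoint hdense fun x y => ?_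
    exact hsymm _ _ _ _ (A.mem_graph _) (A.mem_graph _)

lemma inner_graph_symm [CompleteSpace E] {A : E →ₗ.[ℂ] E} (hA : IsSelfAdjoint A) {x y x' y' : E}
    (h : (x, y) ∈ A.graph) (h' : (x', y') ∈ A.graph) : inner ℂ y x' = (inner ℂ x y' : ℂ) := by
  obtain ⟨u, rfl, rfl⟩ := (LinearPMap.mem_graph_iff A).1 h
  obtain ⟨v, rfl, rfl⟩ := (LinearPMap.mem_graph_iff A).1 h'
  have := LinearPMap.adjoint_isFormalAdjoint hA.dense_domain
  rw [LinearPMap.isSelfAdjoint_def.1 hA] at this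
  exact this u v

/-- The graph of a self-adjoint operator consists of the pairs satisfying Green's identity. -/
lemma mem_graph_of_inner_symm [CompleteSpace E] {A : E →ₗ.[ℂ] E} (hA : IsSelfAdjoint A) {x y : E}
    (h : ∀ x' y', (x', y') ∈ A.graph → inner ℂ y' x = (inner ℂ x' y : ℂ)) :
    (x, y) ∈ A.graph := by
  have := LinearPMap.isSelfAdjoint_def.1 hA
  rw [← this, LinearPMap.adjoint_graph_eq_graph_adjoint hA.dense_domain, Submodule.mem_adjoint_iff]
  intro x' y' h'
  rw [h _ _ h', sub_self]

/-- The resolvent at the conjugate point is the adjoint of the resolvent. -/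
lemma IsResolventAt.inner_symm [CompleteSpace E] {A : E →ₗ.[ℂ] E} (hA : IsSelfAdjoint A) {z : ℂ}
    {R S : E →L[ℂ] E} (h : IsResolventAt A z R) (h' : IsResolventAt A (starRingEnd ℂ z) S)
    (φ ψ : E) : inner ℂ (S φ) ψ = (inner ℂ φ (R ψ) : ℂ) := by
  rw [isResolventAt_iff_graph] at h h'
  have := inner_graph_symm hA (h'.1 φ) (h.1 ψ)
  rw [inner_add_left, inner_add_right, inner_smul_left, inner_smul_right, Complex.conj_conj] at this
  linear_combination -this

/-- `Im ⟨ψ, R ψ⟩ = Im z ‖R ψ‖²` for the resolvent of a self-adjoint operator. -/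
lemma IsResolventAt.im_inner [CompleteSpace E] {A : E →ₗ.[ℂ] E} (hA : IsSelfAdjoint A) {z : ℂ}
    {R : E →L[ℂ] E} (h : IsResolventAt A z R) (ψ : E) :
    (inner ℂ ψ (R ψ) : ℂ).im = z.im * ‖R ψ‖ ^ 2 := by
  rw [isResolventAt_iff_graph] at h
  have h1 := h.1 ψ
  have e := inner_graph_symm hA h1 h1
  have e2 : (inner ℂ (ψ + z • R ψ) (R ψ) : ℂ).im = 0 := by
    have := inner_conj_symm (𝕜 := ℂ) (R ψ) (ψ + z • R ψ)
    rw [e] at this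
    have := congrArg Complex.im this
    rw [Complex.conj_im] at this
    rw [e]; linarith
  rw [inner_add_left, inner_smul_left, inner_self_eq_norm_sq_to_K] at e2
  have : ((starRingEnd ℂ z) * ((‖R ψ‖ : ℂ)) ^ 2).im = - z.im * ‖R ψ‖ ^ 2 := by
    rw [← Complex.ofReal_pow, Complex.im_mul_ofReal, Complex.conj_im]
  simp only [Complex.add_im, Complex.coe_algebraMap, this] at e2
  linarith

lemma IsResolventAt.norm_le [CompleteSpace E] {A : E →ₗ.[ℂ] E} (hA : IsSelfAdjoint A) {z : ℂ}
    {R : E →L[ℂ] E} (h : IsResolventAt A z R) (ψ : E) :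
    |z.im| * ‖R ψ‖ ≤ ‖ψ‖ := by
  have e := h.im_inner hA ψ
  have h2 : |z.im| * ‖R ψ‖ ^ 2 ≤ ‖ψ‖ * ‖R ψ‖ := by
    calc |z.im| * ‖R ψ‖ ^ 2 = |(inner ℂ ψ (R ψ) : ℂ).im| := by
          rw [e, abs_mul, abs_of_nonneg (sq_nonneg ‖R ψ‖)]
      _ ≤ ‖(inner ℂ ψ (R ψ) : ℂ)‖ := Complex.abs_im_le_norm _
      _ ≤ _ := norm_inner_le_norm _ _
  rcases eq_or_lt_of_le (norm_nonneg (R ψ)) with h0 | h0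
  · rw [← h0]; simp
  · nlinarith

lemma IsResolventAt.eq_zero_of_apply {A : E →ₗ.[ℂ] E} {z : ℂ} {R : E →L[ℂ] E}
    (h : IsResolventAt A z R) {ψ : E} (h0 : R ψ = 0) : ψ = 0 := by
  rw [isResolventAt_iff_graph] at h
  have := h.1 ψ
  rw [h0, smul_zero, add_zero] at this
  exact A.graph_fst_eq_zero_snd this rfl

/-- `R (1 - (z - c) T) = T` for resolvents `R` at `z` and `T` at `c`. -/
lemma IsResolventAt.mul_one_sub {A : E →ₗ.[ℂ] E} {z c : ℂ} {R T : E →L[ℂ] E}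
    (h : IsResolventAt A z R) (hT : IsResolventAt A c T) : R * (1 - (z - c) • T) = T := by
  ext ψ
  have := h.sub_apply hT ψ
  simp only [mul_apply_eq_comp, _root_.sub_apply,
    one_apply_eq_self, smul_apply, map_sub, map_smul]
  rw [← this]; abel

lemma IsResolventAt.one_sub_mul {A : E →ₗ.[ℂ] E} {z c : ℂ} {R T : E →L[ℂ] E}
    (h : IsResolventAt A z R) (hT : IsResolventAt A c T) : (1 - (z - c) • T) * R = T := by
  ext ψ
  have := hT.sub_apply h ψ
  simp only [mul_apply_eq_comp, _root_.sub_apply,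
    one_apply_eq_self, smul_apply]
  rw [sub_eq_iff_eq_add] at this
  rw [this, ← neg_sub z c, neg_smul]; abel

/-- The graph of the part of an operator in a subspace. -/
lemma mem_partOn_graph {A : E →ₗ.[ℂ] E} {K : Submodule ℂ E} {x y : K} :
    (x, y) ∈ (partOn A K).graph ↔ ((x : E), (y : E)) ∈ A.graph := by
  unfold partOn
  rw [Submodule.toLinearPMap_graph_eq]
  · rfl
  · rintro ⟨u, v⟩ huv (rfl : u = 0)
    exact Subtype.ext (A.graph_fst_eq_zero_snd (x := 0) huv rfl)

lemma mem_eigenKer_iff {A : E →ₗ.[ℂ] E} {z : ℂ} {u : A.domain} :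
    u ∈ eigenKer A z ↔ A u = z • (u : E) := by
  simp [eigenKer, sub_eq_zero]

lemma mem_pointSpectrum_iff {A : E →ₗ.[ℂ] E} {z : ℂ} :
    z ∈ pointSpectrum A ↔ ∃ u : E, u ≠ 0 ∧ (u, z • u) ∈ A.graph := by
  unfold pointSpectrum
  rw [Set.mem_ofPred_eq, Submodule.ne_bot_iff]
  constructor
  · rintro ⟨u, hu, h0⟩
    refine ⟨u, fun h => h0 (Subtype.ext h), ?_⟩
    rw [← mem_eigenKer_iff.1 hu]
    exact A.mem_graph u
  · rintro ⟨u, h0, hu⟩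
    obtain ⟨v, rfl, e⟩ := (LinearPMap.mem_graph_iff A).1 hu
    exact ⟨v, mem_eigenKer_iff.2 e, fun h => h0 (by rw [h]; rfl)⟩

lemma pointSpectrum_subset_opSpectrum (A : E →ₗ.[ℂ] E) : pointSpectrum A ⊆ opSpectrum A := by
  intro z hz
  obtain ⟨u, h0, hu⟩ := mem_pointSpectrum_iff.1 hz
  rintro ⟨R, hR⟩
  have := (isResolventAt_iff_graph.1 hR).2 _ _ hu
  rw [sub_self, map_zero] at this
  exact h0 this.symm

/-- A failing lower bound for `A - z` puts `z` into the spectrum. -/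
lemma mem_opSpectrum_of_approx {A : E →ₗ.[ℂ] E} {z : ℂ}
    (h : ∀ δ > 0, ∃ x y, x ≠ 0 ∧ (x, y) ∈ A.graph ∧ ‖y - z • x‖ ≤ δ * ‖x‖) : z ∈ opSpectrum A := by
  rintro ⟨R, hR⟩
  obtain ⟨x, y, hx, hxy, hle⟩ := h (1 / (2 * (‖R‖ + 1))) (by positivity)
  have e := (isResolventAt_iff_graph.1 hR).2 _ _ hxy
  have h1 : ‖x‖ ≤ ‖R‖ * (1 / (2 * (‖R‖ + 1)) * ‖x‖) := by
    calc ‖x‖ = ‖R (y - z • x)‖ := by rw [e]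
      _ ≤ ‖R‖ * ‖y - z • x‖ := R.le_opNorm _
      _ ≤ _ := by gcongr
  have hx' : 0 < ‖x‖ := norm_pos_iff.2 hx
  have h2 : ‖R‖ * (1 / (2 * (‖R‖ + 1)) * ‖x‖) = ‖x‖ * (‖R‖ / (‖R‖ + 1)) / 2 := by
    field_simp
  have h3 : ‖R‖ / (‖R‖ + 1) ≤ 1 := by
    rw [div_le_one (by positivity)]; linarith
  rw [h2] at h1
  nlinarith

end Operators

/-! ### Stieltjes transforms of finite measures -/

section Stieltjes

lemma ofReal_sub_ne_zero {z : ℂ} (hz : z.im ≠ 0) (t : ℝ) : (t : ℂ) - z ≠ 0 := by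
  intro h
  apply hz
  have := congrArg Complex.im h
  simpa using this

lemma norm_inv_ofReal_sub_le {z : ℂ} (hz : z.im ≠ 0) (t : ℝ) :
    ‖((t : ℂ) - z)⁻¹‖ ≤ |z.im|⁻¹ := by
  rw [norm_inv]
  have : |z.im| ≤ ‖(t : ℂ) - z‖ := by
    have := Complex.abs_im_le_norm ((t : ℂ) - z)
    simpa using this
  gcongr

lemma continuous_inv_ofReal_sub {z : ℂ} (hz : z.im ≠ 0) :
    Continuous fun t : ℝ => ((t : ℂ) - z)⁻¹ :=
  Continuous.inv₀ (by fun_prop) (ofReal_sub_ne_zero hz)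

lemma integrable_inv_ofReal_sub (μ : Measure ℝ) [IsFiniteMeasure μ] {z : ℂ} (hz : z.im ≠ 0) :
    Integrable (fun t : ℝ => ((t : ℂ) - z)⁻¹) μ :=
  Integrable.of_bound (continuous_inv_ofReal_sub hz).aestronglyMeasurable _
    (Eventually.of_forall (norm_inv_ofReal_sub_le hz))

lemma im_inv_ofReal_sub (z : ℂ) (t : ℝ) :
    (((t : ℂ) - z)⁻¹).im = z.im / ((t - z.re) ^ 2 + z.im ^ 2) := by
  rw [Complex.inv_im, Complex.normSq_apply]
  simp [sq]

lemma integrable_poisson (μ : Measure ℝ) [IsFiniteMeasure μ] {η : ℝ} (hη : 0 < η) (x : ℝ) :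
    Integrable (fun t : ℝ => η / ((t - x) ^ 2 + η ^ 2)) μ := by
  have := (integrable_inv_ofReal_sub μ (z := ⟨x, η⟩) hη.ne').im
  refine this.congr (Eventually.of_forall fun t => im_inv_ofReal_sub _ t)

lemma im_integral_inv_ofReal_sub (μ : Measure ℝ) [IsFiniteMeasure μ] {z : ℂ} (hz : z.im ≠ 0) :
    (∫ t : ℝ, ((t : ℂ) - z)⁻¹ ∂μ).im = ∫ t : ℝ, z.im / ((t - z.re) ^ 2 + z.im ^ 2) ∂μ := by
  have := integral_im (𝕜 := ℂ) (integrable_inv_ofReal_sub μ hz)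
  simp only [RCLike.im_to_complex, im_inv_ofReal_sub] at this
  exact this.symm

/-- Poisson integrals recover the integrals of bounded continuous functions. -/
lemma tendsto_poisson_integral (μ : Measure ℝ) [IsFiniteMeasure μ] {f : ℝ → ℝ} (hf : Continuous f)
    {C : ℝ} (hC : ∀ x, |f x| ≤ C) :
    Tendsto (fun η : ℝ => ∫ x : ℝ, f x * ∫ t, η / ((t - x) ^ 2 + η ^ 2) ∂μ) (𝓝[>] 0)
      (𝓝 (Real.pi * ∫ t, f t ∂μ)) := by
  -- after Fubini and scaling, `∫∫ f(t + ηs) (1 + s²)⁻¹ ds dμ(t)`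
  have key : ∀ η : ℝ, 0 < η → ∫ x : ℝ, f x * ∫ t, η / ((t - x) ^ 2 + η ^ 2) ∂μ =
      ∫ t, (∫ s : ℝ, f (t + η * s) * (1 + s ^ 2)⁻¹) ∂μ := by
    intro η hη
    have hscale : ∀ (g : ℝ → ℝ) (t : ℝ), ∫ x : ℝ, g x * (η / ((t - x) ^ 2 + η ^ 2)) =
        ∫ s : ℝ, g (t + η * s) * (1 + s ^ 2)⁻¹ := by
      intro g t
      have h1 := integral_add_left_eq_self (μ := (volume : Measure ℝ))
        (fun x => g x * (η / ((t - x) ^ 2 + η ^ 2))) t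
      rw [← h1]
      have h2 := Measure.integral_comp_mul_left
        (fun x => g (t + x) * (η / ((t - (t + x)) ^ 2 + η ^ 2))) η
      rw [abs_of_pos (inv_pos.2 hη), smul_eq_mul] at h2
      have h3 : ∫ x : ℝ, g (t + x) * (η / ((t - (t + x)) ^ 2 + η ^ 2)) =
          η * ∫ x : ℝ, g (t + η * x) * (η / ((t - (t + η * x)) ^ 2 + η ^ 2)) := by
        rw [h2, mul_inv_cancel_left₀ hη.ne']
      rw [h3, ← integral_const_mul]
      refine integral_congr_ae (Eventually.of_forall fun s => ?_)
      simp only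
      field_simp
      ring
    have hswap : ∫ x : ℝ, (∫ t, f x * (η / ((t - x) ^ 2 + η ^ 2)) ∂μ) =
        ∫ t, (∫ x : ℝ, f x * (η / ((t - x) ^ 2 + η ^ 2))) ∂μ := by
      refine integral_integral_swap ?_
      have hmeas : AEStronglyMeasurable
          (Function.uncurry fun x t : ℝ => f x * (η / ((t - x) ^ 2 + η ^ 2)))
          ((volume : Measure ℝ).prod μ) := by
        refine Continuous.aestronglyMeasurable ?_
        unfold Function.uncurry
        refine Continuous.mul (by fun_prop) (Continuous.div (by fun_prop) (by fun_prop) ?_)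
        intro p; positivity
      rw [integrable_prod_iff' hmeas]
      have hdom : ∀ t, Integrable (fun x : ℝ => f x * (η / ((t - x) ^ 2 + η ^ 2))) := by
        intro t
        have h0 : Integrable fun x : ℝ => C * (η / ((t - x) ^ 2 + η ^ 2)) := by
          refine Integrable.const_mul ?_ C
          have h1 := ((integrable_inv_one_add_sq.comp_mul_left' (inv_ne_zero hη.ne')).comp_sub_left
            t).const_mul η⁻¹
          refine h1.congr (Eventually.of_forall fun x => ?_)
          simp only
          field_simp
          ring
        refine h0.mono' ?_ (Eventually.of_forall fun x => ?_)
        · refine Continuous.aestronglyMeasurable ?_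
          refine Continuous.mul hf (Continuous.div (by fun_prop) (by fun_prop) ?_)
          intro p; positivity
        · rw [norm_mul, Real.norm_eq_abs, Real.norm_eq_abs,
            abs_of_nonneg (a := η / ((t - x) ^ 2 + η ^ 2)) (by positivity)]
          gcongr
          exact hC x
      refine ⟨Eventually.of_forall hdom, ?_⟩
      refine Integrable.of_bound (C := C * Real.pi)
        hmeas.norm.prod_swap.integral_prod_right' (Eventually.of_forall fun t => ?_)
      have hnn : ∀ x, ‖Function.uncurry (fun x t : ℝ => f x * (η / ((t - x) ^ 2 + η ^ 2))) (x, t)‖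
          = |f x| * (η / ((t - x) ^ 2 + η ^ 2)) := by
        intro x
        simp only [Function.uncurry, norm_mul, Real.norm_eq_abs]
        rw [abs_of_nonneg (a := η / ((t - x) ^ 2 + η ^ 2)) (by positivity)]
      simp only [hnn]
      rw [hscale (fun x => |f x|) t, Real.norm_of_nonneg
        (integral_nonneg fun s => by positivity), ← integral_univ_inv_one_add_sq,
        ← integral_const_mul]
      refine integral_mono_of_nonneg (Eventually.of_forall fun s => by positivity)
        (integrable_inv_one_add_sq.const_mul C) (Eventually.of_forall fun s => ?_)
      simp only
      gcongr
      exact hC _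
    simp only [← integral_const_mul]
    rw [hswap]
    exact integral_congr_ae (Eventually.of_forall fun t => hscale f t)
  have hC0 : 0 ≤ C := (abs_nonneg _).trans (hC 0)
  have hbd : ∀ (η t s : ℝ), ‖f (t + η * s) * (1 + s ^ 2)⁻¹‖ ≤ C * (1 + s ^ 2)⁻¹ := by
    intro η t s
    rw [norm_mul, Real.norm_eq_abs, Real.norm_of_nonneg (by positivity : 0 ≤ (1 + s ^ 2)⁻¹)]
    gcongr
    exact hC _
  have hcont : ∀ η : ℝ, Continuous (Function.uncurry fun t s : ℝ =>
      f (t + η * s) * (1 + s ^ 2)⁻¹) := by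
    intro η
    unfold Function.uncurry
    refine Continuous.mul (by fun_prop) (Continuous.inv₀ (by fun_prop) ?_)
    intro p; positivity
  have lim1 : ∀ t : ℝ, Tendsto (fun η : ℝ => ∫ s : ℝ, f (t + η * s) * (1 + s ^ 2)⁻¹) (𝓝[>] 0)
      (𝓝 (f t * Real.pi)) := by
    intro t
    rw [← integral_univ_inv_one_add_sq, ← integral_const_mul]
    refine tendsto_integral_filter_of_dominated_convergence (fun s => C * (1 + s ^ 2)⁻¹)
      (Eventually.of_forall fun η => ?_) (Eventually.of_forall fun η => Eventually.of_forall
        fun s => hbd η t s) (integrable_inv_one_add_sq.const_mul C) (Eventually.of_forall fun s => ?_)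
    · exact ((hcont η).comp (Continuous.prodMk_right t)).aestronglyMeasurable
    · refine Tendsto.mul_const _ ?_
      have : Tendsto (fun η : ℝ => f (t + η * s)) (𝓝 0) (𝓝 (f (t + 0 * s))) :=
        (hf.comp (by fun_prop : Continuous fun η : ℝ => t + η * s)).tendsto 0
      rw [zero_mul, add_zero] at this
      exact this.mono_left nhdsWithin_le_nhds
  have lim2 : Tendsto (fun η : ℝ => ∫ t, (∫ s : ℝ, f (t + η * s) * (1 + s ^ 2)⁻¹) ∂μ) (𝓝[>] 0)
      (𝓝 (∫ t, f t * Real.pi ∂μ)) := by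
    refine tendsto_integral_filter_of_dominated_convergence (fun _ => C * Real.pi)
      (Eventually.of_forall fun η => ?_) (Eventually.of_forall fun η => Eventually.of_forall
        fun t => ?_) (integrable_const _) (Eventually.of_forall lim1)
    · exact ((hcont η).aestronglyMeasurable (μ := μ.prod volume)).integral_prod_right'
    · rw [← integral_univ_inv_one_add_sq, ← integral_const_mul]
      exact norm_integral_le_of_norm_le (integrable_inv_one_add_sq.const_mul C)
        (Eventually.of_forall fun s => hbd η t s)
  rw [integral_mul_const, mul_comm] at lim2
  refine lim2.congr' ?_
  filter_upwards [self_mem_nhdsWithin] with η hη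
  exact (key η hη).symm

/-- A finite measure on the line is determined by its Stieltjes transform. -/
lemma measure_eq_of_stieltjes {μ ν : Measure ℝ} [IsFiniteMeasure μ] [IsFiniteMeasure ν]
    (h : ∀ z : ℂ, z.im ≠ 0 → ∫ t : ℝ, ((t : ℂ) - z)⁻¹ ∂μ = ∫ t : ℝ, ((t : ℂ) - z)⁻¹ ∂ν) :
    μ = ν := by
  refine ext_of_forall_integral_eq_of_IsFiniteMeasure fun f => ?_
  have hC : ∀ x, |f x| ≤ ‖f‖ := fun x => f.norm_coe_le_norm x
  have h1 := tendsto_poisson_integral μ f.continuous hC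
  have h2 := tendsto_poisson_integral ν f.continuous hC
  have : ∀ᶠ η in 𝓝[>] (0 : ℝ), ∫ x : ℝ, f x * ∫ t, η / ((t - x) ^ 2 + η ^ 2) ∂μ =
      ∫ x : ℝ, f x * ∫ t, η / ((t - x) ^ 2 + η ^ 2) ∂ν := by
    filter_upwards [self_mem_nhdsWithin] with η hη
    have hη' : (0 : ℝ) < η := hη
    congr 1
    ext x
    have e := congrArg Complex.im (h ⟨x, η⟩ hη'.ne')
    rw [im_integral_inv_ofReal_sub μ hη'.ne', im_integral_inv_ofReal_sub ν hη'.ne'] at e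
    rw [e]
  exact mul_left_cancel₀ Real.pi_ne_zero (tendsto_nhds_unique (h1.congr' this) h2)

/-- A finite measure is absolutely continuous on the set of points near which its Poisson
integral stays bounded. -/
lemma absolutelyContinuous_restrict_of_poisson_bounded {μ : Measure ℝ} [IsFiniteMeasure μ]
    {U : Set ℝ}
    (h : ∀ x ∈ U, ∃ C : ℝ, ∀ᶠ η in 𝓝[>] (0 : ℝ), ∫ t, η / ((t - x) ^ 2 + η ^ 2) ∂μ ≤ C)
    {N : Set ℝ} (hN : volume N = 0) (hNU : N ⊆ U) : μ N = 0 := by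
  -- countably many pieces of `N`, on each of which one bound serves all points
  choose! C hC using h
  have hcover : N ⊆ ⋃ n : ℕ, {x ∈ N | C x ≤ n} := by
    intro x hx
    obtain ⟨n, hn⟩ := exists_nat_ge (C x)
    exact Set.mem_iUnion.2 ⟨n, hx, hn⟩
  refine measure_mono_null hcover (measure_iUnion_null fun n => ?_)
  have hle : μ {x ∈ N | C x ≤ n} ≤ (((n : NNReal)) • (volume : Measure ℝ)) {x ∈ N | C x ≤ n} := by
    -- Besicovitch differentiation: it suffices to compare `μ` with `n * volume` on small balls
    refine (Besicovitch.vitaliFamily μ).measure_le_of_frequently_le _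
      (Measure.AbsolutelyContinuous.refl _) _ ?_
    rintro x ⟨hx, hxn⟩
    refine (Besicovitch.tendsto_filterAt μ x).frequently (Eventually.frequently ?_)
    filter_upwards [hC x (hNU hx), self_mem_nhdsWithin] with η hη hpos
    have hpos' : (0 : ℝ) < η := hpos
    -- the Poisson kernel is at least `1 / (2η)` on the ball of radius `η`
    have h1 : μ.real (Metric.closedBall x η) * (1 / (2 * η)) ≤ n := by
      calc μ.real (Metric.closedBall x η) * (1 / (2 * η))
          = ∫ t, (Metric.closedBall x η).indicator (fun _ => 1 / (2 * η)) t ∂μ := by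
            rw [integral_indicator_const _ Metric.isClosed_closedBall.measurableSet, smul_eq_mul]
        _ ≤ ∫ t, η / ((t - x) ^ 2 + η ^ 2) ∂μ := by
            refine integral_mono_of_nonneg (Eventually.of_forall fun t => ?_)
              (integrable_poisson μ hpos' x) (Eventually.of_forall fun t => ?_)
            · exact Set.indicator_nonneg (fun _ _ => by positivity) t
            · by_cases ht : t ∈ Metric.closedBall x η
              · rw [Set.indicator_of_mem ht, div_le_div_iff₀ (by positivity) (by positivity)]
                rw [Metric.mem_closedBall, Real.dist_eq] at ht
                have := sq_le_sq' (abs_le.1 ht).1 (abs_le.1 ht).2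
                nlinarith
              · rw [Set.indicator_of_notMem ht]
                positivity
        _ ≤ n := hη.trans hxn
    have h2 : μ.real (Metric.closedBall x η) ≤ n * (2 * η) := by
      rw [mul_one_div, div_le_iff₀ (by positivity)] at h1
      exact h1
    rw [← ENNReal.ofReal_toReal (measure_ne_top μ (Metric.closedBall x η))]
    rw [Measure.smul_apply, Real.volume_closedBall]
    calc ENNReal.ofReal (μ.real (Metric.closedBall x η)) ≤ ENNReal.ofReal (n * (2 * η)) :=
          ENNReal.ofReal_le_ofReal h2
      _ = _ := by
          rw [ENNReal.ofReal_mul (by positivity)]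
          simp [ENNReal.smul_def]
  have h0 : (volume : Measure ℝ) {x ∈ N | C x ≤ n} = 0 :=
    measure_mono_null (Set.sep_subset _ _) hN
  rw [Measure.smul_apply, h0, smul_zero] at hle
  exact le_antisymm hle bot_le

/-- The mass of a point is recovered from the Stieltjes transform. -/
lemma tendsto_stieltjes_atom (μ : Measure ℝ) [IsFiniteMeasure μ] (x : ℝ) :
    Tendsto (fun η : ℝ => -(Complex.I * η) * ∫ t : ℝ, ((t : ℂ) - (x + Complex.I * η))⁻¹ ∂μ) (𝓝[>] 0)
      (𝓝 ((μ.real {x} : ℝ) : ℂ)) := by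
  have hlim : ((μ.real {x} : ℝ) : ℂ) = ∫ t : ℝ, ({x} : Set ℝ).indicator (fun _ => (1 : ℂ)) t ∂μ := by
    rw [integral_indicator_const _ (measurableSet_singleton x)]
    simp
  rw [hlim]
  simp only [← integral_const_mul]
  refine tendsto_integral_filter_of_dominated_convergence (fun _ => 1) ?_ ?_
    (integrable_const _) (Eventually.of_forall fun t => ?_)
  · filter_upwards [self_mem_nhdsWithin] with η hη
    refine Continuous.aestronglyMeasurable (continuous_const.mul (continuous_inv_ofReal_sub ?_))
    simpa using (ne_of_gt (show (0 : ℝ) < η from hη))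
  · filter_upwards [self_mem_nhdsWithin] with η hη
    have hη' : (0 : ℝ) < η := hη
    refine Eventually.of_forall fun t => ?_
    have := norm_inv_ofReal_sub_le (z := (x : ℂ) + Complex.I * η) (by simpa using hη'.ne') t
    rw [norm_mul]
    simp only [norm_neg, norm_mul, Complex.norm_I, one_mul, Complex.norm_real, Real.norm_eq_abs]
    simp only [Complex.add_im, Complex.ofReal_im, zero_add, Complex.mul_im, Complex.I_re,
      Complex.I_im, Complex.ofReal_re, one_mul, zero_mul] at this
    calc |η| * ‖((t : ℂ) - (x + Complex.I * η))⁻¹‖ ≤ |η| * |η|⁻¹ := by gcongr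
      _ = 1 := mul_inv_cancel₀ (abs_ne_zero.2 hη'.ne')
  · by_cases ht : t = x
    · rw [Set.indicator_of_mem (by simp [ht])]
      refine tendsto_const_nhds.congr' ?_
      filter_upwards [self_mem_nhdsWithin] with η hη
      have hη' : (η : ℂ) ≠ 0 := Complex.ofReal_ne_zero.2 (ne_of_gt (show (0 : ℝ) < η from hη))
      have : (t : ℂ) - (x + Complex.I * η) = -(Complex.I * η) := by rw [ht]; ring
      rw [this, mul_inv_cancel₀ (neg_ne_zero.2 (mul_ne_zero Complex.I_ne_zero hη'))]
    · rw [Set.indicator_of_notMem (by simpa using ht)]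
      have hc : ContinuousAt (fun η : ℝ => -(Complex.I * η) *
          ((t : ℂ) - (x + Complex.I * η))⁻¹) 0 := by
        refine ContinuousAt.mul (by fun_prop) (ContinuousAt.inv₀ (by fun_prop) ?_)
        simpa [sub_eq_zero] using ht
      have := hc.tendsto
      simp only [Complex.ofReal_zero, mul_zero, neg_zero, zero_mul] at this
      exact this.mono_left nhdsWithin_le_nhds

end Stieltjes

/-! ### Spectral measures of self-adjoint operators -/

section SpectralMeasure

variable {E : Type*} [NormedAddCommGroup E] [InnerProductSpace ℂ E] [CompleteSpace E]

open scoped CompactlySupported in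
/-- The functional calculus of a normal operator is given by a measure on the spectrum: the
Riesz–Markov theorem applies, since a nonnegative function is a square and goes to a positive
operator. -/
lemma exists_measure_cfcHom {T : E →L[ℂ] E} (hT : IsStarNormal T) (ψ : E) :
    ∃ ν : Measure (spectrum ℂ T), IsFiniteMeasure ν ∧
      ∀ g : C(spectrum ℂ T, ℂ), inner ℂ ψ (cfcHom hT g ψ) = ∫ s, g s ∂ν := by
  have : CompactSpace (spectrum ℂ T) := isCompact_iff_compactSpace.1 (spectrum.isCompact T)
  let toC : C(spectrum ℂ T, ℝ) → C(spectrum ℂ T, ℂ) := fun f => ⟨fun s => (f s : ℂ), by fun_prop⟩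
  have hreal : ∀ f : C(spectrum ℂ T, ℝ), (inner ℂ ψ (cfcHom hT (toC f) ψ) : ℂ) =
      (((inner ℂ ψ (cfcHom hT (toC f) ψ) : ℂ).re : ℝ) : ℂ) := by
    intro f
    have hs : star (toC f) = toC f := by
      ext s; simp [toC]
    have h1 : star (cfcHom hT (toC f)) = cfcHom hT (toC f) := by rw [← map_star, hs]
    have h2 : (starRingEnd ℂ) (inner ℂ ψ (cfcHom hT (toC f) ψ)) =
        inner ℂ ψ (cfcHom hT (toC f) ψ) := by
      rw [inner_conj_symm]
      conv_lhs => rw [← h1]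
      rw [ContinuousLinearMap.star_eq_adjoint, ContinuousLinearMap.adjoint_inner_left]
    exact (Complex.conj_eq_iff_re.1 h2).symm
  have hpos : ∀ f : C(spectrum ℂ T, ℝ), 0 ≤ f → 0 ≤ (inner ℂ ψ (cfcHom hT (toC f) ψ) : ℂ).re := by
    intro f hf
    let r : C(spectrum ℂ T, ℝ) := ⟨fun s => √(f s), by fun_prop⟩
    have hr : toC f = star (toC r) * toC r := by
      ext s
      have : (f s : ℂ) = ((√(f s) * √(f s) : ℝ) : ℂ) := by rw [Real.mul_self_sqrt (show 0 ≤ f s from hf s)]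
      simp [toC, r, this]
    rw [hr, map_mul, map_star, mul_apply_eq_comp, ContinuousLinearMap.star_eq_adjoint,
      ContinuousLinearMap.adjoint_inner_right, inner_self_eq_norm_sq_to_K]
    simp only [Complex.coe_algebraMap, ← Complex.ofReal_pow, Complex.ofReal_re]
    positivity
  let Λ₀ : C_c(spectrum ℂ T, ℝ) →ₗ[ℝ] ℝ :=
    { toFun := fun f => (inner ℂ ψ (cfcHom hT (toC f.toContinuousMap) ψ) : ℂ).re
      map_add' := fun f g => by
        have : toC (f + g).toContinuousMap = toC f.toContinuousMap + toC g.toContinuousMap := by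
          ext s; simp [toC]
        rw [this, map_add, add_apply, inner_add_right, Complex.add_re]
      map_smul' := fun a f => by
        have : toC (a • f).toContinuousMap = (a : ℂ) • toC f.toContinuousMap := by
          ext s; simp [toC]
        rw [this, map_smul, smul_apply, inner_smul_right]
        simp }
  let Λ : C_c(spectrum ℂ T, ℝ) →ₚ[ℝ] ℝ := PositiveLinearMap.mk₀ Λ₀ fun f hf => hpos _ hf
  have hfin : IsFiniteMeasure (RealRMK.rieszMeasure Λ) := by
    infer_instance
  have hreal2 : ∀ f : C(spectrum ℂ T, ℝ), (inner ℂ ψ (cfcHom hT (toC f) ψ) : ℂ) =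
      ∫ s, ((f s : ℝ) : ℂ) ∂(RealRMK.rieszMeasure Λ) := by
    intro f
    rw [hreal, integral_complex_ofReal]
    congr 1
    exact (RealRMK.integral_rieszMeasure Λ
      (⟨f, HasCompactSupport.of_compactSpace _⟩ : C_c(spectrum ℂ T, ℝ))).symm
  refine ⟨RealRMK.rieszMeasure Λ, hfin, fun g => ?_⟩
  let u : C(spectrum ℂ T, ℝ) := ⟨fun s => (g s).re, by fun_prop⟩
  let v : C(spectrum ℂ T, ℝ) := ⟨fun s => (g s).im, by fun_prop⟩
  have hg : g = toC u + Complex.I • toC v := by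
    ext s
    simp [toC, u, v, mul_comm Complex.I, Complex.re_add_im]
  have hi : ∀ f : C(spectrum ℂ T, ℝ), Integrable (fun s => ((f s : ℝ) : ℂ))
      (RealRMK.rieszMeasure Λ) := fun f =>
    Integrable.of_bound (Continuous.aestronglyMeasurable (by fun_prop)) ‖f‖
      (Eventually.of_forall fun s => by
        rw [Complex.norm_real]; exact f.norm_coe_le_norm s)
  conv_lhs => rw [hg]
  rw [map_add, map_smul, add_apply, smul_apply,
    inner_add_right, inner_smul_right, hreal2, hreal2, ← integral_const_mul,
    ← integral_add (hi u) ((hi v).const_mul _)]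
  refine integral_congr_ae (Eventually.of_forall fun s => ?_)
  simp [u, v, mul_comm Complex.I, Complex.re_add_im]

/-- A resolvent at a real point is a self-adjoint bounded operator. -/
lemma IsResolventAt.isSelfAdjoint {A : E →ₗ.[ℂ] E} (hA : IsSelfAdjoint A) {c : ℝ}
    {T : E →L[ℂ] E} (h : IsResolventAt A c T) : IsSelfAdjoint T := by
  rw [ContinuousLinearMap.isSelfAdjoint_iff_isSymmetric]
  intro φ ψ
  exact h.inner_symm hA (by simpa using h) φ ψ

/-- Existence of spectral measures: the functional calculus of a bounded resolvent, transported
by `s ↦ s⁻¹ + c`. -/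
lemma exists_isSpectralMeasure {A : E →ₗ.[ℂ] E} (hA : IsSelfAdjoint A)
    (hR : ∀ z : ℂ, z.im ≠ 0 → ∃ R : E →L[ℂ] E, IsResolventAt A z R) {c : ℝ} {T : E →L[ℂ] E}
    (hT : IsResolventAt A c T) (ψ : E) :
    ∃ μ : Measure ℝ, IsSpectralMeasure A ψ μ ∧ μ.real Set.univ ≤ ‖ψ‖ ^ 2 := by
  have hsa := hT.isSelfAdjoint hA
  obtain ⟨ν, hν, hint⟩ := exists_measure_cfcHom hsa.isStarNormal ψ
  have hre : ∀ s : spectrum ℂ T, (s : ℂ) = ((s : ℂ).re : ℂ) := fun s =>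
    hsa.mem_spectrum_eq_re s.2
  -- the spectral value `0` of `T` corresponds to infinity in the spectrum of `A`
  let S : Set (spectrum ℂ T) := {s | (s : ℂ).re ≠ 0}
  have hSm : MeasurableSet S := by
    have : Measurable fun s : spectrum ℂ T => (s : ℂ).re := by fun_prop
    exact this (measurableSet_singleton 0).compl
  let τ : spectrum ℂ T → ℝ := fun s => (s : ℂ).re⁻¹ + c
  have hτ : Measurable τ := by fun_prop
  refine ⟨(ν.restrict S).map τ, ⟨inferInstance, fun z hz => ?_⟩, ?_⟩
  · obtain ⟨R, hRz⟩ := hR z hz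
    refine ⟨R, hRz, ?_⟩
    have hne : ∀ s : spectrum ℂ T, 1 - (z - c) * (s : ℂ) ≠ 0 := by
      intro s h0
      rw [hre s] at h0
      by_cases h : (s : ℂ).re = 0
      · simp [h] at h0
      · have := congrArg Complex.im h0
        simp only [Complex.sub_im, Complex.one_im, Complex.im_mul_ofReal, Complex.ofReal_im,
          Complex.zero_im, sub_zero, zero_sub, neg_eq_zero, mul_eq_zero] at this
        exact this.elim hz h
    -- `(t - z)⁻¹ = s / (1 - (z - c) s)` for `t = s⁻¹ + c`
    let g : C(spectrum ℂ T, ℂ) := ⟨fun s => (s : ℂ) / (1 - (z - c) * (s : ℂ)),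
      Continuous.div (by fun_prop) (by fun_prop) hne⟩
    let idm : C(spectrum ℂ T, ℂ) := (ContinuousMap.id ℂ).restrict (spectrum ℂ T)
    have hid : cfcHom hsa.isStarNormal idm = T := cfcHom_id (R := ℂ) hsa.isStarNormal
    have hg : g * (1 - (z - c) • idm) = idm := by
      ext s
      simp only [ContinuousMap.mul_apply, ContinuousMap.sub_apply, ContinuousMap.one_apply,
        ContinuousMap.smul_apply, smul_eq_mul, g, idm, ContinuousMap.coe_mk,
        ContinuousMap.restrict_apply, ContinuousMap.id_apply]
      exact div_mul_cancel₀ _ (hne s)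
    have hgR : cfcHom hsa.isStarNormal g = R := by
      have h1 := congrArg (cfcHom hsa.isStarNormal) hg
      rw [map_mul, map_sub, map_one, map_smul, hid] at h1
      have h2 := hRz.one_sub_mul hT
      have h3 := hRz.mul_one_sub hT
      -- `1 + (z - c) R` is a right inverse of `1 - (z - c) T`
      have h4 : (1 - (z - c) • T) * (1 + (z - c) • R) = 1 := by
        rw [mul_add, mul_one, mul_smul_comm, h2]; abel
      calc cfcHom hsa.isStarNormal g
          = cfcHom hsa.isStarNormal g * ((1 - (z - c) • T) * (1 + (z - c) • R)) := by
            rw [h4, mul_one]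
        _ = R * ((1 - (z - c) • T) * (1 + (z - c) • R)) := by
            rw [← mul_assoc, h1, ← mul_assoc, h3]
        _ = R := by rw [h4, mul_one]
    rw [integral_map hτ.aemeasurable
      (continuous_inv_ofReal_sub hz).aestronglyMeasurable, ← hgR, hint,
      ← integral_indicator hSm]
    refine integral_congr_ae (Eventually.of_forall fun s => ?_)
    by_cases hs : (s : ℂ).re = 0
    · rw [Set.indicator_of_notMem (by simpa [S] using hs)]
      simp only [g, ContinuousMap.coe_mk]
      rw [hre s, hs]; simp
    · rw [Set.indicator_of_mem (by simpa [S] using hs)]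
      simp only [g, ContinuousMap.coe_mk, τ]
      have hs' : (s : ℂ) ≠ 0 := fun h => hs (by rw [h]; rfl)
      have e : (((s : ℂ).re⁻¹ + c : ℝ) : ℂ) - z = (1 - (z - c) * (s : ℂ)) / (s : ℂ) := by
        push_cast
        rw [← hre s]
        field_simp
        ring
      rw [e, inv_div]
  · have h1 := hint 1
    rw [map_one, one_apply_eq_self, inner_self_eq_norm_sq_to_K] at h1
    have h2 : ν.real Set.univ = ‖ψ‖ ^ 2 := by
      have : ((‖ψ‖ ^ 2 : ℝ) : ℂ) = ((ν.real Set.univ : ℝ) : ℂ) := by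
        simpa using h1
      exact_mod_cast this.symm
    rw [← h2, map_measureReal_apply hτ MeasurableSet.univ, Set.preimage_univ]
    exact ENNReal.toReal_mono (measure_ne_top _ _) (Measure.restrict_apply_le _ _)

end SpectralMeasure

/-! ### Spectral measures and eigenspaces -/

section SpectralTypes

variable {E : Type*} [NormedAddCommGroup E] [InnerProductSpace ℂ E]

/-- The eigenspace of `A` at `z`, as a subspace of the whole space. -/
def eigenspaceOf (A : E →ₗ.[ℂ] E) (z : ℂ) : Submodule ℂ E where
  carrier := {u | (u, z • u) ∈ A.graph}
  add_mem' := fun {u v} hu hv => by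
    have := A.graph.add_mem hu hv
    simpa [smul_add] using this
  zero_mem' := by
    rw [Set.mem_ofPred_eq, smul_zero]
    exact A.graph.zero_mem
  smul_mem' := fun a u hu => by
    have := A.graph.smul_mem a hu
    rw [Prod.smul_mk, smul_comm] at this
    exact this

lemma mem_eigenspaceOf {A : E →ₗ.[ℂ] E} {z : ℂ} {u : E} :
    u ∈ eigenspaceOf A z ↔ (u, z • u) ∈ A.graph := Iff.rfl

lemma IsSpectralMeasure.inner_eq {A : E →ₗ.[ℂ] E} {ψ : E} {μ : Measure ℝ}
    (h : IsSpectralMeasure A ψ μ) {z : ℂ} (hz : z.im ≠ 0) {R : E →L[ℂ] E}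
    (hR : IsResolventAt A z R) : inner ℂ ψ (R ψ) = ∫ t : ℝ, ((t : ℂ) - z)⁻¹ ∂μ := by
  obtain ⟨R', hR', e⟩ := h.2 z hz
  rw [hR.unique hR', e]

/-- The spectral measures satisfy the parallelogram law, which bounds the spectral measure of a
sum. -/
lemma IsSpectralMeasure.add_le {A : E →ₗ.[ℂ] E} {ψ φ : E} {μ ν ρ σ : Measure ℝ}
    (hψ : IsSpectralMeasure A ψ μ) (hφ : IsSpectralMeasure A φ ν)
    (hadd : IsSpectralMeasure A (ψ + φ) ρ) (hsub : IsSpectralMeasure A (ψ - φ) σ) (s : Set ℝ) :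
    ρ s ≤ 2 * (μ s + ν s) := by
  have := hψ.1
  have := hφ.1
  have := hadd.1
  have := hsub.1
  have key : ρ + σ = (μ + ν) + (μ + ν) := by
    refine measure_eq_of_stieltjes fun z hz => ?_
    obtain ⟨R, hR, -⟩ := hψ.2 z hz
    have hi := fun (m : Measure ℝ) [IsFiniteMeasure m] => integrable_inv_ofReal_sub m hz
    rw [integral_add_measure (hi ρ) (hi σ), integral_add_measure (hi (μ + ν)) (hi (μ + ν)),
      integral_add_measure (hi μ) (hi ν), ← hψ.inner_eq hz hR, ← hφ.inner_eq hz hR,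
      ← hadd.inner_eq hz hR, ← hsub.inner_eq hz hR]
    simp only [map_add, map_sub, inner_add_left, inner_add_right, inner_sub_left, inner_sub_right]
    ring
  calc ρ s ≤ (ρ + σ) s := by rw [Measure.add_apply]; exact le_self_add
    _ = 2 * (μ s + ν s) := by rw [key, two_mul]; rfl

/-- If the resolvent form of a dense set of vectors stays bounded near the points of `U`, then all
spectral measures are absolutely continuous on `U`. -/
lemma IsSpectralMeasure.null_of_dense {A : E →ₗ.[ℂ] E} {U : Set ℝ}
    (hex : ∀ ψ : E, ∃ μ : Measure ℝ, IsSpectralMeasure A ψ μ ∧ μ.real Set.univ ≤ ‖ψ‖ ^ 2)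
    (hdense : Dense {ψ : E | ∀ x ∈ U, ∃ C : ℝ, ∀ᶠ η : ℝ in 𝓝[>] 0, ∀ R : E →L[ℂ] E,
      IsResolventAt A (x + Complex.I * η) R → (inner ℂ ψ (R ψ) : ℂ).im ≤ C})
    {ψ : E} {μ : Measure ℝ} (h : IsSpectralMeasure A ψ μ) {N : Set ℝ} (hN : volume N = 0)
    (hNU : N ⊆ U) : μ N = 0 := by
  refine le_antisymm (ENNReal.le_of_forall_pos_le_add fun ε hε _ => ?_) bot_le
  rw [zero_add]
  obtain ⟨φ, hφ, hdist⟩ := hdense.exists_dist_lt ψ (Real.sqrt_pos.2 (by positivity :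
    (0 : ℝ) < (ε : ℝ) / 2))
  obtain ⟨ν, hν, -⟩ := hex φ
  obtain ⟨ρ, hρ, hρm⟩ := hex (ψ - φ)
  obtain ⟨σ, hσ, -⟩ := hex (φ - (ψ - φ))
  have := hν.1
  have := hρ.1
  have hν0 : ν N = 0 := by
    refine absolutelyContinuous_restrict_of_poisson_bounded (fun x hx => ?_) hN hNU
    obtain ⟨C, hC⟩ := hφ x hx
    refine ⟨C, ?_⟩
    filter_upwards [hC, self_mem_nhdsWithin] with η h1 hη
    have hη' : (0 : ℝ) < η := hη
    have hz : ((x : ℂ) + Complex.I * η).im ≠ 0 := by simpa using hη'.ne'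
    obtain ⟨R, hR, e⟩ := hν.2 _ hz
    have h2 := h1 R hR
    rw [e, im_integral_inv_ofReal_sub ν hz] at h2
    simpa using h2
  -- `ψ = φ + (ψ - φ)`, where `φ` does not charge `N` and `ψ - φ` is small
  have hle := hν.add_le hρ (ρ := μ) (by simpa using h) hσ N
  rw [hν0, zero_add] at hle
  refine hle.trans ?_
  have h1 : ρ.real N ≤ ε / 2 := by
    refine (measureReal_mono (Set.subset_univ N)).trans (hρm.trans ?_)
    rw [dist_eq_norm] at hdist
    calc (‖ψ - φ‖ ^ 2 : ℝ) ≤ √((ε : ℝ) / 2) ^ 2 := by gcongr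
      _ = (ε : ℝ) / 2 := Real.sq_sqrt (by positivity)
  rw [← ENNReal.ofReal_toReal (measure_ne_top ρ N)]
  calc 2 * ENNReal.ofReal (ρ.real N) ≤ 2 * ENNReal.ofReal ((ε : ℝ) / 2) := by gcongr
    _ = ε := by
      rw [← ENNReal.ofReal_ofNat, ← ENNReal.ofReal_mul (by norm_num)]
      rw [mul_div_cancel₀ _ (by norm_num)]
      exact ENNReal.ofReal_coe_nnreal

/-- An operator which is a resolvent on a subspace `K` is the resolvent of the part in `K`. -/
lemma isResolventAt_partOn {A : E →ₗ.[ℂ] E} {K : Submodule ℂ E} {z : ℂ} (S : E →L[ℂ] E)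
    (hSK : ∀ ψ ∈ K, S ψ ∈ K) (h1 : ∀ ψ ∈ K, (S ψ, ψ + z • S ψ) ∈ A.graph)
    (h2 : ∀ x y, x ∈ K → y ∈ K → (x, y) ∈ A.graph → S (y - z • x) = x) :
    ∃ R : K →L[ℂ] K, IsResolventAt (partOn A K) z R := by
  refine ⟨(S.comp K.subtypeL).codRestrict K fun ψ => hSK _ ψ.2, ?_⟩
  rw [isResolventAt_iff_graph]
  refine ⟨fun ψ => mem_partOn_graph.2 ?_, fun x y hxy => Subtype.ext ?_⟩
  · exact h1 _ ψ.2
  · exact h2 _ _ x.2 y.2 (mem_partOn_graph.1 hxy)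

/-- A spectral value of a resolvent comes from a spectral value of the operator. -/
lemma mem_opSpectrum_of_mem_spectrum {A : E →ₗ.[ℂ] E} {c s : ℂ} {T : E →L[ℂ] E}
    (hT : IsResolventAt A c T) (hs : s ≠ 0) (h : s ∈ spectrum ℂ T) : c + s⁻¹ ∈ opSpectrum A := by
  rintro ⟨R, hR⟩
  apply h
  have h1 := hR.one_sub_mul hT
  have h2 := hR.mul_one_sub hT
  have e : c + s⁻¹ - c = s⁻¹ := by ring
  rw [e] at h1 h2
  have hu : IsUnit (1 - s⁻¹ • T) := by
    refine ⟨⟨1 - s⁻¹ • T, 1 + s⁻¹ • R, ?_, ?_⟩, rfl⟩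
    · rw [mul_add, mul_one, mul_smul_comm, h1]; abel
    · rw [add_mul, one_mul, smul_mul_assoc, h2]; abel
  have e2 : algebraMap ℂ (E →L[ℂ] E) s - T = algebraMap ℂ (E →L[ℂ] E) s * (1 - s⁻¹ • T) := by
    rw [mul_sub, mul_one, mul_smul_comm, Algebra.algebraMap_eq_smul_one, smul_mul_assoc, one_mul,
      smul_smul, inv_mul_cancel₀ hs, one_smul]
  rw [spectrum.mem_resolventSet_iff, e2]
  exact ((isUnit_iff_ne_zero.2 hs).map _).mul hu

variable [CompleteSpace E]

/-- The spectral measure of a vector orthogonal to the eigenspace at `x` does not charge `x`. -/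
lemma IsSpectralMeasure.atom_eq_zero {A : E →ₗ.[ℂ] E} (hA : IsSelfAdjoint A) {ψ : E}
    {μ : Measure ℝ} (h : IsSpectralMeasure A ψ μ) {x : ℝ} (hψ : ψ ∈ (eigenspaceOf A x)ᗮ) :
    μ {x} = 0 := by
  have := h.1
  let K : Submodule ℂ E := A.graph.map (LinearMap.snd ℂ E E - (x : ℂ) • LinearMap.fst ℂ E E)
  have hK : Kᗮ ≤ eigenspaceOf A x := by
    intro u hu
    refine mem_graph_of_inner_symm hA fun x' y' h' => ?_
    have : inner ℂ (y' - (x : ℂ) • x') u = (0 : ℂ) :=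
      (Submodule.mem_orthogonal _ _).1 hu _ ⟨(x', y'), h', rfl⟩
    rw [inner_sub_left, inner_smul_left, Complex.conj_ofReal, sub_eq_zero] at this
    rw [this, inner_smul_right]
  have hcl : ψ ∈ closure (K : Set E) := by
    have : ψ ∈ Kᗮᗮ := Submodule.orthogonal_le hK hψ
    rw [Submodule.orthogonal_orthogonal_eq_closure] at this
    exact this
  have hle : ∀ δ > 0, μ.real {x} ≤ ‖ψ‖ * δ := by
    intro δ hδ
    obtain ⟨v, hv, hvδ⟩ := Metric.mem_closure_iff.1 hcl δ hδ
    obtain ⟨⟨a, b⟩, hab, rfl⟩ := hv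
    simp only [LinearMap.sub_apply, LinearMap.smul_apply, LinearMap.snd_apply,
      LinearMap.fst_apply, dist_eq_norm] at hvδ
    have lim := (tendsto_stieltjes_atom μ x).norm
    have lim2 : Tendsto (fun η : ℝ => ‖ψ‖ * (δ + 2 * η * ‖a‖)) (𝓝[>] 0) (𝓝 (‖ψ‖ * δ)) := by
      have : Continuous fun η : ℝ => ‖ψ‖ * (δ + 2 * η * ‖a‖) := by fun_prop
      have := this.tendsto 0
      simp only [mul_zero, zero_mul, add_zero] at this
      exact this.mono_left nhdsWithin_le_nhds
    rw [Complex.norm_real, Real.norm_of_nonneg measureReal_nonneg] at lim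
    refine le_of_tendsto_of_tendsto lim lim2 ?_
    filter_upwards [self_mem_nhdsWithin] with η hη
    have hη' : (0 : ℝ) < η := hη
    have him : ((x : ℂ) + Complex.I * η).im = η := by simp
    have hz : ((x : ℂ) + Complex.I * η).im ≠ 0 := by rw [him]; exact hη'.ne'
    obtain ⟨R, hR, e⟩ := h.2 _ hz
    rw [← e]
    have hb : ∀ v, η * ‖R v‖ ≤ ‖v‖ := fun v => by
      have := hR.norm_le hA v
      rwa [him, abs_of_pos hη'] at this
    have h1 : R (b - (x : ℂ) • a) = a + (Complex.I * η) • R a := by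
      have := (isResolventAt_iff_graph.1 hR).2 _ _ hab
      have e2 : b - (x : ℂ) • a = (b - ((x : ℂ) + Complex.I * η) • a) + (Complex.I * η) • a := by
        rw [add_smul]; abel
      rw [e2, map_add, this, map_smul]
    have h2 : ‖R (b - (x : ℂ) • a)‖ ≤ 2 * ‖a‖ := by
      rw [h1]
      refine (norm_add_le _ _).trans ?_
      rw [norm_smul, norm_mul, Complex.norm_I, one_mul, Complex.norm_real,
        Real.norm_of_nonneg hη'.le]
      linarith [hb a]
    have h3 : η * ‖R ψ‖ ≤ δ + 2 * η * ‖a‖ := by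
      have e3 : R ψ = R (ψ - (b - (x : ℂ) • a)) + R (b - (x : ℂ) • a) := by
        rw [← map_add]; congr 1; abel
      calc η * ‖R ψ‖ ≤ η * (‖R (ψ - (b - (x : ℂ) • a))‖ + ‖R (b - (x : ℂ) • a)‖) := by
            rw [e3]; gcongr; exact norm_add_le _ _
        _ ≤ δ + 2 * η * ‖a‖ := by
            have := hb (ψ - (b - (x : ℂ) • a))
            nlinarith
    rw [norm_mul, norm_neg, norm_mul, Complex.norm_I, one_mul, Complex.norm_real,
      Real.norm_of_nonneg hη'.le]
    calc η * ‖(inner ℂ ψ (R ψ) : ℂ)‖ ≤ η * (‖ψ‖ * ‖R ψ‖) := by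
          gcongr; exact norm_inner_le_norm _ _
      _ = ‖ψ‖ * (η * ‖R ψ‖) := by ring
      _ ≤ _ := by gcongr
  have h0 : μ.real {x} ≤ 0 := by
    refine le_of_forall_pos_le_add fun ε hε => ?_
    have := hle (ε / (‖ψ‖ + 1)) (by positivity)
    refine this.trans ?_
    rw [zero_add, mul_div_assoc', div_le_iff₀ (by positivity)]
    nlinarith [norm_nonneg ψ]
  have h1 : μ.real {x} = 0 := le_antisymm h0 measureReal_nonneg
  exact (measureReal_eq_zero_iff (measure_ne_top _ _)).1 h1

/-- A vector whose spectral measure does not charge `x` is orthogonal to the eigenspace at `x`. -/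
lemma IsSpectralMeasure.mem_orthogonal {A : E →ₗ.[ℂ] E} (hA : IsSelfAdjoint A) {ψ : E}
    {μ : Measure ℝ} (h : IsSpectralMeasure A ψ μ) {x : ℝ} (hx : μ {x} = 0) :
    ψ ∈ (eigenspaceOf A x)ᗮ := by
  have := h.1
  rw [Submodule.mem_orthogonal]
  intro u hu
  have lim := (tendsto_stieltjes_atom μ x).norm
  rw [measureReal_def, hx] at lim
  simp only [ENNReal.toReal_zero, Complex.ofReal_zero, norm_zero] at lim
  have lim2 : Tendsto (fun η : ℝ => ‖u‖ ^ 2 * ‖-(Complex.I * η) *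
      ∫ t : ℝ, ((t : ℂ) - (x + Complex.I * η))⁻¹ ∂μ‖) (𝓝[>] 0) (𝓝 (‖u‖ ^ 2 * 0)) :=
    lim.const_mul _
  rw [mul_zero] at lim2
  have : ‖(inner ℂ u ψ : ℂ)‖ ^ 2 ≤ 0 := by
    refine ge_of_tendsto lim2 ?_
    filter_upwards [self_mem_nhdsWithin] with η hη
    have hη' : (0 : ℝ) < η := hη
    have him : ((x : ℂ) + Complex.I * η).im = η := by simp
    have hz : ((x : ℂ) + Complex.I * η).im ≠ 0 := by rw [him]; exact hη'.ne'
    obtain ⟨R, hR, e⟩ := h.2 _ hz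
    obtain ⟨S, hS, -⟩ := h.2 (starRingEnd ℂ ((x : ℂ) + Complex.I * η)) (by simpa using hη'.ne')
    rw [← e]
    -- `S u = u / (i η)`, hence `⟨u, ψ⟩` is `η ⟨u, R ψ⟩` up to a phase
    have h1 : S ((Complex.I * η) • u) = u := by
      have := (isResolventAt_iff_graph.1 hS).2 _ _ (mem_eigenspaceOf.1 hu)
      rw [← sub_smul] at this
      convert this using 3
      simp
    have h2 : (inner ℂ u ψ : ℂ) = starRingEnd ℂ (Complex.I * η) * inner ℂ u (R ψ) := by
      have := hR.inner_symm hA hS ((Complex.I * η) • u) ψ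
      rw [h1, inner_smul_left] at this
      exact this
    have h3 : ‖(inner ℂ u ψ : ℂ)‖ = η * ‖(inner ℂ u (R ψ) : ℂ)‖ := by
      rw [h2, norm_mul, RCLike.norm_conj, norm_mul, Complex.norm_I, one_mul, Complex.norm_real,
        Real.norm_of_nonneg hη'.le]
    have h4 := hR.im_inner hA ψ
    rw [him] at h4
    rw [h3, norm_mul, norm_neg, norm_mul, Complex.norm_I, one_mul, Complex.norm_real,
        Real.norm_of_nonneg hη'.le]
    have h5 : ‖(inner ℂ u (R ψ) : ℂ)‖ ≤ ‖u‖ * ‖R ψ‖ := norm_inner_le_norm _ _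
    calc (η * ‖(inner ℂ u (R ψ) : ℂ)‖) ^ 2 ≤ (η * (‖u‖ * ‖R ψ‖)) ^ 2 := by gcongr
      _ = ‖u‖ ^ 2 * (η * (inner ℂ ψ (R ψ) : ℂ).im) := by rw [h4]; ring
      _ ≤ _ := by
        gcongr
        exact (le_abs_self _).trans (Complex.abs_im_le_norm _)
  have h0 : ‖(inner ℂ u ψ : ℂ)‖ = 0 := by
    have := norm_nonneg (inner ℂ u ψ : ℂ)
    nlinarith
  exact norm_eq_zero.1 h0

end SpectralTypes

/-! ### Spectral types -/

section SpectralTypes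

variable {E : Type*} [NormedAddCommGroup E] [InnerProductSpace ℂ E] [CompleteSpace E]

/-- Away from the eigenvalue, the resolvent leaves the orthogonal complement of the eigenspace
invariant. -/
lemma IsResolventAt.mem_orthogonal {A : E →ₗ.[ℂ] E} (hA : IsSelfAdjoint A) {x : ℝ} {z : ℂ}
    (hz : z ≠ x) {R : E →L[ℂ] E} (hR : IsResolventAt A z R) {ψ : E}
    (hψ : ψ ∈ (eigenspaceOf A x)ᗮ) : R ψ ∈ (eigenspaceOf A x)ᗮ := by
  rw [Submodule.mem_orthogonal] at hψ ⊢
  intro u hu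
  have h1 := (isResolventAt_iff_graph.1 hR).1 ψ
  have e := inner_graph_symm hA hu h1
  rw [inner_smul_left, Complex.conj_ofReal, inner_add_right, inner_smul_right, hψ u hu, zero_add]
    at e
  have : ((x : ℂ) - z) * inner ℂ u (R ψ) = 0 := by linear_combination e
  exact (mul_eq_zero.1 this).resolve_left (sub_ne_zero.2 hz.symm)

/-- An isolated point of the spectrum belongs to the resolvent set of the part of the operator in
the orthogonal complement of the eigenspace. The resolvent there is `T (1 - (x - c) T)⁻¹`, formed by
the functional calculus of the resolvent `T` at `c`. -/
lemma exists_isResolventAt_partOn_of_isolated {A : E →ₗ.[ℂ] E} (hA : IsSelfAdjoint A) {c x : ℝ}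
    (hcx : c ≠ x) {T : E →L[ℂ] E} (hT : IsResolventAt A c T) {δ : ℝ} (hδ : 0 < δ)
    (hiso : ∀ z ∈ opSpectrum A, dist z (x : ℂ) < δ → z = x) :
    ∃ R : (eigenspaceOf A x)ᗮ →L[ℂ] (eigenspaceOf A x)ᗮ,
      IsResolventAt (partOn A (eigenspaceOf A x)ᗮ) x R := by
  classical
  have hsa := hT.isSelfAdjoint hA
  have hn : IsStarNormal T := hsa.isStarNormal
  have hd : ((x : ℂ) - c) ≠ 0 := by
    rw [sub_ne_zero]; exact_mod_cast hcx.symm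
  set s₀ : ℂ := ((x : ℂ) - c)⁻¹ with hs₀
  have hs₀' : s₀ ≠ 0 := inv_ne_zero hd
  -- `s₀` is isolated in the spectrum of the bounded resolvent
  have hiso' : ∀ᶠ s in 𝓝[spectrum ℂ T] s₀, s = s₀ := by
    have hc : ContinuousAt (fun s : ℂ => (c : ℂ) + s⁻¹) s₀ := by fun_prop (disch := exact hs₀')
    have hlim : (c : ℂ) + s₀⁻¹ = x := by rw [hs₀, inv_inv]; ring
    have h1 : ∀ᶠ s in 𝓝 s₀, dist ((c : ℂ) + s⁻¹) (x : ℂ) < δ := by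
      have := hc.tendsto
      rw [hlim] at this
      exact this.eventually (Metric.ball_mem_nhds _ hδ)
    have h2 : ∀ᶠ s in 𝓝 s₀, s ≠ 0 := isOpen_ne.mem_nhds hs₀'
    filter_upwards [nhdsWithin_le_nhds h1, nhdsWithin_le_nhds h2, self_mem_nhdsWithin]
      with s hs1 hs2 hs3
    have := hiso _ (mem_opSpectrum_of_mem_spectrum hT hs2 hs3) hs1
    rw [← hlim, add_right_inj, inv_inj] at this
    exact this
  -- continuity on the spectrum is not affected by the value at an isolated point
  have hcont : ∀ f : ℂ → ℂ, (∀ s, s ≠ s₀ → ContinuousAt f s) → ContinuousOn f (spectrum ℂ T) := by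
    intro f hf s hs
    by_cases h : s = s₀
    · rw [h]
      refine (tendsto_const_nhds (x := f s₀)).congr' ?_
      filter_upwards [hiso'] with t ht
      rw [ht]
    · exact (hf s h).continuousWithinAt
  -- `P = χ(T)` is the projection to the eigenspace, `W = w(T)` inverts `1 - (x - c) T` on its
  -- complement
  let χ : ℂ → ℂ := fun s => if s = s₀ then 1 else 0
  let w : ℂ → ℂ := fun s => if s = s₀ then 0 else (1 - ((x : ℂ) - c) * s)⁻¹
  have hev : ∀ s, s ≠ s₀ → ∀ᶠ t in 𝓝 s, t ≠ s₀ := fun s hs => isOpen_ne.mem_nhds hs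
  have hχ : ContinuousOn χ (spectrum ℂ T) := hcont _ fun s hs => by
    refine (continuousAt_const (y := (0 : ℂ))).congr ?_
    filter_upwards [hev s hs] with t ht
    simp [χ, ht]
  have hne : ∀ s, s ≠ s₀ → 1 - ((x : ℂ) - c) * s ≠ 0 := by
    intro s hs h
    apply hs
    rw [hs₀]
    exact eq_inv_of_mul_eq_one_right (sub_eq_zero.1 h).symm
  have hw : ContinuousOn w (spectrum ℂ T) := hcont _ fun s hs => by
    have : ContinuousAt (fun s : ℂ => (1 - ((x : ℂ) - c) * s)⁻¹) s := by
      fun_prop (disch := exact hne s hs)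
    refine this.congr ?_
    filter_upwards [hev s hs] with t ht
    simp [w, ht]
  set P : E →L[ℂ] E := cfc χ T with hP
  set W : E →L[ℂ] E := cfc w T with hW
  have hlin : cfc (fun s : ℂ => 1 - ((x : ℂ) - c) * s) T = 1 - ((x : ℂ) - c) • T := by
    rw [cfc_sub (a := T) (fun _ => (1 : ℂ)) (fun s => ((x : ℂ) - c) * s), cfc_const_one ℂ T,
      cfc_const_mul _ (fun s => s), cfc_id' ℂ T]
  have hWL : W * (1 - ((x : ℂ) - c) • T) = 1 - P := by
    rw [← hlin, hW, ← cfc_mul .., hP, ← cfc_const_one ℂ T, ← cfc_sub ..]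
    refine cfc_congr fun s hs => ?_
    by_cases h : s = s₀
    · simp [w, χ, h]
    · simp [w, χ, h, inv_mul_cancel₀ (hne s h)]
  have hLW : (1 - ((x : ℂ) - c) • T) * W = 1 - P := by
    rw [← hWL, hW, ← hlin]
    exact cfc_commute_cfc _ _ T
  have hLP : (1 - ((x : ℂ) - c) • T) * P = 0 := by
    rw [← hlin, hP, ← cfc_mul .., ← cfc_zero ℂ T]
    refine cfc_congr fun s hs => ?_
    by_cases h : s = s₀
    · simp [χ, h, hs₀, hd]
    · simp [χ, h]
  have hTW : T * W = W * T := by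
    have := cfc_commute_cfc (fun s : ℂ => s) w T
    rwa [cfc_id' ℂ T] at this
  have hPT : P * T = T * P := by
    have := cfc_commute_cfc χ (fun s : ℂ => s) T
    rwa [cfc_id' ℂ T] at this
  have hPW : P * W = W * P := cfc_commute_cfc _ _ T
  have hPsa : ∀ u v : E, inner ℂ (P u) v = (inner ℂ u (P v) : ℂ) := by
    have h1 : star P = P := by
      rw [hP, ← cfc_star]
      refine cfc_congr fun s hs => ?_
      by_cases h : s = s₀ <;> simp [χ, h]
    intro u v
    conv_lhs => rw [← h1]
    rw [ContinuousLinearMap.star_eq_adjoint, ContinuousLinearMap.adjoint_inner_left]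
  have hTg := isResolventAt_iff_graph.1 hT
  have hPmem : ∀ v, P v ∈ eigenspaceOf A x := by
    intro v
    have h1 : P v = ((x : ℂ) - c) • T (P v) := by
      have := congrArg (fun L : E →L[ℂ] E => L v) hLP
      simpa [sub_eq_zero] using this
    have h2 := A.graph.smul_mem ((x : ℂ) - c) (hTg.1 (P v))
    rw [Prod.smul_mk, smul_add, smul_comm _ (c : ℂ), ← h1, ← add_smul, sub_add_cancel] at h2
    exact h2
  have hPfix : ∀ u ∈ eigenspaceOf A x, P u = u := by
    intro u hu
    have h1 := hTg.2 _ _ (mem_eigenspaceOf.1 hu)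
    rw [← sub_smul, map_smul] at h1
    have h2 := congrArg (fun L : E →L[ℂ] E => L u) hWL
    simp only [mul_apply_eq_comp, _root_.sub_apply, one_apply_eq_self, smul_apply, h1, sub_self,
      map_zero] at h2
    exact (sub_eq_zero.1 h2.symm).symm
  have hPzero : ∀ v ∈ (eigenspaceOf A x)ᗮ, P v = 0 := by
    intro v hv
    have h1 := (Submodule.mem_orthogonal _ _).1 hv _ (hPmem (P v))
    rw [hPsa, inner_self_eq_zero] at h1
    exact h1
  refine isResolventAt_partOn (T * W) (fun ψ hψ => ?_) (fun ψ hψ => ?_) (fun a b ha hb hab => ?_)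
  · rw [Submodule.mem_orthogonal]
    intro u hu
    rw [← hPfix u hu, hPsa]
    have : P ((T * W) ψ) = (T * W) (P ψ) := by
      have : P * (T * W) = (T * W) * P := by
        rw [← mul_assoc, hPT, mul_assoc, hPW, mul_assoc]
      exact congrArg (fun L : E →L[ℂ] E => L ψ) this
    rw [this, hPzero ψ hψ, map_zero, inner_zero_right]
  · have h1 := hTg.1 (W ψ)
    have h2 := congrArg (fun L : E →L[ℂ] E => L ψ) hLW
    simp only [mul_apply_eq_comp, _root_.sub_apply, one_apply_eq_self, smul_apply, hPzero ψ hψ,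
      sub_zero] at h2
    have h3 : W ψ + (c : ℂ) • T (W ψ) = ψ + (x : ℂ) • T (W ψ) := by
      rw [sub_smul] at h2
      rw [sub_eq_iff_eq_add] at h2
      nth_rw 1 [h2]
      abel
    rw [h3] at h1
    exact h1
  · have h1 := hTg.2 _ _ hab
    have h2 : b - (x : ℂ) • a = (1 - ((x : ℂ) - c) • T) (b - (c : ℂ) • a) := by
      simp only [_root_.sub_apply, one_apply_eq_self, smul_apply, h1]
      rw [sub_smul]; abel
    have h3 := congrArg (fun L : E →L[ℂ] E => T (L (b - (c : ℂ) • a))) hWL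
    simp only [mul_apply_eq_comp] at h3
    rw [mul_apply_eq_comp, h2, h3, _root_.sub_apply, one_apply_eq_self,
      hPzero _ (Submodule.sub_mem _ hb (Submodule.smul_mem _ (c : ℂ) ha)), sub_zero, h1]

/-- The spectral types of a self-adjoint operator whose spectrum is a set `S` without embedded
eigenvalues together with one isolated eigenvalue of finite multiplicity, and whose resolvent form
is locally bounded, off a countable set, on a dense set of vectors. -/
theorem spectral_types {A : E →ₗ.[ℂ] E} (hA : IsSelfAdjoint A) {c x : ℝ} (hcx : c ≠ x)
    {T : E →L[ℂ] E} (hT : IsResolventAt A c T) {S : Set ℂ}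
    (hS : ∀ z ∈ S, z.im = 0) (hspec : opSpectrum A = insert (x : ℂ) S) {δ : ℝ} (hδ : 0 < δ)
    (hiso : ∀ z ∈ S, δ ≤ dist z (x : ℂ)) (hpt : pointSpectrum A = {(x : ℂ)})
    (hfd : FiniteDimensional ℂ (eigenKer A x)) {Z : Set ℝ} (hZ : Z.Countable)
    (hdense : Dense {ψ : E | ∀ y ∈ Zᶜ, ∃ C : ℝ, ∀ᶠ η : ℝ in 𝓝[>] 0, ∀ R : E →L[ℂ] E,
      IsResolventAt A (y + Complex.I * η) R → (inner ℂ ψ (R ψ) : ℂ).im ≤ C})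
    (happrox : ∀ z ∈ S, ∀ ε > 0, ∃ u v, u ≠ 0 ∧ (u, v) ∈ A.graph ∧
      u ∈ (eigenspaceOf A x)ᗮ ∧ v ∈ (eigenspaceOf A x)ᗮ ∧ ‖v - z • u‖ ≤ ε * ‖u‖) :
    essentialSpectrum A = S ∧ acSpectrum A = S ∧ scSpectrum A = ∅ := by
  have hxS : (x : ℂ) ∉ S := fun h => by
    have := hiso _ h
    rw [dist_self] at this
    linarith
  have hres : ∀ z : ℂ, z ≠ x → z ∉ S → ∃ R : E →L[ℂ] E, IsResolventAt A z R := by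
    intro z hz hzS
    have : z ∉ opSpectrum A := by
      rw [hspec]; simp [hz, hzS]
    exact not_not.1 this
  have hR : ∀ z : ℂ, z.im ≠ 0 → ∃ R : E →L[ℂ] E, IsResolventAt A z R := by
    intro z hz
    refine hres z (fun h => hz (by simp [h])) fun h => hz (hS z h)
  have hex := fun ψ => exists_isSpectralMeasure hA hR hT ψ
  -- points of `Z` other than `x` are no eigenvalues, and `ψ` is orthogonal to the eigenspace at `x`
  have hac : ∀ ψ ∈ (eigenspaceOf A x)ᗮ, ∀ μ, IsSpectralMeasure A ψ μ → μ ≪ volume := by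
    intro ψ hψ μ hμ N hN
    have h1 : μ (N ∩ Zᶜ) = 0 :=
      IsSpectralMeasure.null_of_dense hex hdense hμ (measure_mono_null Set.inter_subset_left hN)
        Set.inter_subset_right
    have h2 : μ Z = 0 := by
      rw [← Set.biUnion_of_singleton Z]
      refine (measure_biUnion_null_iff hZ).2 fun y hy => ?_
      refine hμ.atom_eq_zero hA ?_
      by_cases hyx : y = x
      · rw [hyx]; exact hψ
      · have : eigenspaceOf A y = ⊥ := by
          rw [Submodule.eq_bot_iff]
          intro u hu
          by_contra h0
          have : (y : ℂ) ∈ pointSpectrum A := mem_pointSpectrum_iff.2 ⟨u, h0, hu⟩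
          rw [hpt] at this
          exact hyx (Complex.ofReal_injective this)
        rw [this, Submodule.bot_orthogonal_eq_top]
        trivial
    refine measure_mono_null (t := (N ∩ Zᶜ) ∪ Z) (fun y hy => ?_) (measure_union_null h1 h2)
    by_cases hyZ : y ∈ Z
    · exact Or.inr hyZ
    · exact Or.inl ⟨hy, hyZ⟩
  have hacS : acSubspace A = (eigenspaceOf A x)ᗮ := by
    refine le_antisymm (Submodule.span_le.2 ?_) fun ψ hψ => ?_
    · rintro ψ ⟨μ, hμ, habs⟩
      exact hμ.mem_orthogonal hA (habs (by simp))
    · obtain ⟨μ, hμ, -⟩ := hex ψ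
      exact Submodule.subset_span ⟨μ, hμ, hac ψ hψ μ hμ⟩
  have hscS : scSubspace A = ⊥ := by
    rw [scSubspace, Submodule.span_eq_bot]
    rintro ψ ⟨μ, hμ, hat, hsing⟩
    have habs := hac ψ (hμ.mem_orthogonal hA (hat x)) μ hμ
    -- without atoms `ψ` is orthogonal to the eigenspace, so its measure is absolutely continuous too;
    -- then `Im ⟨ψ, R ψ⟩ = ‖R ψ‖²` vanishes at `z = i`
    have h0 : μ = 0 := Measure.eq_zero_of_absolutelyContinuous_of_mutuallySingular habs hsing
    obtain ⟨R, hR, e⟩ := hμ.2 Complex.I (by simp)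
    rw [h0, integral_zero_measure] at e
    have := hR.im_inner hA ψ
    rw [e] at this
    simp only [Complex.zero_im, Complex.I_im, one_mul] at this
    exact hR.eq_zero_of_apply (norm_eq_zero.1 (pow_eq_zero_iff two_ne_zero |>.1 this.symm))
  refine ⟨?_, ?_, ?_⟩
  · have hdisc : discreteSpectrum A = {(x : ℂ)} := by
      ext z
      constructor
      · rintro ⟨hz, -⟩
        rw [hpt] at hz
        exact hz
      · rintro rfl
        refine ⟨by rw [hpt]; rfl, hfd, δ, hδ, ?_⟩
        rw [hspec]
        ext w
        simp only [Set.mem_inter_iff, Metric.mem_ball, Set.mem_insert_iff, Set.mem_singleton_iff]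
        constructor
        · rintro ⟨h1, rfl | h2⟩
          · rfl
          · exact absurd (hiso w h2) (not_le.2 h1)
        · rintro rfl
          exact ⟨by simpa using hδ, Or.inl rfl⟩
    rw [essentialSpectrum, hdisc, hspec]
    ext w
    simp only [Set.mem_sdiff, Set.mem_insert_iff, Set.mem_singleton_iff]
    constructor
    · rintro ⟨rfl | h, h'⟩
      · exact absurd rfl h'
      · exact h
    · intro h
      exact ⟨Or.inr h, fun h' => hxS (h' ▸ h)⟩
  · rw [acSpectrum, hacS]
    refine Set.Subset.antisymm (fun z hz => ?_) fun z hz => ?_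
    · by_contra hzS
      apply hz
      by_cases hzx : z = x
      · subst hzx
        refine exists_isResolventAt_partOn_of_isolated hA hcx hT hδ fun w hw hd => ?_
        rw [hspec] at hw
        rcases hw with h | h
        · exact h
        · exact absurd (hiso w h) (not_le.2 hd)
      · obtain ⟨R, hR⟩ := hres z hzx hzS
        have hg := isResolventAt_iff_graph.1 hR
        exact isResolventAt_partOn R (fun ψ hψ => hR.mem_orthogonal hA hzx hψ)
          (fun ψ _ => hg.1 ψ) fun a b _ _ hab => hg.2 a b hab
    · refine mem_opSpectrum_of_approx fun ε hε => ?_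
      obtain ⟨u, v, h0, huv, hu, hv, hle⟩ := happrox z hz ε hε
      refine ⟨⟨u, hu⟩, ⟨v, hv⟩, fun h => h0 (congrArg Subtype.val h), mem_partOn_graph.2 huv, ?_⟩
      exact hle
  · rw [scSpectrum, hscS, Set.eq_empty_iff_forall_notMem]
    intro z hz
    apply hz
    refine ⟨0, isResolventAt_iff_graph.2 ⟨fun ψ => ?_, fun a b _ => Subsingleton.elim _ _⟩⟩
    rw [Subsingleton.elim ψ 0, map_zero, smul_zero, add_zero]
    exact Submodule.zero_mem _

end SpectralTypes

/-! ### The Fourier transform of square integrable functions -/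

section FourierL2

open FourierTransform

variable {V : Type*} [NormedAddCommGroup V]

/-- The symbol `|2πξ|²` of the Laplacian. -/
def symb (ξ : V) : ℝ := (2 * Real.pi) ^ 2 * ‖ξ‖ ^ 2

lemma symb_nonneg (ξ : V) : 0 ≤ symb ξ := by unfold symb; positivity

variable [InnerProductSpace ℝ V]

lemma hasTemperateGrowth_symb (c : ℂ) : (fun ξ : V => (symb ξ : ℂ) + c).HasTemperateGrowth := by
  unfold symb
  fun_prop

variable [FiniteDimensional ℝ V]
  [MeasurableSpace V] [BorelSpace V]

/-- Two locally integrable functions with the same integrals against Schwartz functions agree. -/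
lemma ae_eq_of_integral_schwartz {u v : V → ℂ} (hu : LocallyIntegrable u)
    (hv : LocallyIntegrable v) (h : ∀ s : 𝓢(V, ℂ), ∫ x, s x * u x = ∫ x, s x * v x) :
    u =ᵐ[volume] v := by
  refine ae_eq_of_integral_contDiff_smul_eq hu hv fun g hg hc => ?_
  have hg₁ : HasCompactSupport (Complex.ofRealCLM ∘ g) := hc.comp_left rfl
  have hg₂ : ContDiff ℝ ((⊤ : ℕ∞) : WithTop ℕ∞) (Complex.ofRealCLM ∘ g) := by fun_prop
  have := h (hg₁.toSchwartzMap hg₂)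
  simpa using this

/-- On `L¹ ∩ L²` the `L²` Fourier transform is given by the Fourier integral. -/
lemma fourier_toLp_ae_eq {g : V → ℂ} (h2 : MemLp g 2) (h1 : Integrable g) :
    (𝓕 (h2.toLp g) : Lp ℂ 2 (volume : Measure V)) =ᵐ[volume] (𝓕 g : V → ℂ) := by
  have hcont : Continuous (𝓕 g : V → ℂ) :=
    VectorFourier.fourierIntegral_continuous Real.continuous_fourierChar
      (innerSL ℝ).continuous₂ h1
  refine ae_eq_of_integral_schwartz ((Lp.memLp _).locallyIntegrable (by norm_num))
    hcont.locallyIntegrable fun s => ?_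
  have e := congrArg (fun T : 𝓢'(V, ℂ) => T s) (Lp.fourier_toTemperedDistribution_eq (h2.toLp g))
  simp only [TemperedDistribution.fourier_apply, Lp.toTemperedDistribution_apply, smul_eq_mul] at e
  rw [← e]
  have hflip := VectorFourier.integral_fourierIntegral_smul_eq_flip (L := innerₗ V)
    (μ := volume) (ν := volume) Real.continuous_fourierChar continuous_inner
    (f := g) (g := (s : V → ℂ)) h1 s.integrable
  rw [flip_innerₗ] at hflip
  calc ∫ x, (𝓕 s) x * (h2.toLp g) x = ∫ x, g x * (𝓕 (s : V → ℂ)) x := by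
        refine integral_congr_ae ?_
        filter_upwards [h2.coeFn_toLp] with x hx
        rw [hx, mul_comm, SchwartzMap.fourier_coe]
    _ = ∫ x, (𝓕 g) x * s x := hflip.symm
    _ = _ := by simp_rw [mul_comm]

/-- On `L¹ ∩ L²` the inverse `L²` Fourier transform is given by the inverse Fourier integral. -/
lemma fourierInv_ae_eq (u : Lp ℂ 2 (volume : Measure V)) (h1 : Integrable u) :
    (𝓕⁻ u : Lp ℂ 2 (volume : Measure V)) =ᵐ[volume] (𝓕⁻ (u : V → ℂ) : V → ℂ) := by
  have hneg : Integrable (fun x => u (-x)) := h1.comp_neg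
  have hcont : Continuous (𝓕⁻ (u : V → ℂ) : V → ℂ) := by
    rw [Real.fourierInv_eq_fourier_comp_neg]
    exact VectorFourier.fourierIntegral_continuous Real.continuous_fourierChar
      (innerSL ℝ).continuous₂ hneg
  refine ae_eq_of_integral_schwartz ((Lp.memLp _).locallyIntegrable (by norm_num))
    hcont.locallyIntegrable fun s => ?_
  have e := congrArg (fun T : 𝓢'(V, ℂ) => T s) (Lp.fourierInv_toTemperedDistribution_eq u)
  simp only [TemperedDistribution.fourierInv_apply, Lp.toTemperedDistribution_apply, smul_eq_mul]
    at e
  rw [← e]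
  have hflip := VectorFourier.integral_fourierIntegral_smul_eq_flip (L := innerₗ V)
    (μ := volume) (ν := volume) Real.continuous_fourierChar continuous_inner
    (f := fun x => u (-x)) (g := (s : V → ℂ)) hneg s.integrable
  rw [flip_innerₗ] at hflip
  have h3 : ∫ x, u (-x) * (𝓕 (s : V → ℂ)) x = ∫ x, (𝓕⁻ s) x * u x := by
    rw [← integral_neg_eq_self]
    refine integral_congr_ae (Eventually.of_forall fun x => ?_)
    simp only [neg_neg]
    rw [SchwartzMap.fourierInv_coe, Real.fourierInv_eq_fourier_neg, mul_comm]
  rw [← h3]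
  refine hflip.symm.trans ?_
  rw [Real.fourierInv_eq_fourier_comp_neg]
  refine integral_congr_ae (Eventually.of_forall fun x => ?_)
  exact mul_comm _ _

/-- A square integrable function with integrable Fourier transform has a value at the origin, the
integral of its Fourier transform. -/
lemma tendsto_zero_of_integrable_fourier (u : Lp ℂ 2 (volume : Measure V))
    (h1 : Integrable (𝓕 u : Lp ℂ 2 (volume : Measure V))) :
    Tendsto u (𝓝 0 ⊓ ae (volume : Measure V))
      (𝓝 (∫ ξ, (𝓕 u : Lp ℂ 2 (volume : Measure V)) ξ)) := by
  have hae := fourierInv_ae_eq (𝓕 u) h1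
  rw [fourierInv_fourier_eq] at hae
  set w : V → ℂ := ((𝓕 u : Lp ℂ 2 (volume : Measure V)) : V → ℂ) with hw
  have hcont : Continuous (𝓕⁻ w : V → ℂ) := by
    rw [Real.fourierInv_eq_fourier_comp_neg]
    exact VectorFourier.fourierIntegral_continuous Real.continuous_fourierChar
      (innerSL ℝ).continuous₂ h1.comp_neg
  have h0 : (𝓕⁻ w : V → ℂ) 0 = ∫ ξ, w ξ := by
    rw [Real.fourierInv_eq]; simp
  rw [← h0]
  refine ((hcont.tendsto 0).mono_left inf_le_left).congr' ?_
  have : ∀ᶠ x in ae (volume : Measure V), u x = (𝓕⁻ w : V → ℂ) x := hae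
  filter_upwards [this.filter_mono inf_le_right] with x hx using hx.symm

/-- For square integrable functions, multiplication by a function of temperate growth may be read
pointwise. -/
lemma toTemperedDistribution_eq_smulLeftCLM_iff {g : V → ℂ} (hg : g.HasTemperateGrowth)
    (u v : Lp ℂ 2 (volume : Measure V)) :
    (v : 𝓢'(V, ℂ)) = TemperedDistribution.smulLeftCLM ℂ g (u : 𝓢'(V, ℂ)) ↔
      v =ᵐ[volume] fun x => g x * u x := by
  have hgc : Continuous g := hg.1.continuous
  have hu : LocallyIntegrable u := (Lp.memLp u).locallyIntegrable (by norm_num)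
  have hval : ∀ s : 𝓢(V, ℂ), TemperedDistribution.smulLeftCLM ℂ g (u : 𝓢'(V, ℂ)) s =
      ∫ x, s x * (g x * u x) := by
    intro s
    rw [TemperedDistribution.smulLeftCLM_apply_apply, Lp.toTemperedDistribution_apply]
    refine integral_congr_ae (Eventually.of_forall fun x => ?_)
    simp only [SchwartzMap.smulLeftCLM_apply_apply hg, smul_eq_mul]
    ring
  constructor
  · intro h
    refine ae_eq_of_integral_schwartz ((Lp.memLp v).locallyIntegrable (by norm_num)) ?_ fun s => ?_
    · exact LocallyIntegrable.continuous_smul hgc hu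
    · rw [← hval, ← h, Lp.toTemperedDistribution_apply]; rfl
  · intro h
    ext s
    rw [hval, Lp.toTemperedDistribution_apply]
    refine integral_congr_ae ?_
    filter_upwards [h] with x hx
    rw [hx]; rfl

lemma fourier_laplacian (T : 𝓢'(V, ℂ)) :
    𝓕 (-(Δ T)) = TemperedDistribution.smulLeftCLM ℂ (fun ξ : V => (symb ξ : ℂ)) (𝓕 T) := by
  have h1 : (fun ξ : V => (symb ξ : ℂ)) =
      (((2 * Real.pi) ^ 2 : ℝ) : ℂ) • fun ξ : V => ((‖ξ‖ ^ 2 : ℝ) : ℂ) := by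
    ext ξ; simp [symb]
  have hT : (fun ξ : V => ((‖ξ‖ ^ 2 : ℝ) : ℂ)).HasTemperateGrowth := by fun_prop
  have hneg : ∀ X : 𝓢'(V, ℂ), -(-(2 * Real.pi) ^ 2 • X) = (((2 * Real.pi) ^ 2 : ℝ) : ℂ) • X := by
    intro X
    ext s
    simp
  rw [TemperedDistribution.laplacian_eq_fourierMultiplierCLM, h1,
    TemperedDistribution.smulLeftCLM_smul hT, hneg,
    TemperedDistribution.fourierMultiplierCLM_apply, FourierTransform.fourier_smul,
    fourier_fourierInv_eq]
  rfl

/-- `-Δ + c` with domain `H²` acts in Fourier space as multiplication by its symbol. -/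
lemma memSobolev_and_eq_iff (φ h : Lp ℂ 2 (volume : Measure V)) (c : ℂ) :
    (TemperedDistribution.MemSobolev 2 2 (φ : 𝓢'(V, ℂ)) ∧
      (h : 𝓢'(V, ℂ)) = -(Δ (φ : 𝓢'(V, ℂ))) + c • (φ : 𝓢'(V, ℂ))) ↔
    (𝓕 h : Lp ℂ 2 (volume : Measure V)) =ᵐ[volume]
      fun ξ => ((symb ξ : ℂ) + c) * (𝓕 φ : Lp ℂ 2 (volume : Measure V)) ξ := by
  have hsymb : (fun ξ : V => (symb ξ : ℂ)).HasTemperateGrowth := by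
    simpa using hasTemperateGrowth_symb (V := V) 0
  have hF : 𝓕 (-(Δ (φ : 𝓢'(V, ℂ))) + c • (φ : 𝓢'(V, ℂ))) =
      TemperedDistribution.smulLeftCLM ℂ (fun ξ : V => (symb ξ : ℂ) + c)
        ((𝓕 φ : Lp ℂ 2 (volume : Measure V)) : 𝓢'(V, ℂ)) := by
    have hadd : (fun ξ : V => (symb ξ : ℂ) + c) = (fun ξ : V => (symb ξ : ℂ)) + fun _ => c := rfl
    rw [FourierTransform.fourier_add, FourierTransform.fourier_smul, fourier_laplacian, ← Lp.fourier_toTemperedDistribution_eq, hadd,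
      TemperedDistribution.smulLeftCLM_add hsymb (.const c), add_apply,
      TemperedDistribution.smulLeftCLM_const]
  have hiff : (h : 𝓢'(V, ℂ)) = -(Δ (φ : 𝓢'(V, ℂ))) + c • (φ : 𝓢'(V, ℂ)) ↔
      (𝓕 h : Lp ℂ 2 (volume : Measure V)) =ᵐ[volume]
      fun ξ => ((symb ξ : ℂ) + c) * (𝓕 φ : Lp ℂ 2 (volume : Measure V)) ξ := by
    rw [← toTemperedDistribution_eq_smulLeftCLM_iff (hasTemperateGrowth_symb c), ← hF,
      ← Lp.fourier_toTemperedDistribution_eq]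
    constructor
    · intro h; rw [h]
    · intro h
      have := congrArg (fun T : 𝓢'(V, ℂ) => 𝓕⁻ T) h
      simpa only [fourierInv_fourier_eq] using this
  rw [hiff, and_iff_right_iff_imp]
  intro hh
  rw [TemperedDistribution.memSobolev_iff_exists_smulLeftCLM_fourier,
    Lp.fourier_toTemperedDistribution_eq]
  -- `(1 + |ξ|²) φ̂ = (2π)⁻² (ĥ - c φ̂) + φ̂`
  refine ⟨(((2 * Real.pi) ^ 2 : ℝ) : ℂ)⁻¹ • (𝓕 h - c • 𝓕 φ) + 𝓕 φ, ?_⟩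
  symm
  rw [toTemperedDistribution_eq_smulLeftCLM_iff (by fun_prop)]
  filter_upwards [hh, Lp.coeFn_add ((((2 * Real.pi) ^ 2 : ℝ) : ℂ)⁻¹ • (𝓕 h - c • 𝓕 φ)) (𝓕 φ),
    Lp.coeFn_smul (((2 * Real.pi) ^ 2 : ℝ) : ℂ)⁻¹ (𝓕 h - c • 𝓕 φ), Lp.coeFn_sub (𝓕 h) (c • 𝓕 φ),
    Lp.coeFn_smul c (𝓕 φ)] with ξ h1 h2 h3 h4 h5
  rw [h2, Pi.add_apply, h3, Pi.smul_apply, h4, Pi.sub_apply, h5, Pi.smul_apply, h1]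
  simp only [smul_eq_mul, symb]
  have hpi : (Real.pi : ℂ) ≠ 0 := Complex.ofReal_ne_zero.2 Real.pi_ne_zero
  norm_num
  field_simp
  ring

end FourierL2

/-! ### Holomorphic families in `Lᵖ` -/

section HolomorphicFamilies

/-- The second order Taylor remainder of a bounded holomorphic function, by the Schwarz lemma for the
slope and for the slope of the slope. -/
lemma norm_taylor_remainder_le {g : ℂ → ℂ} {z₀ : ℂ} {ρ B : ℝ} (hρ : 0 < ρ)
    (hg : DifferentiableOn ℂ g (Metric.ball z₀ ρ)) (hB : ∀ z ∈ Metric.ball z₀ ρ, ‖g z‖ ≤ B)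
    {z : ℂ} (hz : z ∈ Metric.ball z₀ ρ) :
    ‖g z - g z₀ - (z - z₀) * deriv g z₀‖ ≤ 4 * B / ρ ^ 2 * ‖z - z₀‖ ^ 2 := by
  have hz₀ : z₀ ∈ Metric.ball z₀ ρ := Metric.mem_ball_self hρ
  have hnhds : Metric.ball z₀ ρ ∈ 𝓝 z₀ := Metric.ball_mem_nhds _ hρ
  have hk : DifferentiableOn ℂ (dslope g z₀) (Metric.ball z₀ ρ) :=
    (Complex.differentiableOn_dslope hnhds).2 hg
  have h1 : ∀ w ∈ Metric.ball z₀ ρ, ‖dslope g z₀ w‖ ≤ 2 * B / ρ := by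
    intro w hw
    refine Complex.norm_dslope_le_div_of_mapsTo_ball hg (fun v hv => ?_) hw
    rw [mem_closedBall_iff_norm]
    calc ‖g v - g z₀‖ ≤ ‖g v‖ + ‖g z₀‖ := norm_sub_le _ _
      _ ≤ 2 * B := by linarith [hB v hv, hB z₀ hz₀]
  have h2 : ∀ w ∈ Metric.ball z₀ ρ, ‖dslope (dslope g z₀) z₀ w‖ ≤ 4 * B / ρ / ρ := by
    intro w hw
    refine Complex.norm_dslope_le_div_of_mapsTo_ball hk (fun v hv => ?_) hw
    rw [mem_closedBall_iff_norm]
    calc ‖dslope g z₀ v - dslope g z₀ z₀‖ ≤ ‖dslope g z₀ v‖ + ‖dslope g z₀ z₀‖ := norm_sub_le _ _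
      _ ≤ 4 * B / ρ := by
        have := h1 v hv
        have := h1 z₀ hz₀
        have : 4 * B / ρ = 2 * B / ρ + 2 * B / ρ := by ring
        linarith
  have e1 : g z - g z₀ = (z - z₀) * dslope g z₀ z := (sub_smul_dslope g z₀ z).symm
  have e2 : dslope g z₀ z - dslope g z₀ z₀ = (z - z₀) * dslope (dslope g z₀) z₀ z :=
    (sub_smul_dslope (dslope g z₀) z₀ z).symm
  rw [dslope_same] at e2
  have e3 : g z - g z₀ - (z - z₀) * deriv g z₀ =
      (z - z₀) ^ 2 * dslope (dslope g z₀) z₀ z := by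
    rw [e1, ← mul_sub, e2]; ring
  rw [e3, norm_mul, norm_pow, mul_comm]
  have := h2 z hz
  rw [div_div, ← sq] at this
  gcongr

variable {α : Type*} [MeasurableSpace α] {μ : Measure α}

/-- The class of a function in `Lᵖ`, or zero for functions outside `Lᵖ`. -/
def lpClass (p : ENNReal) (μ : Measure α) (f : α → ℂ) : Lp ℂ p μ := by
  classical exact if h : MemLp f p μ then h.toLp f else 0

lemma lpClass_eq {p : ENNReal} {f : α → ℂ} (h : MemLp f p μ) : lpClass p μ f = h.toLp f := by
  simp [lpClass, h]

/-- A pointwise holomorphic family with a local `Lᵖ` bound is holomorphic as an `Lᵖ`-valued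
function. -/
lemma differentiableAt_lpClass {p : ENNReal} [Fact (1 ≤ p)] {f : ℂ → α → ℂ} {z₀ : ℂ} {ρ : ℝ}
    (hρ : 0 < ρ) {b : α → ℝ} (hb : MemLp b p μ)
    (hm : ∀ z ∈ Metric.ball z₀ ρ, AEStronglyMeasurable (f z) μ)
    (hd : ∀ᵐ a ∂μ, DifferentiableOn ℂ (fun z => f z a) (Metric.ball z₀ ρ))
    (hbd : ∀ᵐ a ∂μ, ∀ z ∈ Metric.ball z₀ ρ, ‖f z a‖ ≤ b a) :
    DifferentiableAt ℂ (fun z => lpClass p μ (f z)) z₀ := by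
  have hz₀ : z₀ ∈ Metric.ball z₀ ρ := Metric.mem_ball_self hρ
  have hnhds : Metric.ball z₀ ρ ∈ 𝓝 z₀ := Metric.ball_mem_nhds _ hρ
  have hmem : ∀ z ∈ Metric.ball z₀ ρ, MemLp (f z) p μ := by
    intro z hz
    refine hb.mono (hm z hz) ?_
    filter_upwards [hbd] with a ha
    exact (ha z hz).trans (le_abs_self _)
  -- the derivative is a limit of difference quotients, hence measurable
  have hdm : AEStronglyMeasurable (fun a => deriv (fun z => f z a) z₀) μ := by
    let h : ℕ → ℂ := fun n => (ρ / 2 / (n + 1) : ℝ)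
    have hpos : ∀ n : ℕ, 0 < ρ / 2 / ((n : ℝ) + 1) := fun n => by positivity
    have hh0 : ∀ n, h n ≠ 0 := fun n => Complex.ofReal_ne_zero.2 (hpos n).ne'
    have hhball : ∀ n, z₀ + h n ∈ Metric.ball z₀ ρ := by
      intro n
      rw [mem_ball_iff_norm, add_sub_cancel_left, Complex.norm_real, Real.norm_of_nonneg (hpos n).le]
      calc ρ / 2 / ((n : ℝ) + 1) ≤ ρ / 2 := div_le_self (half_pos hρ).le (by linarith [n.cast_nonneg (α := ℝ)])
        _ < ρ := by linarith
    have hlim : Tendsto h atTop (𝓝[≠] 0) := by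
      refine tendsto_nhdsWithin_iff.2 ⟨?_, Eventually.of_forall hh0⟩
      have : Tendsto (fun n : ℕ => ρ / 2 / ((n : ℝ) + 1)) atTop (𝓝 0) := by
        simpa [div_eq_mul_inv] using
          (tendsto_one_div_add_atTop_nhds_zero_nat (𝕜 := ℝ)).const_mul (ρ / 2)
      have := (Complex.continuous_ofReal.tendsto 0).comp this
      simpa [h, Function.comp_def] using this
    refine aestronglyMeasurable_of_tendsto_ae atTop
      (f := fun n a => (h n)⁻¹ * (f (z₀ + h n) a - f z₀ a)) (fun n => ?_) ?_
    · exact ((hm _ (hhball n)).sub (hm _ hz₀)).const_mul _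
    · filter_upwards [hd] with a ha
      have := (ha.differentiableAt hnhds).hasDerivAt.tendsto_slope_zero.comp hlim
      exact this
  -- Cauchy estimate on the circle of radius `ρ / 2`
  have hdbd : ∀ᵐ a ∂μ, ‖deriv (fun z => f z a) z₀‖ ≤ (2 * ρ⁻¹) * b a := by
    filter_upwards [hd, hbd] with a h1 h2
    have h3 := Complex.norm_deriv_le_of_forall_mem_sphere_norm_le (f := fun z => f z a) (c := z₀)
      (R := ρ / 2) (C := b a) (by positivity)
      ((h1.mono (Metric.closedBall_subset_ball (by linarith))).diffContOnCl_ball (U := Metric.closedBall z₀ (ρ / 2)) (subset_refl _))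
      (fun z hz => h2 z (by
        rw [mem_sphere_iff_norm] at hz
        rw [mem_ball_iff_norm, hz]; linarith))
    calc _ ≤ b a / (ρ / 2) := h3
      _ = _ := by field_simp
  have hdmem : MemLp (fun a => deriv (fun z => f z a) z₀) p μ :=
    hb.of_le_mul (c := 2 * ρ⁻¹) hdm (by
      filter_upwards [hdbd] with a ha
      refine ha.trans ?_
      gcongr
      exact le_abs_self _)
  have hrem : ∀ z ∈ Metric.ball z₀ ρ, ‖lpClass p μ (f z) - lpClass p μ (f z₀) -
      (z - z₀) • hdmem.toLp _‖ ≤ 4 / ρ ^ 2 * ‖z - z₀‖ ^ 2 * ‖hb.toLp b‖ := by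
    intro z hz
    rw [lpClass_eq (hmem z hz), lpClass_eq (hmem z₀ hz₀)]
    refine Lp.norm_le_mul_norm_of_ae_le_mul ?_
    filter_upwards [hd, hbd, (hmem z hz).coeFn_toLp, (hmem z₀ hz₀).coeFn_toLp, hdmem.coeFn_toLp,
      hb.coeFn_toLp, Lp.coeFn_sub ((hmem z hz).toLp _ - (hmem z₀ hz₀).toLp _)
        ((z - z₀) • hdmem.toLp _), Lp.coeFn_sub ((hmem z hz).toLp _) ((hmem z₀ hz₀).toLp _),
      Lp.coeFn_smul (z - z₀) (hdmem.toLp _)] with a h1 h2 h3 h4 h5 h6 h7 h8 h9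
    rw [h7, Pi.sub_apply, h8, Pi.sub_apply, h9, Pi.smul_apply, h3, h4, h5, h6, smul_eq_mul]
    have h0 : 0 ≤ b a := (norm_nonneg _).trans (h2 z₀ hz₀)
    rw [Real.norm_of_nonneg h0]
    refine (norm_taylor_remainder_le hρ h1 h2 hz).trans (le_of_eq ?_)
    ring
  refine HasDerivAt.differentiableAt (f' := hdmem.toLp _) ?_
  rw [hasDerivAt_iff_isLittleO]
  refine Asymptotics.IsBigO.trans_isLittleO (g := fun z => ‖z - z₀‖ ^ 2) ?_ ?_
  · refine Asymptotics.IsBigO.of_bound (4 / ρ ^ 2 * ‖hb.toLp b‖) ?_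
    filter_upwards [hnhds] with z hz
    refine (hrem z hz).trans (le_of_eq ?_)
    rw [norm_pow, norm_norm]; ring
  · refine (Asymptotics.IsLittleO.of_norm_right ?_)
    have h1 : Tendsto (fun z : ℂ => ‖z - z₀‖) (𝓝 z₀) (𝓝 0) := by
      have : Continuous fun z : ℂ => ‖z - z₀‖ := by fun_prop
      simpa using this.tendsto z₀
    simp only [sq]
    have h2 : (fun z : ℂ => ‖z - z₀‖) =o[𝓝 z₀] (fun _ => (1 : ℝ)) :=
      (Asymptotics.isLittleO_one_iff ℝ).2 h1
    have h3 := h2.mul_isBigO (Asymptotics.isBigO_refl (fun z : ℂ => ‖z - z₀‖) (𝓝 z₀))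
    simpa using h3

/-- Integrals depending holomorphically on a parameter. -/
lemma differentiableAt_integral {f : ℂ → α → ℂ} {z₀ : ℂ} {ρ : ℝ}
    (hρ : 0 < ρ) {b : α → ℝ} (hb : Integrable b μ)
    (hm : ∀ z ∈ Metric.ball z₀ ρ, AEStronglyMeasurable (f z) μ)
    (hd : ∀ᵐ a ∂μ, DifferentiableOn ℂ (fun z => f z a) (Metric.ball z₀ ρ))
    (hbd : ∀ᵐ a ∂μ, ∀ z ∈ Metric.ball z₀ ρ, ‖f z a‖ ≤ b a) :
    DifferentiableAt ℂ (fun z => ∫ a, f z a ∂μ) z₀ := by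
  have h1 := differentiableAt_lpClass (p := 1) hρ (memLp_one_iff_integrable.2 hb) hm hd hbd
  let Λ : Lp ℂ 1 μ →L[ℂ] ℂ := LinearMap.mkContinuous
    { toFun := fun g => ∫ a, g a ∂μ
      map_add' := fun g h => by
        rw [integral_congr_ae (Lp.coeFn_add g h)]
        exact integral_add (L1.integrable_coeFn g) (L1.integrable_coeFn h)
      map_smul' := fun c g => by
        rw [integral_congr_ae (Lp.coeFn_smul c g)]
        exact integral_const_mul c _ } 1 (fun g => by
      rw [one_mul, L1.norm_eq_integral_norm]
      exact norm_integral_le_integral_norm _)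
  have h2 := (Λ.differentiableAt).comp z₀ h1
  refine h2.congr_of_eventuallyEq ?_
  filter_upwards [Metric.ball_mem_nhds z₀ hρ] with z hz
  have hmem : MemLp (f z) 1 μ := by
    refine (memLp_one_iff_integrable.2 hb).mono (hm z hz) ?_
    filter_upwards [hbd] with a ha
    exact (ha z hz).trans (le_abs_self _)
  change _ = ∫ a, lpClass 1 μ (f z) a ∂μ
  rw [lpClass_eq hmem]
  exact (integral_congr_ae hmem.coeFn_toLp).symm

end HolomorphicFamilies

/-! ### The Macdonald function -/

section Macdonald

/-- Two holomorphic functions on the right half-plane agree if they agree on the positive reals. -/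
lemma eq_of_eq_ofReal {f g : ℂ → ℂ} (hf : ∀ s : ℂ, 0 < s.re → DifferentiableAt ℂ f s)
    (hg : ∀ s : ℂ, 0 < s.re → DifferentiableAt ℂ g s)
    (h : ∀ s : ℝ, 0 < s → f s = g s) {s : ℂ} (hs : 0 < s.re) : f s = g s := by
  have hU : IsOpen {s : ℂ | 0 < s.re} := isOpen_lt continuous_const Complex.continuous_re
  have hconv : Convex ℝ {s : ℂ | 0 < s.re} := convex_halfSpace_re_gt 0
  have h1 : AnalyticOnNhd ℂ f {s : ℂ | 0 < s.re} :=
    DifferentiableOn.analyticOnNhd (fun s hs => (hf s hs).differentiableWithinAt) hU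
  have h2 : AnalyticOnNhd ℂ g {s : ℂ | 0 < s.re} :=
    DifferentiableOn.analyticOnNhd (fun s hs => (hg s hs).differentiableWithinAt) hU
  refine h1.eqOn_of_preconnected_of_frequently_eq h2 hconv.isPreconnected (z₀ := 1) (by simp) ?_ hs
  have hlim : Tendsto (fun n : ℕ => ((1 + 1 / ((n : ℝ) + 1) : ℝ) : ℂ)) atTop (𝓝[≠] 1) := by
    refine tendsto_nhdsWithin_iff.2 ⟨?_, Eventually.of_forall fun n => ?_⟩
    · have : Tendsto (fun n : ℕ => 1 + 1 / ((n : ℝ) + 1)) atTop (𝓝 (1 + 0)) :=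
        tendsto_one_div_add_atTop_nhds_zero_nat.const_add 1
      have := (Complex.continuous_ofReal.tendsto _).comp this
      simpa [Function.comp_def] using this
    · have : (0 : ℝ) < 1 / ((n : ℝ) + 1) := by positivity
      simp only [Set.mem_compl_iff, Set.mem_singleton_iff]
      intro h0
      have := congrArg Complex.re h0
      simp only [Complex.ofReal_re, Complex.one_re] at this
      linarith
  exact hlim.frequently (Frequently.of_forall fun n => h _ (by positivity))

/-- The weight `e^{-y} y^{-1/2}` of the Laplace integral for the Macdonald function. -/
def gammaWeight (y : ℝ) : ℝ := Real.exp (-y) * (√y)⁻¹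

lemma gammaWeight_nonneg (y : ℝ) : 0 ≤ gammaWeight y := by unfold gammaWeight; positivity

lemma measurable_gammaWeight : Measurable gammaWeight := by unfold gammaWeight; fun_prop

lemma integrableOn_gammaWeight : IntegrableOn gammaWeight (Set.Ioi 0) := by
  refine (Real.GammaIntegral_convergent (s := 1 / 2) (by norm_num)).congr_fun (fun y hy => ?_)
    measurableSet_Ioi
  simp only [gammaWeight, Real.sqrt_eq_rpow]
  rw [← Real.rpow_neg (le_of_lt hy)]
  norm_num

lemma mem_slitPlane_add {s : ℂ} (hs : s ∈ Complex.slitPlane) {y : ℝ} (hy : 0 ≤ y) :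
    (y : ℂ) + 2 * s ∈ Complex.slitPlane := by
  rw [Complex.mem_slitPlane_iff] at hs ⊢
  simp only [Complex.add_re, Complex.ofReal_re, Complex.mul_re, Complex.re_ofNat, Complex.im_ofNat,
    zero_mul, sub_zero, Complex.add_im, Complex.ofReal_im, Complex.mul_im, add_zero, zero_add]
  rcases hs with hs | hs
  · left; linarith
  · right; simpa using hs

lemma exists_le_norm_add {s : ℂ} (hs : s ∈ Complex.slitPlane) :
    ∃ c : ℝ, 0 < c ∧ ∀ s' ∈ Metric.ball s c, s' ∈ Complex.slitPlane ∧
      ∀ y : ℝ, 0 ≤ y → c ≤ ‖(y : ℂ) + 2 * s'‖ := by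
  obtain ⟨ρ, hρ, hsub⟩ := Metric.isOpen_iff.1 Complex.isOpen_slitPlane s hs
  refine ⟨ρ / 2, by positivity, fun s' hs' => ⟨hsub (Metric.ball_subset_ball (by linarith) hs'),
    fun y hy => ?_⟩⟩
  by_contra! hlt
  have h1 : ((-y / 2 : ℝ) : ℂ) ∈ Metric.ball s ρ := by
    rw [Metric.mem_ball] at hs' ⊢
    have h2 : dist ((-y / 2 : ℝ) : ℂ) s' < ρ / 2 := by
      rw [dist_eq_norm]
      have : ((-y / 2 : ℝ) : ℂ) - s' = -(1 / 2) * ((y : ℂ) + 2 * s') := by push_cast; ring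
      rw [this, norm_mul]
      norm_num
      linarith
    calc _ ≤ dist ((-y / 2 : ℝ) : ℂ) s' + dist s' s := dist_triangle _ _ _
      _ < ρ := by linarith
  have := hsub h1
  rw [Complex.ofReal_mem_slitPlane] at this
  linarith

/-- The Macdonald function `K₀` on the plane cut along the negative real axis, by its Laplace
integral `e^{-s} ∫₀^∞ e^{-y} (y (y + 2s))^{-1/2} dy`. -/
def bessK0 (s : ℂ) : ℂ :=
  Complex.exp (-s) *
    ∫ y in Set.Ioi (0 : ℝ), (gammaWeight y : ℂ) * ((y : ℂ) + 2 * s) ^ ((-(1 / 2) : ℝ) : ℂ)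

lemma norm_laplace_integrand_le {c : ℝ} (hc : 0 < c) {y : ℝ} {w : ℂ} (h : c ≤ ‖w‖) :
    ‖(gammaWeight y : ℂ) * w ^ ((-(1 / 2) : ℝ) : ℂ)‖ ≤
      gammaWeight y * c ^ (-(1 / 2) : ℝ) := by
  rw [norm_mul, Complex.norm_real, Real.norm_of_nonneg (gammaWeight_nonneg y),
    Complex.norm_cpow_real]
  have := gammaWeight_nonneg y
  gcongr ?_ * ?_
  exact Real.rpow_le_rpow_of_nonpos hc h (by norm_num)

lemma measurable_laplace_integrand (s : ℂ) : Measurable fun y : ℝ =>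
    (gammaWeight y : ℂ) * ((y : ℂ) + 2 * s) ^ ((-(1 / 2) : ℝ) : ℂ) := by
  have := measurable_gammaWeight
  fun_prop

lemma differentiableAt_bessK0 {s : ℂ} (hs : s ∈ Complex.slitPlane) :
    DifferentiableAt ℂ bessK0 s := by
  obtain ⟨c, hc, h⟩ := exists_le_norm_add hs
  refine DifferentiableAt.mul (by fun_prop) ?_
  refine differentiableAt_integral hc (b := fun y => gammaWeight y * c ^ (-(1 / 2) : ℝ))
    (integrableOn_gammaWeight.mul_const _)
    (fun z _ => (measurable_laplace_integrand z).aestronglyMeasurable) ?_ ?_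
  · filter_upwards [self_mem_ae_restrict measurableSet_Ioi] with y hy z hz
    refine (DifferentiableAt.const_mul ?_ _).differentiableWithinAt
    refine DifferentiableAt.cpow_const (by fun_prop) ?_
    exact mem_slitPlane_add (h z hz).1 (le_of_lt hy)
  · filter_upwards [self_mem_ae_restrict measurableSet_Ioi] with y hy z hz
    exact norm_laplace_integrand_le hc ((h z hz).2 y (le_of_lt hy))

lemma integral_gammaWeight_nonneg : 0 ≤ ∫ y in Set.Ioi (0 : ℝ), gammaWeight y :=
  setIntegral_nonneg measurableSet_Ioi fun y _ => gammaWeight_nonneg y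

/-- Locally uniform bound, along rays, for the Macdonald function. -/
lemma norm_bessK0_le {κ : ℂ} {c : ℝ} (hc : 0 < c)
    (h : ∀ y : ℝ, 0 ≤ y → c ≤ ‖(y : ℂ) + 2 * κ‖) {r : ℝ} (hr : 0 < r) :
    ‖bessK0 (κ * r)‖ ≤ (∫ y in Set.Ioi (0 : ℝ), gammaWeight y) * c ^ (-(1 / 2) : ℝ) *
      (r ^ (-(1 / 2) : ℝ) * Real.exp (-κ.re * r)) := by
  have h1 : ∀ y ∈ Set.Ioi (0 : ℝ), c * r ≤ ‖(y : ℂ) + 2 * (κ * r)‖ := by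
    intro y hy
    have h2 := h (y / r) (div_nonneg (le_of_lt hy) hr.le)
    have h3 : (y : ℂ) + 2 * (κ * r) = (((y / r : ℝ) : ℂ) + 2 * κ) * r := by
      have : (r : ℂ) ≠ 0 := Complex.ofReal_ne_zero.2 hr.ne'
      push_cast; field_simp
    rw [h3, norm_mul, Complex.norm_real, Real.norm_of_nonneg hr.le]
    gcongr
  unfold bessK0
  rw [norm_mul, Complex.norm_exp]
  have h4 : ‖∫ y in Set.Ioi (0 : ℝ), (gammaWeight y : ℂ) *
      ((y : ℂ) + 2 * (κ * r)) ^ ((-(1 / 2) : ℝ) : ℂ)‖ ≤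
      ∫ y in Set.Ioi (0 : ℝ), gammaWeight y * (c * r) ^ (-(1 / 2) : ℝ) := by
    refine norm_integral_le_of_norm_le (integrableOn_gammaWeight.mul_const _) ?_
    filter_upwards [self_mem_ae_restrict measurableSet_Ioi] with y hy
    exact norm_laplace_integrand_le (by positivity) (h1 y hy)
  rw [integral_mul_const] at h4
  have h5 : (-(κ * (r : ℂ))).re = -κ.re * r := by simp
  rw [h5]
  refine (mul_le_mul_of_nonneg_left h4 (Real.exp_pos _).le).trans (le_of_eq ?_)
  rw [Real.mul_rpow hc.le hr.le]; ring

/-- Substitution `y = s (cosh u - 1)` in the Laplace integral. -/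
lemma integral_exp_cosh_ofReal {s : ℝ} (hs : 0 < s) :
    ∫ t : ℝ, Complex.exp (-(s : ℂ) * (Real.cosh t : ℂ)) = 2 * bessK0 s := by
  have heven : ∫ t : ℝ, Complex.exp (-(s : ℂ) * (Real.cosh t : ℂ)) =
      2 * ∫ t in Set.Ioi (0 : ℝ), Complex.exp (-(s : ℂ) * (Real.cosh t : ℂ)) := by
    have h1 := integral_comp_abs (f := fun t : ℝ => Real.exp (-s * Real.cosh t))
    simp only [Real.cosh_abs] at h1
    have h2 : ∀ t : ℝ, Complex.exp (-(s : ℂ) * (Real.cosh t : ℂ)) =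
        ((Real.exp (-s * Real.cosh t) : ℝ) : ℂ) := fun t => by push_cast; rfl
    simp only [h2]
    rw [integral_complex_ofReal, h1, integral_complex_ofReal]
    push_cast; rfl
  rw [heven]
  congr 1
  have himg : (fun u : ℝ => s * (Real.cosh u - 1)) '' Set.Ioi 0 = Set.Ioi 0 := by
    ext y
    constructor
    · rintro ⟨u, hu, rfl⟩
      have : 1 < Real.cosh u := Real.one_lt_cosh.2 (ne_of_gt hu)
      exact mul_pos hs (by linarith)
    · intro hy
      have hy' : 0 < y / s := div_pos hy hs
      refine ⟨Real.arcosh (1 + y / s), Real.arcosh_pos (by linarith), ?_⟩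
      simp only
      rw [Real.cosh_arcosh (by linarith)]
      field_simp; ring
  have hsub := integral_image_eq_integral_abs_deriv_smul (s := Set.Ioi (0 : ℝ))
    (f := fun u : ℝ => s * (Real.cosh u - 1)) (f' := fun u => s * Real.sinh u)
    measurableSet_Ioi
    (fun u _ => (((Real.hasDerivAt_cosh u).sub_const 1).const_mul s).hasDerivWithinAt)
    (fun u hu v hv huv => by
      have : Real.cosh u = Real.cosh v := by
        have := mul_left_cancel₀ hs.ne' huv; linarith
      have h2 := congrArg Real.arcosh this
      rwa [Real.arcosh_cosh (le_of_lt hu), Real.arcosh_cosh (le_of_lt hv)] at h2)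
    (fun y : ℝ => (gammaWeight y : ℂ) * ((y : ℂ) + 2 * s) ^ ((-(1 / 2) : ℝ) : ℂ))
  rw [himg] at hsub
  unfold bessK0
  rw [hsub, ← integral_const_mul]
  refine setIntegral_congr_fun measurableSet_Ioi fun u hu => ?_
  have hu' : 0 < Real.sinh u := Real.sinh_pos_iff.2 hu
  have hc : 1 < Real.cosh u := Real.one_lt_cosh.2 (ne_of_gt hu)
  have h1 : (((s * (Real.cosh u - 1) : ℝ) : ℂ) + 2 * s) = ((s * (Real.cosh u + 1) : ℝ) : ℂ) := by
    push_cast; ring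
  have hp : 0 < s * (Real.cosh u + 1) := by nlinarith
  rw [h1, ← Complex.ofReal_cpow hp.le, Real.rpow_neg hp.le, ← Real.sqrt_eq_rpow,
    abs_of_pos (mul_pos hs hu')]
  have h2 : √(s * (Real.cosh u - 1)) * √(s * (Real.cosh u + 1)) = s * Real.sinh u := by
    have h0 : 0 ≤ s * (Real.cosh u - 1) := mul_nonneg hs.le (by linarith)
    rw [← Real.sqrt_mul h0, ← Real.sqrt_mul_self (mul_pos hs hu').le]
    congr 1
    linear_combination s ^ 2 * Real.cosh_sq u
  rw [← h2]
  have h3 : √(s * (Real.cosh u - 1)) ≠ 0 := (Real.sqrt_pos.2 (mul_pos hs (by linarith))).ne'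
  have h4 : √(s * (Real.cosh u + 1)) ≠ 0 := (Real.sqrt_pos.2 hp).ne'
  rw [gammaWeight, Complex.real_smul, ← Complex.ofReal_neg, ← Complex.ofReal_exp]
  norm_cast
  have h5 : Real.exp (-s) * (√(s * (Real.cosh u - 1)) * √(s * (Real.cosh u + 1)) *
      (Real.exp (-(s * (Real.cosh u - 1))) * (√(s * (Real.cosh u - 1)))⁻¹ *
        (√(s * (Real.cosh u + 1)))⁻¹)) = Real.exp (-s) * Real.exp (-(s * (Real.cosh u - 1))) := by
    field_simp
  rw [h5, ← Real.exp_add]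
  congr 1; ring

lemma le_cosh_abs (t : ℝ) : (1 + |t|) / 2 ≤ Real.cosh t := by
  rw [← Real.cosh_abs, Real.cosh_eq]
  have := Real.add_one_le_exp |t|
  have := Real.exp_pos (-|t|)
  linarith

lemma integrable_exp_cosh {a : ℝ} (ha : 0 < a) :
    Integrable fun t : ℝ => Real.exp (-a * Real.cosh t) := by
  have h1 : Integrable fun t : ℝ => Real.exp (-(a / 2) * |t|) := by
    have h := (integrable_fun_norm_addHaar (volume : Measure ℝ)
      (f := fun t : ℝ => Real.exp (-(a / 2) * t))).2
    simp only [Module.finrank_self, Nat.sub_self, pow_zero, one_smul, Real.norm_eq_abs] at h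
    exact h (integrableOn_exp_mul_Ioi (by linarith) 0)
  refine h1.mono' (by fun_prop) (Eventually.of_forall fun t => ?_)
  rw [Real.norm_of_nonneg (Real.exp_pos _).le]
  refine Real.exp_le_exp.2 ?_
  nlinarith [le_cosh_abs t]

/-- The integral defining the Hankel function is the Macdonald function. -/
lemma integral_exp_cosh {s : ℂ} (hs : 0 < s.re) :
    ∫ t : ℝ, Complex.exp (-s * (Real.cosh t : ℂ)) = 2 * bessK0 s := by
  refine eq_of_eq_ofReal (f := fun s => ∫ t : ℝ, Complex.exp (-s * (Real.cosh t : ℂ)))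
    (g := fun s => 2 * bessK0 s) (fun z hz => ?_) (fun z hz => ?_)
    (fun s hs => integral_exp_cosh_ofReal hs) hs
  · refine differentiableAt_integral (ρ := z.re / 2) (by positivity)
      (integrable_exp_cosh (a := z.re / 2) (by positivity))
      (fun w _ => Continuous.aestronglyMeasurable (by fun_prop))
      (Eventually.of_forall fun t => by fun_prop)
      (Eventually.of_forall fun t w hw => ?_)
    rw [Complex.norm_exp]
    refine Real.exp_le_exp.2 ?_
    have h1 : |w.re - z.re| < z.re / 2 := by
      rw [← Complex.sub_re]
      exact (Complex.abs_re_le_norm _).trans_lt (mem_ball_iff_norm.1 hw)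
    have h2 : z.re / 2 ≤ w.re := by
      rw [abs_lt] at h1; linarith
    rw [Complex.re_mul_ofReal, Complex.neg_re]
    have := Real.cosh_pos t
    nlinarith
  · exact (differentiableAt_bessK0 (Complex.mem_slitPlane_iff.2 (Or.inl hz))).const_mul _

end Macdonald

/-! ### The Macdonald function near the origin -/

section MacdonaldAsymptotics

lemma cpow_half_re_pos {z : ℂ} (hz : z ∈ Complex.slitPlane) : 0 < (z ^ (1 / 2 : ℂ)).re := by
  rw [Complex.cpow_def_of_ne_zero (Complex.slitPlane_ne_zero hz), Complex.exp_re]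
  refine mul_pos (Real.exp_pos _) (Real.cos_pos_of_mem_Ioo ?_)
  have h := Complex.mem_slitPlane_iff_arg.1 hz
  have h1 : (Complex.log z * (1 / 2)).im = z.arg / 2 := by
    have : (1 / 2 : ℂ) = ((1 / 2 : ℝ) : ℂ) := by push_cast; rfl
    rw [this, Complex.im_mul_ofReal, Complex.log_im]; ring
  rw [h1]
  have h2 := Complex.neg_pi_lt_arg z
  have h3 := lt_of_le_of_ne (Complex.arg_le_pi z) h.1
  constructor <;> linarith

lemma cpow_half_sq (z : ℂ) : (z ^ (1 / 2 : ℂ)) ^ 2 = z := by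
  simp

lemma log_cpow_half {z : ℂ} (hz : z ∈ Complex.slitPlane) :
    2 * Complex.log (z ^ (1 / 2 : ℂ)) = Complex.log z := by
  have h1 : (Complex.log z * (1 / 2)).im = z.arg / 2 := by
    have : (1 / 2 : ℂ) = ((1 / 2 : ℝ) : ℂ) := by push_cast; rfl
    rw [this, Complex.im_mul_ofReal, Complex.log_im]; ring
  rw [Complex.cpow_def_of_ne_zero (Complex.slitPlane_ne_zero hz), Complex.log_exp]
  · ring
  · rw [h1]; linarith [Complex.neg_pi_lt_arg z, Real.pi_pos]
  · rw [h1]; linarith [Complex.arg_le_pi z, Real.pi_pos]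

lemma integral_exp_neg_mul_log :
    ∫ y in Set.Ioi (0 : ℝ), ((Real.exp (-y) * Real.log y : ℝ) : ℂ) =
      -(Real.eulerMascheroniConstant : ℂ) := by
  have h1 := Complex.hasDerivAt_GammaIntegral (s := 1) (by simp)
  have h2 := Complex.hasDerivAt_Gamma_one
  have h3 : Complex.GammaIntegral =ᶠ[𝓝 1] Complex.Gamma := by
    have : {s : ℂ | 0 < s.re} ∈ 𝓝 (1 : ℂ) :=
      (isOpen_lt continuous_const Complex.continuous_re).mem_nhds (by simp)
    filter_upwards [this] with s hs
    exact (Complex.Gamma_eq_integral hs).symm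
  have h4 := (h2.congr_of_eventuallyEq h3).unique h1
  rw [h4]
  refine setIntegral_congr_fun measurableSet_Ioi fun y _ => ?_
  simp only [sub_self, Complex.cpow_zero, one_mul]
  push_cast; ring

lemma integrableOn_exp_neg : IntegrableOn (fun y : ℝ => Real.exp (-y)) (Set.Ioi 0) := by
  simpa using integrableOn_exp_mul_Ioi (a := -1) (by norm_num) 0

lemma integrableOn_exp_neg_mul : IntegrableOn (fun y : ℝ => Real.exp (-y) * y) (Set.Ioi 0) := by
  simpa using (Real.GammaIntegral_convergent (s := 2) (by norm_num)).congr_fun (g := fun y : ℝ =>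
    Real.exp (-y) * y) (fun y _ => by norm_num) measurableSet_Ioi

/-- The function `2 log (√y + √(y + 2s))`, an antiderivative of `(y (y + 2s))^{-1/2}`. -/
def logAux (s : ℂ) (y : ℝ) : ℂ := 2 * Complex.log ((√y : ℂ) + ((y : ℂ) + 2 * s) ^ (1 / 2 : ℂ))

lemma logAux_arg_re {s : ℂ} (hs : s ∈ Complex.slitPlane) {y : ℝ} (hy : 0 ≤ y) :
    √y < ((√y : ℂ) + ((y : ℂ) + 2 * s) ^ (1 / 2 : ℂ)).re := by
  have := cpow_half_re_pos (mem_slitPlane_add hs hy)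
  simp only [Complex.add_re, Complex.ofReal_re]
  linarith

lemma logAux_arg_mem {s : ℂ} (hs : s ∈ Complex.slitPlane) {y : ℝ} (hy : 0 ≤ y) :
    (√y : ℂ) + ((y : ℂ) + 2 * s) ^ (1 / 2 : ℂ) ∈ Complex.slitPlane :=
  Complex.mem_slitPlane_iff.2 (Or.inl ((Real.sqrt_nonneg y).trans_lt (logAux_arg_re hs hy)))

lemma norm_logAux_le {s : ℂ} (hs : s ∈ Complex.slitPlane) (hs1 : ‖s‖ ≤ 1) {y : ℝ} (hy : 0 < y) :
    ‖logAux s y‖ ≤ 2 * (y + (√y)⁻¹ + 7) := by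
  have hre := logAux_arg_re hs hy.le
  set u := (√y : ℂ) + ((y : ℂ) + 2 * s) ^ (1 / 2 : ℂ) with hu
  have hsy : 0 < √y := Real.sqrt_pos.2 hy
  have h1 : √y ≤ ‖u‖ := hre.le.trans (Complex.re_le_norm u)
  have hu0 : 0 < ‖u‖ := hsy.trans_le h1
  have h2 : ‖u‖ ≤ y + 3 := by
    have h3 : ‖((y : ℂ) + 2 * s) ^ (1 / 2 : ℂ)‖ ≤ √(y + 2) := by
      refine Real.le_sqrt_of_sq_le ?_
      rw [← norm_pow, cpow_half_sq]
      calc _ ≤ ‖(y : ℂ)‖ + ‖2 * s‖ := norm_add_le _ _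
        _ ≤ y + 2 := by
          rw [Complex.norm_real, Real.norm_of_nonneg hy.le, norm_mul, Complex.norm_ofNat]
          linarith
    have h4 : ‖u‖ ≤ √y + √(y + 2) := by
      refine (norm_add_le _ _).trans (add_le_add (le_of_eq ?_) h3)
      rw [Complex.norm_real, Real.norm_of_nonneg hsy.le]
    have h5 := Real.sq_sqrt hy.le
    have h6 := Real.sq_sqrt (show 0 ≤ y + 2 by linarith)
    nlinarith [sq_nonneg (√y - 1), sq_nonneg (√(y + 2) - 1)]
  have h7 : |Real.log ‖u‖| ≤ y + (√y)⁻¹ + 3 := by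
    rw [abs_le]
    constructor
    · have h8 := Real.log_le_log hsy h1
      have h9 := Real.log_le_sub_one_of_pos (inv_pos.2 hsy)
      rw [Real.log_inv] at h9
      linarith
    · have := Real.log_le_sub_one_of_pos hu0
      have := inv_pos.2 hsy
      linarith
  have h8 : ‖Complex.log u‖ ≤ |Real.log ‖u‖| + |u.arg| := by
    have := Complex.norm_le_abs_re_add_abs_im (Complex.log u)
    rwa [Complex.log_re, Complex.log_im] at this
  have h9 := Complex.abs_arg_le_pi u
  rw [logAux, norm_mul, Complex.norm_ofNat]
  have := Real.pi_lt_four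
  linarith

/-- The majorant used for dominated convergence. -/
lemma integrableOn_logAux_bound :
    IntegrableOn (fun y : ℝ => Real.exp (-y) * (2 * (y + (√y)⁻¹ + 7))) (Set.Ioi 0) := by
  refine (((integrableOn_exp_neg_mul.const_mul 2).add (integrableOn_gammaWeight.const_mul 2)).add
    (integrableOn_exp_neg.const_mul 14)).congr (Eventually.of_forall fun y => ?_)
  simp only [Pi.add_apply, gammaWeight]
  ring

lemma measurable_logAux (s : ℂ) : Measurable (logAux s) := by unfold logAux; fun_prop

lemma norm_exp_logAux_le {s : ℂ} (hs : s ∈ Complex.slitPlane) (hs1 : ‖s‖ ≤ 1) {y : ℝ}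
    (hy : 0 < y) : ‖(Real.exp (-y) : ℂ) * logAux s y‖ ≤
      Real.exp (-y) * (2 * (y + (√y)⁻¹ + 7)) := by
  rw [norm_mul, Complex.norm_real, Real.norm_of_nonneg (Real.exp_pos _).le]
  exact mul_le_mul_of_nonneg_left (norm_logAux_le hs hs1 hy) (Real.exp_pos _).le

lemma integrableOn_exp_logAux {s : ℂ} (hs : s ∈ Complex.slitPlane) (hs1 : ‖s‖ ≤ 1) :
    IntegrableOn (fun y : ℝ => (Real.exp (-y) : ℂ) * logAux s y) (Set.Ioi 0) := by
  refine integrableOn_logAux_bound.mono' ?_ ?_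
  · have := measurable_logAux s
    exact (by fun_prop : Measurable _).aestronglyMeasurable
  · filter_upwards [self_mem_ae_restrict measurableSet_Ioi] with y hy
    exact norm_exp_logAux_le hs hs1 hy

lemma hasDerivAt_logAux {s : ℂ} (hs : s ∈ Complex.slitPlane) {y : ℝ} (hy : 0 < y) :
    HasDerivAt (logAux s) (((√y)⁻¹ : ℝ) * ((y : ℂ) + 2 * s) ^ ((-(1 / 2) : ℝ) : ℂ)) y := by
  have hm := mem_slitPlane_add hs hy.le
  have h1 : HasDerivAt (fun y : ℝ => ((√y : ℝ) : ℂ)) ((1 / (2 * √y) : ℝ) : ℂ) y :=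
    (Real.hasDerivAt_sqrt hy.ne').ofReal_comp
  have h2 : HasDerivAt (fun y : ℝ => ((y : ℂ) + 2 * s) ^ (1 / 2 : ℂ))
      ((1 / 2) * ((y : ℂ) + 2 * s) ^ (1 / 2 - 1 : ℂ) * 1) y := by
    have := (((hasDerivAt_id (y : ℂ)).add_const (2 * s)).cpow_const (c := 1 / 2) hm).comp_ofReal
    exact this
  have h3 := ((h1.add h2).clog_real (logAux_arg_mem hs hy.le)).const_mul 2
  refine h3.congr_deriv ?_
  have hw := Complex.slitPlane_ne_zero (logAux_arg_mem hs hy.le)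
  have hre := cpow_half_re_pos hm
  have he1 : ((y : ℂ) + 2 * s) ^ ((-(1 / 2) : ℝ) : ℂ) = (((y : ℂ) + 2 * s) ^ (1 / 2 : ℂ))⁻¹ := by
    rw [← Complex.cpow_neg]; congr 1; push_cast; ring
  have he2 : ((y : ℂ) + 2 * s) ^ (1 / 2 - 1 : ℂ) = (((y : ℂ) + 2 * s) ^ (1 / 2 : ℂ))⁻¹ := by
    rw [← Complex.cpow_neg]; congr 1; norm_num
  simp only [Pi.add_apply]
  rw [he1, he2]
  set w := ((y : ℂ) + 2 * s) ^ (1 / 2 : ℂ)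
  have hw0 : w ≠ 0 := fun h => by rw [h] at hre; simp at hre
  have hy0 : ((√y : ℝ) : ℂ) ≠ 0 := Complex.ofReal_ne_zero.2 (Real.sqrt_pos.2 hy).ne'
  push_cast
  field_simp
  ring

/-- Integration by parts in the Laplace integral of the Macdonald function. -/
lemma integral_laplace_eq {s : ℂ} (hs : s ∈ Complex.slitPlane) (hs1 : ‖s‖ ≤ 1) :
    ∫ y in Set.Ioi (0 : ℝ), (gammaWeight y : ℂ) * ((y : ℂ) + 2 * s) ^ ((-(1 / 2) : ℝ) : ℂ) =
      (∫ y in Set.Ioi (0 : ℝ), (Real.exp (-y) : ℂ) * logAux s y) - Complex.log (2 * s) := by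
  obtain ⟨c, hc, hcs⟩ := exists_le_norm_add hs
  have hint : IntegrableOn (fun y : ℝ => (gammaWeight y : ℂ) *
      ((y : ℂ) + 2 * s) ^ ((-(1 / 2) : ℝ) : ℂ)) (Set.Ioi 0) := by
    refine (integrableOn_gammaWeight.mul_const (c ^ (-(1 / 2) : ℝ))).mono'
      (measurable_laplace_integrand s).aestronglyMeasurable ?_
    filter_upwards [self_mem_ae_restrict measurableSet_Ioi] with y hy
    exact norm_laplace_integrand_le hc ((hcs s (Metric.mem_ball_self hc)).2 y (le_of_lt hy))
  have hint2 := integrableOn_exp_logAux hs hs1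
  -- the boundary term at `y = 0` is `-log (2s)`, as `logAux s 0 = 2 log √(2s)`
  have key := integral_Ioi_of_hasDerivAt_of_tendsto (a := (0 : ℝ))
    (f := fun y : ℝ => (Real.exp (-y) : ℂ) * logAux s y) (m := 0)
    (f' := fun y : ℝ => (gammaWeight y : ℂ) * ((y : ℂ) + 2 * s) ^ ((-(1 / 2) : ℝ) : ℂ) -
      (Real.exp (-y) : ℂ) * logAux s y) ?_ ?_ (hint.sub hint2) ?_
  · rw [integral_sub hint hint2] at key
    simp only [logAux, neg_zero, Real.exp_zero, Complex.ofReal_one, one_mul, Real.sqrt_zero,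
      Complex.ofReal_zero, zero_add] at key ⊢
    have h2s : 2 * s ∈ Complex.slitPlane := by
      simpa using mem_slitPlane_add hs le_rfl
    rw [log_cpow_half h2s] at key
    linear_combination key
  · refine ContinuousAt.continuousWithinAt ?_
    have hm : ((0 : ℝ) : ℂ) + 2 * s ∈ Complex.slitPlane := mem_slitPlane_add hs le_rfl
    have hm2 := logAux_arg_mem hs le_rfl
    unfold logAux
    refine ContinuousAt.mul (by fun_prop) (continuousAt_const.mul (ContinuousAt.clog ?_ hm2))
    refine ContinuousAt.add (by fun_prop) (ContinuousAt.cpow (by fun_prop) continuousAt_const hm)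
  · intro y hy
    have h1 : HasDerivAt (fun y : ℝ => (Real.exp (-y) : ℂ)) ((Real.exp (-y) * (-1) : ℝ) : ℂ) y :=
      ((hasDerivAt_neg y).exp).ofReal_comp
    refine (h1.mul (hasDerivAt_logAux hs hy)).congr_deriv ?_
    simp only [gammaWeight]
    push_cast; ring
  · have h0 : Tendsto (fun y : ℝ => 2 * (y ^ 1 * Real.exp (-y)) + 16 * (y ^ 0 * Real.exp (-y)))
        atTop (𝓝 (2 * 0 + 16 * 0)) :=
      ((Real.tendsto_pow_mul_exp_neg_atTop_nhds_zero 1).const_mul 2).add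
        ((Real.tendsto_pow_mul_exp_neg_atTop_nhds_zero 0).const_mul 16)
    simp only [mul_zero, add_zero] at h0
    refine squeeze_zero_norm' ?_ h0
    filter_upwards [eventually_ge_atTop 1] with y hy
    refine (norm_exp_logAux_le hs hs1 (by linarith)).trans ?_
    have h1 : (√y)⁻¹ ≤ 1 := inv_le_one_of_one_le₀ (Real.one_le_sqrt.2 hy)
    have := Real.exp_pos (-y)
    rw [pow_one, pow_zero]
    nlinarith

lemma mem_slitPlane_mul_pos {κ : ℂ} (hκ : κ ∈ Complex.slitPlane) {r : ℝ} (hr : 0 < r) :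
    κ * r ∈ Complex.slitPlane := by
  rw [Complex.mem_slitPlane_iff] at hκ ⊢
  simp only [Complex.re_mul_ofReal, Complex.im_mul_ofReal]
  rcases hκ with h | h
  · exact Or.inl (mul_pos h hr)
  · exact Or.inr (mul_ne_zero h hr.ne')

lemma tendsto_mul_ofReal_zero (κ : ℂ) : Tendsto (fun r : ℝ => κ * (r : ℂ)) (𝓝[>] 0) (𝓝 0) := by
  have : Continuous fun r : ℝ => κ * (r : ℂ) := by fun_prop
  have := this.tendsto 0
  simp only [Complex.ofReal_zero, mul_zero] at this
  exact this.mono_left nhdsWithin_le_nhds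

/-- The logarithmic singularity of the Macdonald function at the origin. -/
lemma tendsto_bessK0_add_log {κ : ℂ} (hκ : κ ∈ Complex.slitPlane) :
    Tendsto (fun r : ℝ => bessK0 (κ * r) + Real.log r) (𝓝[>] 0)
      (𝓝 (-(Complex.log (κ / 2) + Real.eulerMascheroniConstant))) := by
  have hsmall : ∀ᶠ r : ℝ in 𝓝[>] 0, 0 < r ∧ ‖κ * (r : ℂ)‖ ≤ 1 := by
    have h1 := (tendsto_mul_ofReal_zero κ).norm
    rw [norm_zero] at h1
    filter_upwards [self_mem_nhdsWithin, h1.eventually (eventually_lt_nhds one_pos)] with r h2 h3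
    exact ⟨h2, h3.le⟩
  -- at `s = 0` the antiderivative is `2 log (2 √y) = log 4 + log y`, and the integral of
  -- `e^{-y} log y` is `-γ`
  have hJ : Tendsto (fun r : ℝ => ∫ y in Set.Ioi (0 : ℝ), (Real.exp (-y) : ℂ) * logAux (κ * r) y)
      (𝓝[>] 0) (𝓝 (Real.log 4 - Real.eulerMascheroniConstant)) := by
    have hval : ∫ y in Set.Ioi (0 : ℝ), (Real.exp (-y) : ℂ) * (2 * Complex.log ((2 * √y : ℝ) : ℂ)) =
        Real.log 4 - Real.eulerMascheroniConstant := by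
      have hc : ∀ y ∈ Set.Ioi (0 : ℝ), (Real.exp (-y) : ℂ) * (2 * Complex.log ((2 * √y : ℝ) : ℂ)) =
          ((Real.exp (-y) * Real.log 4 : ℝ) : ℂ) + ((Real.exp (-y) * Real.log y : ℝ) : ℂ) := by
        intro y hy
        have hy' : 0 < √y := Real.sqrt_pos.2 hy
        rw [← Complex.ofReal_log (by positivity), Real.log_mul two_ne_zero hy'.ne',
          Real.log_sqrt (le_of_lt hy), show (4 : ℝ) = 2 ^ 2 by norm_num, Real.log_pow]
        push_cast; ring
      rw [setIntegral_congr_fun measurableSet_Ioi hc, integral_add, integral_exp_neg_mul_log,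
        integral_complex_ofReal, integral_mul_const]
      · have : ∫ y in Set.Ioi (0 : ℝ), Real.exp (-y) = 1 := by
          simp [integral_exp_neg_Ioi 0]
        rw [this]; push_cast; ring
      · exact (integrableOn_exp_neg.mul_const _).ofReal
      · refine (integrableOn_logAux_bound.mono' (f := fun y => Real.exp (-y) * Real.log y)
          ?_ ?_).ofReal
        · exact (by fun_prop : Measurable fun y : ℝ =>
            Real.exp (-y) * Real.log y).aestronglyMeasurable
        · filter_upwards [self_mem_ae_restrict measurableSet_Ioi] with y hy
          have hy' : 0 < √y := Real.sqrt_pos.2 hy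
          have hy0 : (0 : ℝ) < y := hy
          rw [norm_mul, Real.norm_of_nonneg (Real.exp_pos _).le, Real.norm_eq_abs]
          refine mul_le_mul_of_nonneg_left ?_ (Real.exp_pos _).le
          have h9 := Real.log_le_sub_one_of_pos (inv_pos.2 hy')
          rw [Real.log_inv, Real.log_sqrt hy0.le] at h9
          have h10 := Real.log_le_sub_one_of_pos hy0
          have := inv_pos.2 hy'
          rw [abs_le]; constructor <;> linarith
    rw [← hval]
    refine tendsto_integral_filter_of_dominated_convergence
      (fun y : ℝ => Real.exp (-y) * (2 * (y + (√y)⁻¹ + 7))) ?_ ?_ integrableOn_logAux_bound ?_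
    · refine Eventually.of_forall fun r => ?_
      have := measurable_logAux (κ * r)
      exact (by fun_prop : Measurable _).aestronglyMeasurable
    · filter_upwards [hsmall] with r hr
      filter_upwards [self_mem_ae_restrict measurableSet_Ioi] with y hy
      exact norm_exp_logAux_le (mem_slitPlane_mul_pos hκ hr.1) hr.2 hy
    · filter_upwards [self_mem_ae_restrict measurableSet_Ioi] with y hy
      refine Tendsto.const_mul _ (Tendsto.const_mul _ (Tendsto.clog ?_ ?_))
      · have h1 : Tendsto (fun r : ℝ => (y : ℂ) + 2 * (κ * r)) (𝓝[>] 0) (𝓝 (y : ℂ)) := by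
          simpa using ((tendsto_mul_ofReal_zero κ).const_mul 2).const_add (y : ℂ)
        have h2 := h1.cpow (tendsto_const_nhds (x := (1 / 2 : ℂ)))
          (Complex.ofReal_mem_slitPlane.2 hy)
        have h3 : (y : ℂ) ^ (1 / 2 : ℂ) = (√y : ℝ) := by
          rw [Real.sqrt_eq_rpow, Complex.ofReal_cpow (le_of_lt hy)]; push_cast; rfl
        rw [h3] at h2
        have h4 := h2.const_add ((√y : ℝ) : ℂ)
        convert h4 using 2
        push_cast; ring
      · have hy' : 0 < √y := Real.sqrt_pos.2 hy
        exact Complex.ofReal_mem_slitPlane.2 (by positivity)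
  have hexp : Tendsto (fun r : ℝ => Complex.exp (-(κ * r))) (𝓝[>] 0) (𝓝 1) := by
    have := (Complex.continuous_exp.tendsto _).comp (tendsto_mul_ofReal_zero κ).neg
    simpa [Function.comp_def] using this
  have herr : Tendsto (fun r : ℝ => (1 - Complex.exp (-(κ * r))) * (Real.log r : ℂ))
      (𝓝[>] 0) (𝓝 0) := by
    have h1 := (tendsto_log_mul_rpow_nhdsGT_zero one_pos).norm.const_mul (2 * ‖κ‖)
    simp only [norm_zero, mul_zero] at h1
    refine squeeze_zero_norm' ?_ h1
    filter_upwards [hsmall] with r hr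
    have h2 : ‖Complex.exp (-(κ * r)) - 1‖ ≤ 2 * ‖-(κ * (r : ℂ))‖ :=
      Complex.norm_exp_sub_one_le (by rw [norm_neg]; exact hr.2)
    rw [norm_mul, norm_sub_rev, norm_mul, Complex.norm_real]
    rw [norm_neg, norm_mul, Complex.norm_real] at h2
    calc _ ≤ 2 * (‖κ‖ * ‖r‖) * ‖Real.log r‖ := by gcongr
      _ = _ := by rw [Real.rpow_one]; ring
  have hmain := (hexp.mul (hJ.sub_const (Complex.log (2 * κ)))).add herr
  have hκ0 := Complex.slitPlane_ne_zero hκ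
  have hlim : 1 * ((Real.log 4 : ℂ) - Real.eulerMascheroniConstant - Complex.log (2 * κ)) + 0 =
      -(Complex.log (κ / 2) + Real.eulerMascheroniConstant) := by
    have h1 : Complex.log (2 * κ) = Real.log 2 + Complex.log κ := by
      have := Complex.log_ofReal_mul (r := 2) (by norm_num) hκ0
      simpa using this
    have h2 : Complex.log (κ / 2) = Real.log (2⁻¹) + Complex.log κ := by
      have := Complex.log_ofReal_mul (r := 2⁻¹) (by norm_num) hκ0
      rw [← this]; congr 1; push_cast; ring
    rw [h1, h2, show (4 : ℝ) = 2 ^ 2 by norm_num, Real.log_pow, Real.log_inv]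
    push_cast; ring
  rw [hlim] at hmain
  refine hmain.congr' ?_
  filter_upwards [hsmall] with r hr
  have h1 : Complex.log (2 * (κ * r)) = Real.log r + Complex.log (2 * κ) := by
    rw [← Complex.log_ofReal_mul hr.1 (mul_ne_zero two_ne_zero hκ0)]
    congr 1; ring
  rw [bessK0, integral_laplace_eq (mem_slitPlane_mul_pos hκ hr.1) hr.2, h1]
  ring

end MacdonaldAsymptotics

/-! ### The Green functions -/

section GreenFunctions

/-- The dimensions in which point interactions exist. -/
class LowDim (d : ℕ) : Prop where
  cases : d = 1 ∨ d = 2 ∨ d = 3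

variable {d : ℕ}

instance LowDim.nontrivial [h : LowDim d] : Nontrivial (EuclideanSpace ℝ (Fin d)) := by
  have : 0 < d := by rcases h.cases with h | h | h <;> omega
  have : Nonempty (Fin d) := ⟨⟨0, this⟩⟩
  infer_instance

/-- The Green function `(-Δ + κ²)⁻¹(x)` in terms of `κ`; it is holomorphic in `κ` on the plane cut
along the negative real axis, while it decays only for `Re κ > 0`. -/
def gk (d : ℕ) (κ : ℂ) (x : EuclideanSpace ℝ (Fin d)) : ℂ :=
  match d with
  | 1 => Complex.exp (-(κ * (‖x‖ : ℂ))) / (2 * κ)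
  | 2 => bessK0 (κ * (‖x‖ : ℂ)) / (2 * Real.pi)
  | 3 => Complex.exp (-(κ * (‖x‖ : ℂ))) / (4 * Real.pi * (‖x‖ : ℂ))
  | _ => 0

/-- The value at the origin of the regular part of the Green function. -/
def greg (d : ℕ) (κ : ℂ) : ℂ :=
  match d with
  | 1 => 1 / (2 * κ)
  | 2 => -(Complex.log (κ / 2) + Real.eulerMascheroniConstant) / (2 * Real.pi)
  | 3 => -κ / (4 * Real.pi)
  | _ => 0

lemma sqrtUp_eq (w : ℂ) : Complex.I * sqrtUp w = -((-w) ^ (1 / 2 : ℂ)) := by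
  rw [sqrtUp, ← mul_assoc, Complex.I_mul_I]; ring

lemma green_eq_gk [hd : LowDim d] {w : ℂ} (hw : -w ∈ Complex.slitPlane)
    {x : EuclideanSpace ℝ (Fin d)} (hx : x ≠ 0) : green d w x = gk d ((-w) ^ (1 / 2 : ℂ)) x := by
  have hx' : 0 < ‖x‖ := norm_pos_iff.2 hx
  have hre := cpow_half_re_pos hw
  have h0 : (-w) ^ (1 / 2 : ℂ) ≠ 0 := fun h => by rw [h] at hre; simp at hre
  rcases hd.cases with rfl | rfl | rfl
  · simp only [green, gk, sqrtUp_eq]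
    rw [sqrtUp, neg_mul]
    have := Complex.I_ne_zero
    field_simp
  · simp only [green, gk, hankel]
    have h1 : ∀ t : ℝ, Complex.I * (sqrtUp w * (‖x‖ : ℂ)) * (Real.cosh t : ℂ) =
        -((-w) ^ (1 / 2 : ℂ) * (‖x‖ : ℂ)) * (Real.cosh t : ℂ) := by
      intro t
      rw [← mul_assoc, sqrtUp_eq]; ring
    simp only [h1]
    rw [integral_exp_cosh]
    · have := Complex.I_ne_zero
      have : (Real.pi : ℂ) ≠ 0 := Complex.ofReal_ne_zero.2 Real.pi_ne_zero
      field_simp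
      norm_num
    · rw [Complex.re_mul_ofReal]
      exact mul_pos hre hx'
  · simp only [green, gk, sqrtUp_eq]
    rw [neg_mul]

lemma differentiableAt_gk [hd : LowDim d] {κ : ℂ} (hκ : κ ∈ Complex.slitPlane)
    {x : EuclideanSpace ℝ (Fin d)} (hx : x ≠ 0) : DifferentiableAt ℂ (fun κ => gk d κ x) κ := by
  have hκ0 := Complex.slitPlane_ne_zero hκ
  rcases hd.cases with rfl | rfl | rfl
  · simp only [gk]
    exact DifferentiableAt.fun_div (by fun_prop) (by fun_prop) (mul_ne_zero two_ne_zero hκ0)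
  · simp only [gk]
    refine DifferentiableAt.div_const ?_ _
    exact DifferentiableAt.comp (g := bessK0) (f := fun κ : ℂ => κ * (‖x‖ : ℂ)) κ
      (differentiableAt_bessK0 (mem_slitPlane_mul_pos hκ (norm_pos_iff.2 hx))) (by fun_prop)
  · simp only [gk]
    fun_prop

lemma continuousOn_gk [hd : LowDim d] {κ : ℂ} (hκ : κ ∈ Complex.slitPlane) :
    ContinuousOn (gk d κ) {0}ᶜ := by
  intro x hx
  have hx : x ≠ 0 := hx
  have hx' : ((‖x‖ : ℝ) : ℂ) ≠ 0 := Complex.ofReal_ne_zero.2 (norm_ne_zero_iff.2 hx)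
  refine ContinuousAt.continuousWithinAt ?_
  rcases hd.cases with rfl | rfl | rfl
  · unfold gk
    fun_prop
  · unfold gk
    refine ContinuousAt.div_const ?_ _
    exact ContinuousAt.comp' (g := bessK0) (f := fun x : EuclideanSpace ℝ (Fin 2) => κ * (‖x‖ : ℂ))
      (differentiableAt_bessK0 (mem_slitPlane_mul_pos hκ (norm_pos_iff.2 hx))).continuousAt
      (by fun_prop)
  · unfold gk
    refine ContinuousAt.div (by fun_prop) (by fun_prop) ?_
    exact mul_ne_zero (by simp [Real.pi_ne_zero]) hx'

lemma measurable_gk [LowDim d] {κ : ℂ} (hκ : κ ∈ Complex.slitPlane) : Measurable (gk d κ) :=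
  measurable_of_continuousOn_compl_singleton 0 (continuousOn_gk hκ)

/-- Locally uniform bound for the Green functions. -/
lemma exists_norm_gk_le [hd : LowDim d] {κ₀ : ℂ} (hκ₀ : κ₀ ∈ Complex.slitPlane) :
    ∃ ρ : ℝ, 0 < ρ ∧ ∃ C : ℝ, 0 ≤ C ∧ ∀ κ ∈ Metric.ball κ₀ ρ, κ ∈ Complex.slitPlane ∧
      ∀ x : EuclideanSpace ℝ (Fin d), x ≠ 0 →
        ‖gk d κ x‖ ≤ C * (‖x‖ ^ (-((d : ℝ) - 1) / 2) * Real.exp (-κ.re * ‖x‖)) := by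
  obtain ⟨c, hc, h⟩ := exists_le_norm_add hκ₀
  have hnexp : ∀ (κ : ℂ) (r : ℝ), ‖Complex.exp (-(κ * (r : ℂ)))‖ = Real.exp (-κ.re * r) := by
    intro κ r
    rw [Complex.norm_exp]; simp
  rcases hd.cases with rfl | rfl | rfl
  · refine ⟨c, hc, c⁻¹, by positivity, fun κ hκ => ⟨(h κ hκ).1, fun x hx => ?_⟩⟩
    have h1 := (h κ hκ).2 0 le_rfl
    rw [Complex.ofReal_zero, zero_add] at h1
    simp only [gk, norm_div, hnexp]
    rw [div_eq_inv_mul, Nat.cast_one, sub_self, neg_zero, zero_div, Real.rpow_zero, one_mul]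
    gcongr
  · refine ⟨c, hc, (∫ y in Set.Ioi (0 : ℝ), gammaWeight y) * c ^ (-(1 / 2) : ℝ) / (2 * Real.pi),
      ?_, fun κ hκ => ⟨(h κ hκ).1, fun x hx => ?_⟩⟩
    · have := integral_gammaWeight_nonneg
      positivity
    · have h1 := norm_bessK0_le hc (h κ hκ).2 (norm_pos_iff.2 hx)
      simp only [gk, norm_div]
      have h2 : ‖(2 * Real.pi : ℂ)‖ = 2 * Real.pi := by
        rw [norm_mul, Complex.norm_ofNat, Complex.norm_real, Real.norm_of_nonneg Real.pi_pos.le]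
      have h3 : -(((2 : ℕ) : ℝ) - 1) / 2 = -(1 / 2) := by norm_num
      rw [h2, h3, div_mul_eq_mul_div]
      have := Real.pi_pos
      gcongr
  · refine ⟨c, hc, (4 * Real.pi)⁻¹, by have := Real.pi_pos; positivity,
      fun κ hκ => ⟨(h κ hκ).1, fun x hx => ?_⟩⟩
    simp only [gk, norm_div, norm_mul, hnexp]
    have h3 : -(((3 : ℕ) : ℝ) - 1) / 2 = -1 := by norm_num
    rw [h3, Real.rpow_neg_one, Complex.norm_ofNat, Complex.norm_real, Complex.norm_real,
      Real.norm_of_nonneg Real.pi_pos.le, norm_norm]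
    refine le_of_eq ?_
    rw [div_eq_inv_mul, mul_inv]; ring

/-- The radial majorant `|x|^{-(d-1)/2} e^{-a|x|}` of the Green functions. -/
def envelope (d : ℕ) (a : ℝ) (x : EuclideanSpace ℝ (Fin d)) : ℝ :=
  ‖x‖ ^ (-((d : ℝ) - 1) / 2) * Real.exp (-a * ‖x‖)

lemma envelope_nonneg (a : ℝ) (x : EuclideanSpace ℝ (Fin d)) : 0 ≤ envelope d a x := by
  unfold envelope; positivity

lemma measurable_envelope (a : ℝ) : Measurable (envelope d a) := by unfold envelope; fun_prop

lemma LowDim.one_le [hd : LowDim d] : 1 ≤ d := by rcases hd.cases with h | h | h <;> omega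

lemma integrableOn_rpow_mul_exp {s a : ℝ} (hs : -1 < s) (ha : 0 < a) :
    IntegrableOn (fun y : ℝ => y ^ s * Real.exp (-a * y)) (Set.Ioi 0) := by
  simpa using integrableOn_rpow_mul_exp_neg_mul_rpow (p := 1) (s := s) (b := a) hs one_pos ha

lemma integrable_envelope [LowDim d] {a : ℝ} (ha : 0 < a) : Integrable (envelope d a) := by
  refine (integrable_fun_norm_addHaar (volume : Measure (EuclideanSpace ℝ (Fin d)))
    (f := fun y : ℝ => y ^ (-((d : ℝ) - 1) / 2) * Real.exp (-a * y))).2 ?_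
  have h1 : (1 : ℝ) ≤ d := by exact_mod_cast LowDim.one_le (d := d)
  refine (integrableOn_rpow_mul_exp (s := ((d : ℝ) - 1) / 2) (by linarith) ha).congr_fun
    (fun y hy => ?_) measurableSet_Ioi
  have hy : (0 : ℝ) < y := hy
  rw [finrank_euclideanSpace_fin, smul_eq_mul, ← Real.rpow_natCast, ← mul_assoc,
    ← Real.rpow_add hy, Nat.cast_sub LowDim.one_le]
  have h2 : ((d : ℝ) - (1 : ℕ)) + -((d : ℝ) - 1) / 2 = ((d : ℝ) - 1) / 2 := by push_cast; ring
  rw [h2]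

lemma memLp_two_envelope [LowDim d] {a : ℝ} (ha : 0 < a) : MemLp (envelope d a) 2 := by
  rw [memLp_two_iff_integrable_sq (measurable_envelope a).aestronglyMeasurable]
  refine (integrable_fun_norm_addHaar (volume : Measure (EuclideanSpace ℝ (Fin d)))
    (f := fun y : ℝ => (y ^ (-((d : ℝ) - 1) / 2) * Real.exp (-a * y)) ^ 2)).2 ?_
  refine (integrableOn_rpow_mul_exp (s := 0) (a := 2 * a) (by norm_num) (by positivity)).congr_fun
    (fun y hy => ?_) measurableSet_Ioi
  have hy : (0 : ℝ) < y := hy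
  rw [finrank_euclideanSpace_fin, smul_eq_mul, ← Real.rpow_natCast, mul_pow,
    ← Real.rpow_mul_natCast hy.le, ← mul_assoc, ← Real.rpow_add hy, Nat.cast_sub LowDim.one_le,
    ← Real.exp_nat_mul]
  have h2 : ((d : ℝ) - (1 : ℕ)) + -((d : ℝ) - 1) / 2 * (2 : ℕ) = 0 := by push_cast; ring
  have h3 : ((2 : ℕ) : ℝ) * (-a * y) = -(2 * a) * y := by push_cast; ring
  rw [h2, h3]

lemma ae_ne_zero [LowDim d] : ∀ᵐ x : EuclideanSpace ℝ (Fin d), x ≠ 0 :=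
  Measure.ae_ne volume 0

/-- Uniform global bound near a point of the open right half-plane. -/
lemma exists_norm_gk_le_envelope [LowDim d] {κ₀ : ℂ} (hκ₀ : 0 < κ₀.re) :
    ∃ ρ : ℝ, 0 < ρ ∧ ∃ C : ℝ, 0 ≤ C ∧ ∀ κ ∈ Metric.ball κ₀ ρ, 0 < κ.re ∧
      ∀ x : EuclideanSpace ℝ (Fin d), x ≠ 0 → ‖gk d κ x‖ ≤ C * envelope d (κ₀.re / 2) x := by
  obtain ⟨ρ, hρ, C, hC, h⟩ := exists_norm_gk_le (d := d)
    (Complex.mem_slitPlane_iff.2 (Or.inl hκ₀))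
  refine ⟨min ρ (κ₀.re / 2), by positivity, C, hC, fun κ hκ => ?_⟩
  have h1 : |κ.re - κ₀.re| < κ₀.re / 2 := by
    rw [← Complex.sub_re]
    exact (Complex.abs_re_le_norm _).trans_lt
      ((mem_ball_iff_norm.1 hκ).trans_le (min_le_right _ _))
  rw [abs_lt] at h1
  refine ⟨by linarith, fun x hx => ?_⟩
  refine ((h κ (Metric.ball_subset_ball (min_le_left _ _) hκ)).2 x hx).trans ?_
  unfold envelope
  gcongr
  linarith

/-- Uniform bound on a ball near any point of the cut plane. -/
lemma exists_norm_gk_le_of_norm_lt [LowDim d] {κ₀ : ℂ} (hκ₀ : κ₀ ∈ Complex.slitPlane) (r : ℝ) :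
    ∃ ρ : ℝ, 0 < ρ ∧ ∃ C : ℝ, 0 ≤ C ∧ ∀ κ ∈ Metric.ball κ₀ ρ, κ ∈ Complex.slitPlane ∧
      ∀ x : EuclideanSpace ℝ (Fin d), x ≠ 0 → ‖x‖ < r → ‖gk d κ x‖ ≤ C * envelope d 1 x := by
  obtain ⟨ρ, hρ, C, hC, h⟩ := exists_norm_gk_le (d := d) hκ₀
  refine ⟨ρ, hρ, C * Real.exp ((1 + ‖κ₀‖ + ρ) * r), by positivity,
    fun κ hκ => ⟨(h κ hκ).1, fun x hx hxr => ?_⟩⟩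
  refine ((h κ hκ).2 x hx).trans ?_
  have h1 : |κ.re| ≤ ‖κ₀‖ + ρ := by
    have h2 : ‖κ‖ ≤ ‖κ₀‖ + ‖κ - κ₀‖ := by
      simpa using norm_add_le κ₀ (κ - κ₀)
    have := mem_ball_iff_norm.1 hκ
    linarith [Complex.abs_re_le_norm κ]
  have h3 : Real.exp (-κ.re * ‖x‖) ≤ Real.exp ((1 + ‖κ₀‖ + ρ) * r) * Real.exp (-1 * ‖x‖) := by
    rw [← Real.exp_add]
    refine Real.exp_le_exp.2 ?_
    have h4 := (abs_le.1 h1).1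
    have h5 := norm_nonneg x
    have h6 : (1 + ‖κ₀‖ + ρ) * ‖x‖ ≤ (1 + ‖κ₀‖ + ρ) * r := by gcongr
    nlinarith
  unfold envelope
  calc _ ≤ C * (‖x‖ ^ (-((d : ℝ) - 1) / 2) *
        (Real.exp ((1 + ‖κ₀‖ + ρ) * r) * Real.exp (-1 * ‖x‖))) := by gcongr
    _ = _ := by ring

lemma aestronglyMeasurable_gk [LowDim d] {κ : ℂ} (hκ : κ ∈ Complex.slitPlane)
    {μ : Measure (EuclideanSpace ℝ (Fin d))} : AEStronglyMeasurable (gk d κ) μ :=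
  (measurable_gk hκ).aestronglyMeasurable

lemma integrable_gk [LowDim d] {κ : ℂ} (hκ : 0 < κ.re) : Integrable (gk d κ) := by
  obtain ⟨ρ, hρ, C, hC, h⟩ := exists_norm_gk_le_envelope (d := d) hκ
  refine ((integrable_envelope (half_pos hκ)).const_mul C).mono'
    (aestronglyMeasurable_gk (Complex.mem_slitPlane_iff.2 (Or.inl hκ))) ?_
  filter_upwards [ae_ne_zero] with x hx
  exact (h κ (Metric.mem_ball_self hρ)).2 x hx

lemma memLp_two_gk [LowDim d] {κ : ℂ} (hκ : 0 < κ.re) : MemLp (gk d κ) 2 := by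
  obtain ⟨ρ, hρ, C, hC, h⟩ := exists_norm_gk_le_envelope (d := d) hκ
  refine ((memLp_two_envelope (half_pos hκ)).const_mul C).mono
    (aestronglyMeasurable_gk (Complex.mem_slitPlane_iff.2 (Or.inl hκ))) ?_
  filter_upwards [ae_ne_zero] with x hx
  exact ((h κ (Metric.mem_ball_self hρ)).2 x hx).trans (le_abs_self _)

lemma tendsto_gk_sub_singularPart [hd : LowDim d] {κ : ℂ} (hκ : κ ∈ Complex.slitPlane) :
    Tendsto (fun x => gk d κ x - singularPart d x) (𝓝[≠] 0) (𝓝 (greg d κ)) := by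
  have hκ0 := Complex.slitPlane_ne_zero hκ
  have hpi : (Real.pi : ℂ) ≠ 0 := Complex.ofReal_ne_zero.2 Real.pi_ne_zero
  have hn : Tendsto (fun x : EuclideanSpace ℝ (Fin d) => ‖x‖) (𝓝[≠] 0) (𝓝[>] 0) :=
    tendsto_norm_nhdsNE_zero
  rcases hd.cases with rfl | rfl | rfl
  · have : Continuous fun r : ℝ => Complex.exp (-(κ * (r : ℂ))) / (2 * κ) := by fun_prop
    have h1 := ((this.tendsto 0).mono_left nhdsWithin_le_nhds).comp hn
    simpa [gk, greg, singularPart, Function.comp_def] using h1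
  · have h1 := ((tendsto_bessK0_add_log hκ).div_const (2 * Real.pi : ℂ)).comp hn
    refine h1.congr fun x => ?_
    simp only [gk, singularPart, Function.comp]
    push_cast
    ring
  · have h1 : HasDerivAt (fun r : ℝ => Complex.exp (-(κ * (r : ℂ)))) (-κ) 0 := by
      have h2 : HasDerivAt (fun z : ℂ => Complex.exp (-(κ * z)))
          (Complex.exp (-(κ * ((0 : ℝ) : ℂ))) * -(κ * 1)) ((0 : ℝ) : ℂ) :=
        (((hasDerivAt_id _).const_mul κ).neg).cexp
      have := h2.comp_ofReal
      simpa using this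
    have h2 := (h1.tendsto_slope_zero.mono_left
      (nhdsWithin_mono 0 fun r (hr : r ∈ Set.Ioi (0 : ℝ)) => (ne_of_gt hr))).comp hn
    have h3 := h2.div_const (4 * Real.pi : ℂ)
    refine h3.congr' ?_
    filter_upwards [self_mem_nhdsWithin] with x hx
    have hx' : ((‖x‖ : ℝ) : ℂ) ≠ 0 := Complex.ofReal_ne_zero.2 (norm_ne_zero_iff.2 hx)
    simp only [gk, singularPart, Function.comp]
    simp only [zero_add, Complex.ofReal_zero, mul_zero, neg_zero, Complex.exp_zero]
    rw [Complex.real_smul]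
    push_cast
    field_simp

lemma nhds_inf_ae_le [LowDim d] :
    𝓝 (0 : EuclideanSpace ℝ (Fin d)) ⊓ ae volume ≤ 𝓝[≠] 0 := by
  refine inf_le_inf_left _ ?_
  rw [le_principal_iff]
  exact ae_ne_zero

end GreenFunctions

/-! ### The Green functions through the heat kernel -/

section HeatKernel

open FourierTransform

variable {d : ℕ}

/-- Substitution `v = sinh (u / 2)`. -/
lemma integrable_and_integral_cosh_half {s : ℝ} (hs : 0 < s) :
    Integrable (fun u : ℝ => Real.cosh (u / 2) * Real.exp (-s * Real.cosh u)) ∧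
    ∫ u : ℝ, Real.cosh (u / 2) * Real.exp (-s * Real.cosh u) =
      2 * Real.exp (-s) * √(Real.pi / (2 * s)) := by
  have himg : (fun u : ℝ => Real.sinh (u / 2)) '' Set.univ = Set.univ := by
    rw [Set.image_univ, Set.range_eq_univ]
    intro y
    exact ⟨2 * Real.arsinh y, by simp [Real.sinh_arsinh]⟩
  have hderiv : ∀ u ∈ Set.univ, HasDerivWithinAt (fun u : ℝ => Real.sinh (u / 2))
      (Real.cosh (u / 2) * (1 / 2)) Set.univ u := fun u _ =>
    (((hasDerivAt_id u).div_const 2).sinh).hasDerivWithinAt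
  have hinj : Set.InjOn (fun u : ℝ => Real.sinh (u / 2)) Set.univ := fun u _ v _ h => by
    have := Real.sinh_injective h
    linarith
  have hpt : ∀ u : ℝ, |Real.cosh (u / 2) * (1 / 2)| • Real.exp (-(2 * s) * Real.sinh (u / 2) ^ 2) =
      (Real.exp s / 2) * (Real.cosh (u / 2) * Real.exp (-s * Real.cosh u)) := by
    intro u
    have h0 := Real.cosh_pos (u / 2)
    have h1 : Real.cosh u = 1 + 2 * Real.sinh (u / 2) ^ 2 := by
      have h2 := Real.cosh_two_mul (u / 2)
      rw [show 2 * (u / 2) = u by ring] at h2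
      rw [h2, Real.cosh_sq]; ring
    rw [abs_of_pos (by positivity), h1, smul_eq_mul]
    have h3 : Real.exp (-s * (1 + 2 * Real.sinh (u / 2) ^ 2)) =
        Real.exp (-s) * Real.exp (-(2 * s) * Real.sinh (u / 2) ^ 2) := by
      rw [← Real.exp_add]; congr 1; ring
    have h4 : Real.exp s * Real.exp (-s) = 1 := by rw [← Real.exp_add]; simp
    rw [h3]
    linear_combination (-(1 / 2) * Real.cosh (u / 2) *
      Real.exp (-(2 * s) * Real.sinh (u / 2) ^ 2)) * h4
  have h1 := (integrableOn_image_iff_integrableOn_abs_deriv_smul MeasurableSet.univ hderiv hinj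
    (fun v : ℝ => Real.exp (-(2 * s) * v ^ 2)))
  have h2 := (integral_image_eq_integral_abs_deriv_smul MeasurableSet.univ hderiv hinj
    (fun v : ℝ => Real.exp (-(2 * s) * v ^ 2)))
  rw [himg] at h1 h2
  simp only [integrableOn_univ, Measure.restrict_univ, hpt] at h1 h2
  have h3 := h1.1 (integrable_exp_neg_mul_sq (by positivity))
  have he := (Real.exp_pos s).ne'
  constructor
  · refine (h3.const_mul (2 / Real.exp s)).congr (Eventually.of_forall fun u => ?_)
    field_simp
  · rw [integral_gaussian, integral_const_mul] at h2
    rw [h2, Real.exp_neg]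
    field_simp

lemma integrable_exp_half_mul {s : ℝ} (hs : 0 < s) {c : ℝ} (hc : |c| ≤ 1 / 2) :
    Integrable (fun u : ℝ => Real.exp (c * u) * Real.exp (-s * Real.cosh u)) := by
  refine ((integrable_and_integral_cosh_half hs).1.const_mul 2).mono' (by fun_prop)
    (Eventually.of_forall fun u => ?_)
  rw [Real.norm_of_nonneg (by positivity), ← mul_assoc]
  refine mul_le_mul_of_nonneg_right ?_ (Real.exp_pos _).le
  rw [← Real.cosh_abs, Real.cosh_eq]
  have h1 : c * u ≤ |u / 2| := by
    refine (le_abs_self _).trans ?_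
    rw [abs_mul, abs_div, abs_two]
    nlinarith [abs_nonneg u]
  have := Real.exp_le_exp.2 h1
  have := Real.exp_pos (-|u / 2|)
  linarith

lemma integral_exp_half_mul {s : ℝ} (hs : 0 < s) {c : ℝ} (hc : |c| = 1 / 2) :
    ∫ u : ℝ, Real.exp (c * u) * Real.exp (-s * Real.cosh u) =
      2 * Real.exp (-s) * √(Real.pi / (2 * s)) := by
  have h1 : ∫ u : ℝ, Real.exp (c * u) * Real.exp (-s * Real.cosh u) =
      ∫ u : ℝ, Real.exp (-c * u) * Real.exp (-s * Real.cosh u) := by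
    rw [← integral_neg_eq_self]
    simp
  have h2 := integral_add (integrable_exp_half_mul hs hc.le)
    (integrable_exp_half_mul hs (c := -c) (by rw [abs_neg]; exact hc.le))
  rw [← (integrable_and_integral_cosh_half hs).2]
  have h3 : ∀ u : ℝ, Real.exp (c * u) * Real.exp (-s * Real.cosh u) +
      Real.exp (-c * u) * Real.exp (-s * Real.cosh u) =
      2 * (Real.cosh (u / 2) * Real.exp (-s * Real.cosh u)) := by
    intro u
    have h4 : Real.cosh (u / 2) = Real.cosh (c * u) := by
      rcases eq_or_eq_neg_of_abs_eq hc with h | h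
      · rw [h]; congr 1; ring
      · rw [h, ← Real.cosh_neg]; congr 1; ring
    rw [h4, Real.cosh_eq (c * u), neg_mul c u]; ring
  simp only [h3] at h2
  rw [integral_const_mul, ← h1] at h2
  linarith

/-- The heat kernel at time `t`, damped by `e^{-tκ²}`, as a function of the radius. -/
def heat (d : ℕ) (κ r t : ℝ) : ℝ :=
  Real.exp (-t * κ ^ 2) * ((4 * Real.pi * t) ^ (-(d : ℝ) / 2) * Real.exp (-(1 / (4 * t)) * r ^ 2))

lemma heat_nonneg {κ r t : ℝ} (ht : 0 < t) : 0 ≤ heat d κ r t := by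
  have := Real.pi_pos
  unfold heat; positivity

/-- Substitution `t = (r / 2κ) eᵘ` in the time integral of the heat kernel. -/
lemma integral_heat_eq {κ r : ℝ} (hκ : 0 < κ) (hr : 0 < r) :
    ∫ t in Set.Ioi (0 : ℝ), heat d κ r t =
      r / (2 * κ) * (4 * Real.pi * (r / (2 * κ))) ^ (-(d : ℝ) / 2) *
        ∫ u : ℝ, Real.exp ((1 - (d : ℝ) / 2) * u) * Real.exp (-(κ * r) * Real.cosh u) := by
  set c := r / (2 * κ) with hc
  have hc0 : 0 < c := by positivity
  have himg : (fun u : ℝ => c * Real.exp u) '' Set.univ = Set.Ioi 0 := by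
    ext y
    constructor
    · rintro ⟨u, _, rfl⟩
      exact mul_pos hc0 (Real.exp_pos u)
    · intro hy
      refine ⟨Real.log (y / c), trivial, ?_⟩
      simp only
      rw [Real.exp_log (div_pos hy hc0)]
      field_simp
  have h2 := integral_image_eq_integral_abs_deriv_smul MeasurableSet.univ
    (f := fun u : ℝ => c * Real.exp u) (f' := fun u => c * Real.exp u)
    (fun u _ => ((Real.hasDerivAt_exp u).const_mul c).hasDerivWithinAt)
    (fun u _ v _ h => Real.exp_injective (mul_left_cancel₀ hc0.ne' h)) (heat d κ r)
  rw [himg, Measure.restrict_univ] at h2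
  rw [h2, ← integral_const_mul]
  refine integral_congr_ae (Eventually.of_forall fun u => ?_)
  have he := Real.exp_pos u
  have hpi := Real.pi_pos
  simp only [heat]
  rw [abs_of_pos (by positivity), smul_eq_mul, ← mul_assoc (4 * Real.pi),
    Real.mul_rpow (by positivity) he.le, ← Real.exp_mul]
  have h3 : Real.exp (-(c * Real.exp u) * κ ^ 2) * Real.exp (-(1 / (4 * (c * Real.exp u))) * r ^ 2) =
      Real.exp (-(κ * r) * Real.cosh u) := by
    rw [← Real.exp_add, Real.cosh_eq, Real.exp_neg]
    congr 1
    rw [hc]; field_simp; ring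
  have h4 : Real.exp u * Real.exp (u * (-(d : ℝ) / 2)) = Real.exp ((1 - (d : ℝ) / 2) * u) := by
    rw [← Real.exp_add]; congr 1; ring
  rw [← h3, ← h4]
  ring

/-- The Green function is the Laplace transform of the heat kernel. -/
lemma gk_ofReal_eq [hd : LowDim d] {κ : ℝ} (hκ : 0 < κ) {x : EuclideanSpace ℝ (Fin d)}
    (hx : x ≠ 0) : gk d κ x = ((∫ t in Set.Ioi (0 : ℝ), heat d κ ‖x‖ t : ℝ) : ℂ) := by
  have hr : 0 < ‖x‖ := norm_pos_iff.2 hx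
  have hpi := Real.pi_pos
  rw [integral_heat_eq hκ hr]
  have hsq : ∀ a : ℝ, 0 < a → a ^ (1 / 2 : ℝ) = √a := fun a _ => (Real.sqrt_eq_rpow a).symm
  rcases hd.cases with rfl | rfl | rfl
  · rw [integral_exp_half_mul (mul_pos hκ hr) (by norm_num)]
    simp only [gk]
    have h1 : ‖x‖ / (2 * κ) * (4 * Real.pi * (‖x‖ / (2 * κ))) ^ (-((1 : ℕ) : ℝ) / 2) *
        (2 * Real.exp (-(κ * ‖x‖)) * √(Real.pi / (2 * (κ * ‖x‖)))) =
        Real.exp (-(κ * ‖x‖)) / (2 * κ) := by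
      have h2 : (-((1 : ℕ) : ℝ) / 2) = -(1 / 2) := by norm_num
      rw [h2, Real.rpow_neg (by positivity), hsq _ (by positivity)]
      have h3 : √(Real.pi / (2 * (κ * ‖x‖))) =
          √(4 * Real.pi * (‖x‖ / (2 * κ))) * (1 / (2 * ‖x‖)) := by
        have h4 : Real.pi / (2 * (κ * ‖x‖)) =
          (4 * Real.pi * (‖x‖ / (2 * κ))) * (1 / (2 * ‖x‖)) ^ 2 := by
          field_simp; ring
        rw [h4, Real.sqrt_mul (by positivity), Real.sqrt_sq (by positivity)]
      rw [h3]
      have h5 : √(4 * Real.pi * (‖x‖ / (2 * κ))) ≠ 0 := (Real.sqrt_pos.2 (by positivity)).ne'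
      field_simp
    rw [h1]
    push_cast
    rfl
  · have h1 := integral_exp_cosh_ofReal (mul_pos hκ hr)
    have h2 : ∀ t : ℝ, Complex.exp (-((κ * ‖x‖ : ℝ) : ℂ) * (Real.cosh t : ℂ)) =
        ((Real.exp (-(κ * ‖x‖) * Real.cosh t) : ℝ) : ℂ) := fun t => by push_cast; rfl
    simp only [h2] at h1
    rw [integral_complex_ofReal] at h1
    have h3 : ∀ u : ℝ, Real.exp ((1 - ((2 : ℕ) : ℝ) / 2) * u) = 1 := by intro u; norm_num
    simp only [h3, one_mul, gk]
    have h4 : -((2 : ℕ) : ℝ) / 2 = -1 := by norm_num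
    rw [h4, Real.rpow_neg_one]
    have h5 : ‖x‖ / (2 * κ) * (4 * Real.pi * (‖x‖ / (2 * κ)))⁻¹ = (4 * Real.pi)⁻¹ := by
      field_simp
    rw [h5]
    push_cast at h1 ⊢
    rw [h1]
    field_simp
    norm_num
  · rw [integral_exp_half_mul (mul_pos hκ hr) (by norm_num)]
    simp only [gk]
    have h1 : ‖x‖ / (2 * κ) * (4 * Real.pi * (‖x‖ / (2 * κ))) ^ (-((3 : ℕ) : ℝ) / 2) *
        (2 * Real.exp (-(κ * ‖x‖)) * √(Real.pi / (2 * (κ * ‖x‖)))) =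
        Real.exp (-(κ * ‖x‖)) / (4 * Real.pi * ‖x‖) := by
      have h2 : (-((3 : ℕ) : ℝ) / 2) = -(1 + 1 / 2) := by norm_num
      rw [h2, Real.rpow_neg (by positivity), Real.rpow_add (by positivity), Real.rpow_one,
        hsq _ (by positivity)]
      have h3 : √(Real.pi / (2 * (κ * ‖x‖))) =
          √(4 * Real.pi * (‖x‖ / (2 * κ))) * (1 / (2 * ‖x‖)) := by
        have h4 : Real.pi / (2 * (κ * ‖x‖)) =
          (4 * Real.pi * (‖x‖ / (2 * κ))) * (1 / (2 * ‖x‖)) ^ 2 := by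
          field_simp; ring
        rw [h4, Real.sqrt_mul (by positivity), Real.sqrt_sq (by positivity)]
      rw [h3]
      have h5 : √(4 * Real.pi * (‖x‖ / (2 * κ))) ≠ 0 := (Real.sqrt_pos.2 (by positivity)).ne'
      field_simp
    rw [h1]
    push_cast
    rfl

lemma measurable_heat (κ : ℝ) : Measurable fun p : ℝ × EuclideanSpace ℝ (Fin d) =>
    heat d κ ‖p.2‖ p.1 := by
  unfold heat
  fun_prop

/-- The Fourier transform of the heat kernel. -/
lemma fourier_heat {κ t : ℝ} (ht : 0 < t) (ξ : EuclideanSpace ℝ (Fin d)) :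
    𝓕 (fun x : EuclideanSpace ℝ (Fin d) => (heat d κ ‖x‖ t : ℂ)) ξ =
      Complex.exp (-t * ((symb ξ : ℂ) + κ ^ 2)) := by
  have hpi := Real.pi_pos
  have hb : 0 < (((1 / (4 * t) : ℝ)) : ℂ).re := by rw [Complex.ofReal_re]; positivity
  have h1 := fourier_gaussian_innerProductSpace (V := EuclideanSpace ℝ (Fin d)) hb ξ
  have h2 : (fun x : EuclideanSpace ℝ (Fin d) => (heat d κ ‖x‖ t : ℂ)) =
      ((Real.exp (-t * κ ^ 2) * (4 * Real.pi * t) ^ (-(d : ℝ) / 2) : ℝ) : ℂ) •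
        fun x : EuclideanSpace ℝ (Fin d) => Complex.exp (-((1 / (4 * t) : ℝ) : ℂ) * ‖x‖ ^ 2) := by
    ext x
    simp only [heat, Pi.smul_apply, smul_eq_mul]
    push_cast; ring
  have hsmul : ∀ (c : ℂ) (g : EuclideanSpace ℝ (Fin d) → ℂ), 𝓕 (c • g) ξ = c * 𝓕 g ξ := by
    intro c g
    rw [Real.fourier_eq, Real.fourier_eq, ← integral_const_mul]
    refine integral_congr_ae (Eventually.of_forall fun x => ?_)
    simp only [Pi.smul_apply, Circle.smul_def, smul_eq_mul]
    ring
  rw [h2, hsmul, h1, finrank_euclideanSpace_fin]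
  have h3 : (Real.pi : ℂ) / ((1 / (4 * t) : ℝ) : ℂ) = ((4 * Real.pi * t : ℝ) : ℂ) := by
    push_cast; field_simp
  have h4 : ((d : ℂ) / 2) = (((d : ℝ) / 2 : ℝ) : ℂ) := by push_cast; rfl
  rw [h3, h4, ← Complex.ofReal_cpow (by positivity)]
  have h5 : (4 * Real.pi * t) ^ (-(d : ℝ) / 2) * (4 * Real.pi * t) ^ ((d : ℝ) / 2) = 1 := by
    rw [← Real.rpow_add (by positivity)]
    have : -(d : ℝ) / 2 + (d : ℝ) / 2 = 0 := by ring
    rw [this, Real.rpow_zero]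
  have h6 : Complex.exp (-t * ((symb ξ : ℂ) + κ ^ 2)) = Complex.exp (-t * κ ^ 2) *
      Complex.exp (-(Real.pi : ℂ) ^ 2 * ‖ξ‖ ^ 2 / ((1 / (4 * t) : ℝ) : ℂ)) := by
    rw [← Complex.exp_add]
    congr 1
    have : (t : ℂ) ≠ 0 := Complex.ofReal_ne_zero.2 ht.ne'
    simp only [symb]
    push_cast; field_simp; ring
  rw [h6]
  have h5' : (((4 * Real.pi * t) ^ (-(d : ℝ) / 2) : ℝ) : ℂ) *
    (((4 * Real.pi * t) ^ ((d : ℝ) / 2) : ℝ) : ℂ) = 1 := by rw [← Complex.ofReal_mul, h5]; simp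
  push_cast
  linear_combination (Complex.exp (-t * κ ^ 2) *
    Complex.exp (-(Real.pi : ℂ) ^ 2 * ‖ξ‖ ^ 2 / (1 / (4 * t)))) * h5'

lemma integrable_heat {κ t : ℝ} (ht : 0 < t) :
    Integrable (fun x : EuclideanSpace ℝ (Fin d) => heat d κ ‖x‖ t) := by
  have hb : 0 < (((1 / (4 * t) : ℝ)) : ℂ).re := by rw [Complex.ofReal_re]; positivity
  have h1 := (GaussianFourier.integrable_cexp_neg_mul_sq_norm_add hb 0
    (0 : EuclideanSpace ℝ (Fin d))).re.const_mul
      (Real.exp (-t * κ ^ 2) * (4 * Real.pi * t) ^ (-(d : ℝ) / 2))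
  refine h1.congr (Eventually.of_forall fun x => ?_)
  have h2 : -((1 / (4 * t) : ℝ) : ℂ) * (‖x‖ : ℂ) ^ 2 + 0 * ((inner ℝ 0 x : ℝ) : ℂ) =
      ((-(1 / (4 * t)) * ‖x‖ ^ 2 : ℝ) : ℂ) := by push_cast; ring
  simp only [heat]
  rw [h2, ← Complex.ofReal_exp, RCLike.re_to_complex, Complex.ofReal_re]
  ring

lemma integral_heat {κ t : ℝ} (ht : 0 < t) :
    ∫ x : EuclideanSpace ℝ (Fin d), heat d κ ‖x‖ t = Real.exp (-t * κ ^ 2) := by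
  have h1 := fourier_heat (d := d) (κ := κ) ht 0
  rw [Real.fourier_eq] at h1
  simp only [inner_zero_right, neg_zero, AddChar.map_zero_eq_one, one_smul, symb, norm_zero] at h1
  rw [integral_complex_ofReal] at h1
  have h2 : Complex.exp (-t * (((((2 * Real.pi) ^ 2 * 0 ^ 2 : ℝ)) : ℂ) + κ ^ 2)) =
      ((Real.exp (-t * κ ^ 2) : ℝ) : ℂ) := by push_cast; simp
  rw [h2] at h1
  exact_mod_cast h1

/-- For real `κ`, by Fubini and the Fourier transform of the heat kernel. -/
lemma fourier_gk_ofReal [LowDim d] {κ : ℝ} (hκ : 0 < κ) (ξ : EuclideanSpace ℝ (Fin d)) :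
    𝓕 (gk d κ) ξ = 1 / ((symb ξ : ℂ) + κ ^ 2) := by
  have hs := symb_nonneg ξ
  let F : ℝ → EuclideanSpace ℝ (Fin d) → ℂ := fun t x =>
    Real.fourierChar (-(inner ℝ x ξ)) • (heat d κ ‖x‖ t : ℂ)
  have hnorm : ∀ t ∈ Set.Ioi (0 : ℝ), ∀ x, ‖F t x‖ = heat d κ ‖x‖ t := by
    intro t ht x
    rw [Circle.norm_smul, Complex.norm_real, Real.norm_of_nonneg (heat_nonneg ht)]
  have hmeas : Measurable (Function.uncurry F) := by
    have h1 := measurable_heat (d := d) κ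
    have h2 : Measurable fun p : ℝ × EuclideanSpace ℝ (Fin d) =>
        ((Real.fourierChar (-(inner ℝ p.2 ξ)) : Circle) : ℂ) := by
      refine Continuous.measurable ?_
      have := Real.continuous_fourierChar
      fun_prop
    exact h2.mul (Complex.measurable_ofReal.comp h1)
  have hint : Integrable (Function.uncurry F)
      ((volume.restrict (Set.Ioi (0 : ℝ))).prod volume) := by
    rw [integrable_prod_iff hmeas.aestronglyMeasurable]
    constructor
    · filter_upwards [self_mem_ae_restrict measurableSet_Ioi] with t ht
      refine (integrable_heat (d := d) (κ := κ) ht).mono'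
        (hmeas.comp measurable_prodMk_left).aestronglyMeasurable
        (Eventually.of_forall fun x => (hnorm t ht x).le)
    · have h1 : IntegrableOn (fun t : ℝ => Real.exp (-t * κ ^ 2)) (Set.Ioi 0) := by
        refine (integrableOn_exp_mul_Ioi (a := -κ ^ 2) (by nlinarith) 0).congr_fun
          (fun t _ => ?_) measurableSet_Ioi
        simp only; congr 1; ring
      refine h1.congr_fun (fun t ht => ?_) measurableSet_Ioi
      change _ = ∫ x, ‖F t x‖
      simp only [hnorm t ht, integral_heat ht]
  have hswap := integral_integral_swap hint
  rw [Real.fourier_eq]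
  have h1 : ∫ x : EuclideanSpace ℝ (Fin d), Real.fourierChar (-(inner ℝ x ξ)) • gk d κ x =
      ∫ x, (∫ t in Set.Ioi (0 : ℝ), F t x) := by
    refine integral_congr_ae ?_
    filter_upwards [ae_ne_zero] with x hx
    simp only [F, Circle.smul_def, smul_eq_mul]
    rw [gk_ofReal_eq hκ hx, integral_const_mul, integral_complex_ofReal]
  rw [h1, ← hswap]
  have h2 : ∀ t ∈ Set.Ioi (0 : ℝ), ∫ x, F t x =
      Complex.exp (-((symb ξ : ℂ) + κ ^ 2) * t) := by
    intro t ht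
    have := fourier_heat (d := d) (κ := κ) ht ξ
    rw [Real.fourier_eq] at this
    rw [this]; congr 1; ring
  have hre : 0 < ((symb ξ : ℂ) + κ ^ 2).re := by
    have : ((symb ξ : ℂ) + κ ^ 2) = ((symb ξ + κ ^ 2 : ℝ) : ℂ) := by push_cast; rfl
    rw [this, Complex.ofReal_re]; positivity
  rw [setIntegral_congr_fun measurableSet_Ioi h2,
    integral_exp_mul_complex_Ioi (by rw [Complex.neg_re]; linarith)]
  simp only [Complex.ofReal_zero, mul_zero, Complex.exp_zero]
  rw [neg_div_neg_eq]

lemma symb_add_sq_ne_zero {κ : ℂ} (hκ : 0 < κ.re) (ξ : EuclideanSpace ℝ (Fin d)) :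
    (symb ξ : ℂ) + κ ^ 2 ≠ 0 := by
  intro h
  have hs := symb_nonneg ξ
  have h1 := congrArg Complex.re h
  have h2 := congrArg Complex.im h
  simp only [sq, Complex.add_re, Complex.add_im, Complex.ofReal_re, Complex.ofReal_im,
    Complex.mul_re, Complex.mul_im, Complex.zero_re, Complex.zero_im, zero_add] at h1 h2
  have h3 : κ.im = 0 := by
    have : κ.re * κ.im = 0 := by linarith
    exact (mul_eq_zero.1 this).resolve_left hκ.ne'
  rw [h3] at h1
  nlinarith

/-- The Fourier transform of the Green function, by holomorphic continuation from real `κ`. -/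
lemma fourier_gk [LowDim d] {κ : ℂ} (hκ : 0 < κ.re) (ξ : EuclideanSpace ℝ (Fin d)) :
    𝓕 (gk d κ) ξ = 1 / ((symb ξ : ℂ) + κ ^ 2) := by
  refine eq_of_eq_ofReal (f := fun κ => 𝓕 (gk d κ) ξ)
    (g := fun κ => 1 / ((symb ξ : ℂ) + κ ^ 2)) (fun z hz => ?_) (fun z hz => ?_)
    (fun s hs => fourier_gk_ofReal hs ξ) hκ
  · obtain ⟨ρ, hρ, C, hC, h⟩ := exists_norm_gk_le_envelope (d := d) hz
    simp only [Real.fourier_eq]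
    refine differentiableAt_integral hρ
      (b := fun x => C * envelope d (z.re / 2) x)
      ((integrable_envelope (half_pos hz)).const_mul C) (fun w hw => ?_) ?_ ?_
    · have h1 := aestronglyMeasurable_gk (d := d) (μ := volume)
        (Complex.mem_slitPlane_iff.2 (Or.inl (h w hw).1))
      have h2 : Continuous fun x : EuclideanSpace ℝ (Fin d) =>
          ((Real.fourierChar (-(inner ℝ x ξ)) : Circle) : ℂ) := by
        have := Real.continuous_fourierChar
        fun_prop
      exact h2.aestronglyMeasurable.mul h1
    · filter_upwards [ae_ne_zero] with x hx w hw
      refine DifferentiableAt.differentiableWithinAt ?_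
      simp only [Circle.smul_def, smul_eq_mul]
      exact (differentiableAt_gk (Complex.mem_slitPlane_iff.2 (Or.inl (h w hw).1)) hx).const_mul _
    · filter_upwards [ae_ne_zero] with x hx w hw
      rw [Circle.norm_smul]
      exact (h w hw).2 x hx
  · exact DifferentiableAt.fun_div (by fun_prop) (by fun_prop) (symb_add_sq_ne_zero hz ξ)

end HeatKernel

/-! ### Convolution, multiplication and pairing on `L²` -/

section L2Operators

open FourierTransform

/-- Multiplication of square integrable functions by bounded ones. -/
def mulL {α : Type*} [MeasurableSpace α] (μ : Measure α) :
    Lp ℂ ⊤ μ →L[ℂ] Lp ℂ 2 μ →L[ℂ] Lp ℂ 2 μ :=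
  (ContinuousLinearMap.mul ℂ ℂ).holderL μ ⊤ 2 2

lemma mulL_ae_eq {α : Type*} [MeasurableSpace α] {μ : Measure α} (m : Lp ℂ ⊤ μ) (u : Lp ℂ 2 μ) :
    mulL μ m u =ᵐ[μ] fun x => m x * u x :=
  (ContinuousLinearMap.mul ℂ ℂ).coeFn_holder m u

/-- The bilinear pairing `∫ u v` of square integrable functions. -/
def pairL {α : Type*} [MeasurableSpace α] (μ : Measure α) :
    Lp ℂ 2 μ →L[ℂ] Lp ℂ 2 μ →L[ℂ] ℂ :=
  (ContinuousLinearMap.mul ℂ ℂ).lpPairing μ 2 2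

lemma pairL_eq_integral {α : Type*} [MeasurableSpace α] {μ : Measure α} (u v : Lp ℂ 2 μ) :
    pairL μ u v = ∫ x, u x * v x ∂μ :=
  (ContinuousLinearMap.mul ℂ ℂ).lpPairing_eq_integral u v

lemma pairL_eq_inner {α : Type*} [MeasurableSpace α] {μ : Measure α} {u u' : Lp ℂ 2 μ}
    (h : u' =ᵐ[μ] fun x => (starRingEnd ℂ) (u x)) (v : Lp ℂ 2 μ) :
    pairL μ u v = inner ℂ u' v := by
  rw [pairL_eq_integral, L2.inner_def]
  refine integral_congr_ae ?_
  filter_upwards [h] with x hx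
  rw [RCLike.inner_apply, hx, RCLike.conj_conj, mul_comm]

variable {V : Type*} [NormedAddCommGroup V] [InnerProductSpace ℝ V] [FiniteDimensional ℝ V]
  [MeasurableSpace V] [BorelSpace V]

lemma norm_fourier_le (a : Lp ℂ 1 (volume : Measure V)) (ξ : V) :
    ‖(𝓕 (a : V → ℂ) : V → ℂ) ξ‖ ≤ ‖a‖ := by
  rw [L1.norm_eq_integral_norm]
  exact VectorFourier.norm_fourierIntegral_le_integral_norm _ _ _ _ _

lemma memLp_top_fourier (a : Lp ℂ 1 (volume : Measure V)) :
    MemLp (𝓕 (a : V → ℂ) : V → ℂ) ⊤ := by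
  have hcont : Continuous (𝓕 (a : V → ℂ) : V → ℂ) :=
    VectorFourier.fourierIntegral_continuous Real.continuous_fourierChar
      (innerSL ℝ).continuous₂ (L1.integrable_coeFn a)
  exact memLp_top_of_bound hcont.aestronglyMeasurable ‖a‖ (Eventually.of_forall (norm_fourier_le a))

/-- The Fourier integral, as a bounded map from `L¹` to `L^∞`. -/
def fourierL1 : Lp ℂ 1 (volume : Measure V) →L[ℂ] Lp ℂ ⊤ (volume : Measure V) :=
  LinearMap.mkContinuous
    { toFun := fun a => (memLp_top_fourier a).toLp _
      map_add' := fun a b => by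
        rw [← MemLp.toLp_add]
        refine MemLp.toLp_congr _ _ (Eventually.of_forall fun ξ => ?_)
        simp only [Pi.add_apply, Real.fourier_eq]
        rw [← integral_add]
        · refine integral_congr_ae ?_
          filter_upwards [Lp.coeFn_add a b] with x hx
          rw [hx, Pi.add_apply, smul_add]
        · exact (Real.fourierIntegral_convergent_iff ξ).2 (L1.integrable_coeFn a)
        · exact (Real.fourierIntegral_convergent_iff ξ).2 (L1.integrable_coeFn b)
      map_smul' := fun c a => by
        rw [RingHom.id_apply, ← MemLp.toLp_const_smul]
        refine MemLp.toLp_congr _ _ (Eventually.of_forall fun ξ => ?_)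
        simp only [Pi.smul_apply, Real.fourier_eq, smul_eq_mul]
        rw [← integral_const_mul]
        refine integral_congr_ae ?_
        filter_upwards [Lp.coeFn_smul c a] with x hx
        rw [hx, Pi.smul_apply, Circle.smul_def, Circle.smul_def]
        simp only [smul_eq_mul]
        ring } 1 (fun a => by
      rw [one_mul]
      simp only [LinearMap.coe_mk, AddHom.coe_mk]
      rw [Lp.norm_toLp]
      refine ENNReal.toReal_le_of_le_ofReal (norm_nonneg _) ?_
      rw [eLpNorm_exponent_top]
      exact eLpNormEssSup_le_of_ae_bound (Eventually.of_forall (norm_fourier_le a)))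

lemma fourierL1_ae_eq (a : Lp ℂ 1 (volume : Measure V)) :
    fourierL1 a =ᵐ[volume] (𝓕 (a : V → ℂ) : V → ℂ) :=
  (memLp_top_fourier a).coeFn_toLp

/-- The convolution by an integrable function, as an operator on `L²`. -/
def convOp (a : Lp ℂ 1 (volume : Measure V)) :
    Lp ℂ 2 (volume : Measure V) →L[ℂ] Lp ℂ 2 (volume : Measure V) :=
  ((Lp.fourierTransformₗᵢ V ℂ).symm.toContinuousLinearEquiv :
      Lp ℂ 2 (volume : Measure V) →L[ℂ] Lp ℂ 2 (volume : Measure V)) ∘L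
    mulL volume (fourierL1 a) ∘L
      ((Lp.fourierTransformₗᵢ V ℂ).toContinuousLinearEquiv :
        Lp ℂ 2 (volume : Measure V) →L[ℂ] Lp ℂ 2 (volume : Measure V))

lemma fourier_convOp (a : Lp ℂ 1 (volume : Measure V)) (u : Lp ℂ 2 (volume : Measure V)) :
    (𝓕 (convOp a u) : Lp ℂ 2 (volume : Measure V)) =ᵐ[volume]
      fun ξ => (𝓕 (a : V → ℂ) : V → ℂ) ξ * (𝓕 u : Lp ℂ 2 (volume : Measure V)) ξ := by
  have h1 : (𝓕 (convOp a u) : Lp ℂ 2 (volume : Measure V)) = mulL volume (fourierL1 a) (𝓕 u) :=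
    fourier_fourierInv_eq _
  rw [h1]
  filter_upwards [mulL_ae_eq (fourierL1 a) (𝓕 u), fourierL1_ae_eq a] with ξ h2 h3
  rw [h2, h3]

lemma convOp_add (a b : Lp ℂ 1 (volume : Measure V)) : convOp (a + b) = convOp a + convOp b := by
  ext1 u
  simp [convOp]

lemma differentiableAt_convOp {a : ℂ → Lp ℂ 1 (volume : Measure V)} {κ : ℂ}
    (h : DifferentiableAt ℂ a κ) : DifferentiableAt ℂ (fun κ => convOp (a κ)) κ := by
  have h1 : DifferentiableAt ℂ (fun κ => mulL (volume : Measure V) (fourierL1 (a κ))) κ :=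
    ((mulL volume).differentiableAt.comp _
      ((fourierL1 (V := V)).differentiableAt.comp κ h))
  exact (differentiableAt_const _).clm_comp (h1.clm_comp (differentiableAt_const _))

/-- The `L²` and the `L¹` Fourier transform determine the function consistently. -/
lemma ae_eq_of_fourier_ae_eq (w : Lp ℂ 2 (volume : Measure V)) {g : V → ℂ} (hg : Integrable g)
    (h : (𝓕 w : Lp ℂ 2 (volume : Measure V)) =ᵐ[volume] (𝓕 g : V → ℂ)) : w =ᵐ[volume] g := by
  refine ae_eq_of_integral_schwartz ((Lp.memLp _).locallyIntegrable (by norm_num))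
    hg.locallyIntegrable fun s => ?_
  obtain ⟨t, rfl⟩ : ∃ t : 𝓢(V, ℂ), 𝓕 t = s := ⟨𝓕⁻ s, fourier_fourierInv_eq s⟩
  have e := congrArg (fun T : 𝓢'(V, ℂ) => T t) (Lp.fourier_toTemperedDistribution_eq w)
  simp only [TemperedDistribution.fourier_apply, Lp.toTemperedDistribution_apply, smul_eq_mul] at e
  have hflip := VectorFourier.integral_fourierIntegral_smul_eq_flip (L := innerₗ V)
    (μ := volume) (ν := volume) Real.continuous_fourierChar continuous_inner
    (f := g) (g := (t : V → ℂ)) hg t.integrable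
  rw [flip_innerₗ] at hflip
  calc _ = ∫ x, t x * (𝓕 w : Lp ℂ 2 (volume : Measure V)) x := e
    _ = ∫ x, (𝓕 g : V → ℂ) x * t x := by
        refine integral_congr_ae ?_
        filter_upwards [h] with x hx
        rw [hx, mul_comm]
    _ = ∫ x, g x * (𝓕 (t : V → ℂ) : V → ℂ) x := hflip
    _ = _ := by
        refine integral_congr_ae (Eventually.of_forall fun x => ?_)
        simp only
        rw [mul_comm, SchwartzMap.fourier_coe]

open scoped Convolution in
lemma convOp_ae_eq (a : Lp ℂ 1 (volume : Measure V)) (u : Lp ℂ 2 (volume : Measure V))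
    (hu : Integrable u) :
    convOp a u =ᵐ[volume] ((a : V → ℂ) ⋆[ContinuousLinearMap.mul ℂ ℂ] (u : V → ℂ)) := by
  have ha := L1.integrable_coeFn a
  refine ae_eq_of_fourier_ae_eq _ (ha.integrable_convolution _ hu) ?_
  have hu2 : (𝓕 u : Lp ℂ 2 (volume : Measure V)) =ᵐ[volume] (𝓕 (u : V → ℂ) : V → ℂ) := by
    have := fourier_toLp_ae_eq (Lp.memLp u) hu
    rwa [Lp.toLp_coeFn] at this
  filter_upwards [fourier_convOp a u, hu2] with ξ h1 h2
  rw [h1, h2, Real.fourier_mul_convolution_eq ha hu]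

/-- Restriction to the ball of radius `r`. -/
def cutL (r : ℝ) : Lp ℂ 2 (volume : Measure V) →L[ℂ] Lp ℂ 2 (volume : Measure V) :=
  mulL volume (lpClass ⊤ volume ((Metric.ball (0 : V) r).indicator 1))

lemma cutL_ae_eq (r : ℝ) (u : Lp ℂ 2 (volume : Measure V)) :
    cutL r u =ᵐ[volume] (Metric.ball (0 : V) r).indicator u := by
  have h : MemLp ((Metric.ball (0 : V) r).indicator (1 : V → ℂ)) ⊤ volume :=
    memLp_top_of_bound ((measurable_one.indicator measurableSet_ball).aestronglyMeasurable) 1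
      (Eventually.of_forall fun x => by
        by_cases hx : x ∈ Metric.ball (0 : V) r <;> simp [hx])
  rw [cutL, lpClass_eq h]
  filter_upwards [mulL_ae_eq (h.toLp _) u, h.coeFn_toLp] with x h1 h2
  rw [h1, h2]
  by_cases hx : x ∈ Metric.ball (0 : V) r <;> simp [hx]

lemma integrable_cutL (r : ℝ) (u : Lp ℂ 2 (volume : Measure V)) : Integrable (cutL r u) := by
  refine Integrable.congr ?_ (cutL_ae_eq r u).symm
  rw [integrable_indicator_iff measurableSet_ball]
  exact (Lp.memLp u).locallyIntegrable (by norm_num) |>.integrableOn_isCompact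
    (isCompact_closedBall 0 r) |>.mono_set Metric.ball_subset_closedBall

/-- Convolution by a function supported outside the ball of radius `2r` vanishes between functions
supported in the ball of radius `r`. -/
lemma cutL_convOp_cutL_eq_zero {r : ℝ} {a : Lp ℂ 1 (volume : Measure V)}
    (ha : ∀ᵐ x, ‖x‖ < 2 * r → a x = 0) (u : Lp ℂ 2 (volume : Measure V)) :
    cutL r (convOp a (cutL r u)) = 0 := by
  refine Lp.ext ?_
  filter_upwards [cutL_ae_eq r (convOp a (cutL r u)), convOp_ae_eq a _ (integrable_cutL r u),
    Lp.coeFn_zero ℂ 2 (volume : Measure V)] with x h1 h2 h3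
  rw [h1, h3, Pi.zero_apply]
  by_cases hx : x ∈ Metric.ball (0 : V) r
  · rw [Set.indicator_of_mem hx, h2, MeasureTheory.convolution_def]
    refine integral_eq_zero_of_ae ?_
    filter_upwards [ha, (quasiMeasurePreserving_sub_left volume x).ae (cutL_ae_eq r u)] with t h4 h5
    rw [ContinuousLinearMap.mul_apply', h5, Pi.zero_apply]
    by_cases ht : ‖t‖ < 2 * r
    · rw [h4 ht, zero_mul]
    · rw [Set.indicator_of_notMem, mul_zero]
      rw [mem_ball_zero_iff] at hx ⊢
      intro h6
      have : ‖t‖ ≤ ‖x‖ + ‖x - t‖ := by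
        calc ‖t‖ = ‖x - (x - t)‖ := by congr 1; abel
          _ ≤ _ := norm_sub_le _ _
      linarith
  · rw [Set.indicator_of_notMem hx]

end L2Operators

/-! ### The free resolvent -/

section FreeResolvent

open FourierTransform

variable {d : ℕ}

lemma re_pos_mem_slitPlane {κ : ℂ} (hκ : 0 < κ.re) : κ ∈ Complex.slitPlane :=
  Complex.mem_slitPlane_iff.2 (Or.inl hκ)

lemma conj_mem_slitPlane {κ : ℂ} (hκ : κ ∈ Complex.slitPlane) :
    (starRingEnd ℂ) κ ∈ Complex.slitPlane := by
  rw [Complex.mem_slitPlane_iff] at hκ ⊢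
  simpa using hκ

lemma arg_ne_pi_of_mem {κ : ℂ} (hκ : κ ∈ Complex.slitPlane) : κ.arg ≠ Real.pi :=
  (Complex.mem_slitPlane_iff_arg.1 hκ).1

lemma bessK0_conj {s : ℂ} (hs : s ∈ Complex.slitPlane) :
    bessK0 ((starRingEnd ℂ) s) = (starRingEnd ℂ) (bessK0 s) := by
  unfold bessK0
  rw [map_mul, ← integral_conj, ← Complex.exp_conj, map_neg]
  congr 1
  refine setIntegral_congr_fun measurableSet_Ioi fun y hy => ?_
  rw [map_mul, Complex.conj_ofReal]
  have h1 := mem_slitPlane_add hs (le_of_lt hy)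
  have h3 := Complex.conj_cpow ((y : ℂ) + 2 * s) ((-(1 / 2) : ℝ) : ℂ) (arg_ne_pi_of_mem h1)
  rw [Complex.conj_ofReal] at h3
  rw [← h3, map_add, map_mul, Complex.conj_ofReal, Complex.conj_ofNat]

lemma gk_conj [hd : LowDim d] {κ : ℂ} (hκ : κ ∈ Complex.slitPlane) {x : EuclideanSpace ℝ (Fin d)}
    (hx : x ≠ 0) : gk d ((starRingEnd ℂ) κ) x = (starRingEnd ℂ) (gk d κ x) := by
  rcases hd.cases with rfl | rfl | rfl
  · simp [gk, ← Complex.exp_conj, Complex.conj_ofNat]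
  · simp only [gk, map_div₀, map_mul, Complex.conj_ofReal, Complex.conj_ofNat]
    rw [← bessK0_conj (mem_slitPlane_mul_pos hκ (norm_pos_iff.2 hx)), map_mul, Complex.conj_ofReal]
  · simp [gk, ← Complex.exp_conj, Complex.conj_ofNat]

/-- The Green function as an element of `L²`. -/
def gLp (d : ℕ) (κ : ℂ) : L2 d := lpClass 2 volume (gk d κ)

lemma gLp_ae_eq [LowDim d] {κ : ℂ} (hκ : 0 < κ.re) : gLp d κ =ᵐ[volume] gk d κ := by
  rw [gLp, lpClass_eq (memLp_two_gk hκ)]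
  exact (memLp_two_gk hκ).coeFn_toLp

lemma fourier_gLp [LowDim d] {κ : ℂ} (hκ : 0 < κ.re) :
    (𝓕 (gLp d κ) : L2 d) =ᵐ[volume] fun ξ => 1 / ((symb ξ : ℂ) + κ ^ 2) := by
  rw [gLp, lpClass_eq (memLp_two_gk hκ)]
  filter_upwards [fourier_toLp_ae_eq (memLp_two_gk hκ) (integrable_gk hκ)] with ξ h
  rw [h, fourier_gk hκ]

/-- The free resolvent `(-Δ + κ²)⁻¹`, the convolution by the Green function. -/
def freeRes (d : ℕ) (κ : ℂ) : L2 d →L[ℂ] L2 d := convOp (lpClass 1 volume (gk d κ))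

lemma fourier_freeRes [LowDim d] {κ : ℂ} (hκ : 0 < κ.re) (u : L2 d) :
    (𝓕 (freeRes d κ u) : L2 d) =ᵐ[volume]
      fun ξ => 1 / ((symb ξ : ℂ) + κ ^ 2) * (𝓕 u : L2 d) ξ := by
  have hm : MemLp (gk d κ) 1 volume := memLp_one_iff_integrable.2 (integrable_gk hκ)
  filter_upwards [fourier_convOp (lpClass 1 volume (gk d κ)) u] with ξ h
  rw [freeRes, h, ← fourier_gk hκ]
  congr 1
  rw [Real.fourier_eq, Real.fourier_eq]
  refine integral_congr_ae ?_
  rw [lpClass_eq hm]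
  filter_upwards [hm.coeFn_toLp] with x hx
  rw [hx]

lemma fourier_injective {u v : L2 d} (h : (𝓕 u : L2 d) = 𝓕 v) : u = v :=
  (Lp.fourierTransformₗᵢ _ ℂ).injective h

lemma gLp_conj [LowDim d] {κ : ℂ} (hκ : 0 < κ.re) :
    gLp d ((starRingEnd ℂ) κ) =ᵐ[volume] fun x => (starRingEnd ℂ) (gLp d κ x) := by
  have hκ' : 0 < ((starRingEnd ℂ) κ).re := by simpa using hκ
  filter_upwards [gLp_ae_eq (d := d) hκ, gLp_ae_eq (d := d) hκ', ae_ne_zero] with x h2 h3 h4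
  rw [h2, h3, gk_conj (re_pos_mem_slitPlane hκ) h4]

/-- The pairing with the Green function is the value at the origin of the free resolvent. -/
lemma pairL_gLp [LowDim d] {κ : ℂ} (hκ : 0 < κ.re) (v : L2 d) :
    pairL volume (gLp d κ) v = ∫ ξ, (𝓕 (freeRes d κ v) : L2 d) ξ := by
  have hκ' : 0 < ((starRingEnd ℂ) κ).re := by simpa using hκ
  rw [pairL_eq_inner (gLp_conj hκ), ← Lp.inner_fourier_eq, L2.inner_def]
  refine integral_congr_ae ?_
  filter_upwards [fourier_gLp (d := d) hκ', fourier_freeRes hκ v] with ξ h2 h3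
  rw [h2, h3, RCLike.inner_apply]
  simp only [map_div₀, map_one, map_add, map_pow, Complex.conj_ofReal, Complex.conj_conj]
  ring

lemma integrable_fourier_freeRes [LowDim d] {κ : ℂ} (hκ : 0 < κ.re) (v : L2 d) :
    Integrable (𝓕 (freeRes d κ v) : L2 d) := by
  have h1 : Integrable (fun ξ => (𝓕 (gLp d κ) : L2 d) ξ * (𝓕 v : L2 d) ξ) :=
    MemLp.integrable_mul (Lp.memLp _) (Lp.memLp _)
  refine h1.congr ?_
  filter_upwards [fourier_gLp (d := d) hκ, fourier_freeRes hκ v] with ξ h2 h3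
  rw [h2, h3]

lemma tendsto_freeRes [LowDim d] {κ : ℂ} (hκ : 0 < κ.re) (v : L2 d) :
    Tendsto (freeRes d κ v) (𝓝 0 ⊓ ae volume) (𝓝 (pairL volume (gLp d κ) v)) := by
  rw [pairL_gLp hκ]
  exact tendsto_zero_of_integrable_fourier _ (integrable_fourier_freeRes hκ v)

lemma tendsto_gLp [LowDim d] {κ : ℂ} (hκ : 0 < κ.re) :
    Tendsto (fun x => gLp d κ x - singularPart d x) (𝓝 0 ⊓ ae volume) (𝓝 (greg d κ)) := by
  refine ((tendsto_gk_sub_singularPart (re_pos_mem_slitPlane hκ)).mono_left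
    nhds_inf_ae_le).congr' ?_
  have h : ∀ᶠ x in ae volume, gLp d κ x = gk d κ x := gLp_ae_eq hκ
  filter_upwards [h.filter_mono inf_le_right] with x hx
  rw [hx]

instance nhds_inf_ae_neBot :
    (𝓝 (0 : EuclideanSpace ℝ (Fin d)) ⊓ ae (volume : Measure _)).NeBot := by
  rw [inf_neBot_iff]
  intro s hs t ht
  by_contra h
  rw [Set.not_nonempty_iff_eq_empty] at h
  have h1 : s ⊆ tᶜ := by
    intro x hx hxt
    have : x ∈ s ∩ t := ⟨hx, hxt⟩
    rw [h] at this
    exact this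
  have h2 : (volume : Measure (EuclideanSpace ℝ (Fin d))) s = 0 :=
    measure_mono_null h1 ht
  exact (Measure.measure_pos_of_mem_nhds volume hs).ne' h2

end FreeResolvent

/-! ### The action of the Hamiltonian -/

section Action

open FourierTransform

variable {d : ℕ}

/-- The action of the Hamiltonian in one channel, in the Fourier representation. -/
lemma fourier_action_iff [LowDim d] {κ z c q : ℂ} (hκ : 0 < κ.re) (hz : κ ^ 2 = c - z)
    {Ψ Ξ φ h : L2 d} (h1 : Ψ = φ + q • gLp d κ) (h2 : Ξ = h + (z * q) • gLp d κ) :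
    (𝓕 h : L2 d) =ᵐ[volume] (fun ξ => ((symb ξ : ℂ) + c) * (𝓕 φ : L2 d) ξ) ↔
    (𝓕 Ξ : L2 d) =ᵐ[volume] (fun ξ => ((symb ξ : ℂ) + c) * (𝓕 Ψ : L2 d) ξ - q) := by
  have e1 : (𝓕 Ψ : L2 d) = 𝓕 φ + q • 𝓕 (gLp d κ) := by
    rw [h1, FourierTransform.fourier_add, FourierTransform.fourier_smul]
  have e2 : (𝓕 Ξ : L2 d) = 𝓕 h + (z * q) • 𝓕 (gLp d κ) := by
    rw [h2, FourierTransform.fourier_add, FourierTransform.fourier_smul]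
  have key : ∀ᵐ ξ, ((𝓕 Ξ : L2 d) ξ - (((symb ξ : ℂ) + c) * (𝓕 Ψ : L2 d) ξ - q)) =
      (𝓕 h : L2 d) ξ - ((symb ξ : ℂ) + c) * (𝓕 φ : L2 d) ξ := by
    rw [e1, e2]
    filter_upwards [Lp.coeFn_add (𝓕 φ : L2 d) (q • 𝓕 (gLp d κ)),
      Lp.coeFn_add (𝓕 h : L2 d) ((z * q) • 𝓕 (gLp d κ)), Lp.coeFn_smul q (𝓕 (gLp d κ) : L2 d),
      Lp.coeFn_smul (z * q) (𝓕 (gLp d κ) : L2 d), fourier_gLp (d := d) hκ] with ξ a1 a2 a3 a4 a5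
    rw [a1, a2, Pi.add_apply, Pi.add_apply, a3, a4, Pi.smul_apply, Pi.smul_apply, a5,
      smul_eq_mul, smul_eq_mul]
    have hne := symb_add_sq_ne_zero hκ ξ
    have hc : c = κ ^ 2 + z := by rw [hz]; ring
    rw [hc]
    field_simp
    ring
  constructor
  · intro H
    filter_upwards [key, H] with ξ a b
    rw [b, sub_self] at a
    exact sub_eq_zero.1 a
  · intro H
    filter_upwards [key, H] with ξ a b
    rw [b, sub_self] at a
    exact (sub_eq_zero.1 a.symm)

lemma green_ae_eq [LowDim d] {c z : ℂ} (h : c - z ∈ Complex.slitPlane) :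
    green d (z - c) =ᵐ[volume] gLp d ((c - z) ^ (1 / 2 : ℂ)) := by
  filter_upwards [gLp_ae_eq (d := d) (cpow_half_re_pos h), ae_ne_zero] with x h1 h2
  have h3 : -(z - c) = c - z := by ring
  rw [h1, green_eq_gk (by rwa [h3]) h2, h3]

lemma sub_mem_slitPlane_of_im {z : ℂ} (hz : z.im ≠ 0) (c : ℝ) :
    (c : ℂ) - z ∈ Complex.slitPlane := by
  refine Complex.mem_slitPlane_iff.2 (Or.inr ?_)
  simpa using hz

/-- The action of the Hamiltonian in the Fourier representation: `-Δ + βσ` applied to a function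
with charge `q` at the origin produces the additional term `-q`. -/
lemma isHamAction_iff [LowDim d] {β : ℝ} {Ψ Ξ : State d} {q f : Fin 2 → ℂ} :
    IsHamAction d β Ψ Ξ q f ↔
      (∀ σ : Fin 2, Tendsto (fun x => Ψ σ x - q σ * singularPart d x)
        (𝓝 0 ⊓ ae volume) (𝓝 (f σ))) ∧
      ∀ σ : Fin 2, (𝓕 (Ξ σ) : L2 d) =ᵐ[volume]
        fun ξ => ((symb ξ : ℂ) + (β * sgn σ : ℝ)) * (𝓕 (Ψ σ) : L2 d) ξ - q σ := by
  refine and_congr_right fun _ => ⟨fun H σ => ?_, fun H z hz => ?_⟩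
  · obtain ⟨φ, h, hf, he⟩ := H Complex.I (by simp)
    have hm := sub_mem_slitPlane_of_im (z := Complex.I) (by simp) (β * sgn σ)
    refine (fourier_action_iff (cpow_half_re_pos hm) (cpow_half_sq _) (φ := φ σ) (h := h σ)
      ?_ ?_).1 ((memSobolev_and_eq_iff (φ σ) (h σ) _).1 (hf σ))
    · refine Lp.ext ?_
      filter_upwards [(he σ).1, green_ae_eq (d := d) hm, Lp.coeFn_add (φ σ)
        (q σ • gLp d (((β * sgn σ : ℝ) - Complex.I) ^ (1 / 2 : ℂ))),
        Lp.coeFn_smul (q σ) (gLp d (((β * sgn σ : ℝ) - Complex.I) ^ (1 / 2 : ℂ)))] with x a1 a2 a3 a4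
      rw [a3, Pi.add_apply, a4, Pi.smul_apply, a1, a2, smul_eq_mul]
    · refine Lp.ext ?_
      filter_upwards [(he σ).2, green_ae_eq (d := d) hm, Lp.coeFn_add (h σ)
        ((Complex.I * q σ) • gLp d (((β * sgn σ : ℝ) - Complex.I) ^ (1 / 2 : ℂ))),
        Lp.coeFn_smul (Complex.I * q σ)
          (gLp d (((β * sgn σ : ℝ) - Complex.I) ^ (1 / 2 : ℂ)))] with x a1 a2 a3 a4
      rw [a3, Pi.add_apply, a4, Pi.smul_apply, a1, a2, smul_eq_mul, mul_assoc]
  · have hm := fun σ : Fin 2 => sub_mem_slitPlane_of_im hz (β * sgn σ)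
    let g : Fin 2 → L2 d := fun σ => gLp d (((β * sgn σ : ℝ) - z) ^ (1 / 2 : ℂ))
    refine ⟨WithLp.toLp 2 fun σ => Ψ σ - q σ • g σ, WithLp.toLp 2 fun σ => Ξ σ - (z * q σ) • g σ,
      fun σ => ?_, fun σ => ⟨?_, ?_⟩⟩
    · refine (memSobolev_and_eq_iff _ _ _).2 ?_
      refine (fourier_action_iff (cpow_half_re_pos (hm σ)) (cpow_half_sq _) (Ψ := Ψ σ) (Ξ := Ξ σ)
        ?_ ?_).2 (H σ)
      · exact (sub_add_cancel _ _).symm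
      · exact (sub_add_cancel _ _).symm
    · filter_upwards [green_ae_eq (d := d) (hm σ), Lp.coeFn_sub (Ψ σ) (q σ • g σ),
        Lp.coeFn_smul (q σ) (g σ)] with x a2 a3 a4
      rw [a2]
      rw [a3, Pi.sub_apply, a4, Pi.smul_apply, smul_eq_mul]
      simp only [g]
      ring
    · filter_upwards [green_ae_eq (d := d) (hm σ), Lp.coeFn_sub (Ξ σ) ((z * q σ) • g σ),
        Lp.coeFn_smul (z * q σ) (g σ)] with x a2 a3 a4
      rw [a2]
      rw [a3, Pi.sub_apply, a4, Pi.smul_apply, smul_eq_mul]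
      simp only [g]
      ring

/-- The square root `κ_σ = √(βσ - z)` of the channel energies, with positive real part. -/
def kap (β : ℝ) (z : ℂ) (σ : Fin 2) : ℂ := ((β * sgn σ : ℝ) - z) ^ (1 / 2 : ℂ)

/-- The energies at which both channels are closed. -/
def IsClosedAt (β : ℝ) (z : ℂ) : Prop := ∀ σ : Fin 2, ((β * sgn σ : ℝ) : ℂ) - z ∈ Complex.slitPlane

lemma IsClosedAt.of_im {β : ℝ} {z : ℂ} (hz : z.im ≠ 0) : IsClosedAt β z :=
  fun _ => sub_mem_slitPlane_of_im hz _

lemma IsClosedAt.of_lt {β E : ℝ} (hβ : 0 < β) (hE : E < -β) : IsClosedAt β (E : ℂ) := by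
  intro σ
  rw [← Complex.ofReal_sub, Complex.ofReal_mem_slitPlane]
  fin_cases σ <;> simp [sgn] <;> linarith

lemma IsClosedAt.kap_re {β : ℝ} {z : ℂ} (h : IsClosedAt β z) (σ : Fin 2) : 0 < (kap β z σ).re :=
  cpow_half_re_pos (h σ)

lemma kap_sq (β : ℝ) (z : ℂ) (σ : Fin 2) : kap β z σ ^ 2 = (β * sgn σ : ℝ) - z := cpow_half_sq _

/-- Vectors in the domain of the maximal operator, through free resolvent and Green function. -/
lemma isHamAction_iff_freeRes [LowDim d] {β : ℝ} {z : ℂ} (hz : IsClosedAt β z) {Ψ Ξ : State d}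
    {q f : Fin 2 → ℂ} : IsHamAction d β Ψ Ξ q f ↔
      ∀ σ, Ψ σ = freeRes d (kap β z σ) (Ξ σ - z • Ψ σ) + q σ • gLp d (kap β z σ) ∧
        f σ = pairL volume (gLp d (kap β z σ)) (Ξ σ - z • Ψ σ) + q σ * greg d (kap β z σ) := by
  have hlim : ∀ σ, Ψ σ = freeRes d (kap β z σ) (Ξ σ - z • Ψ σ) + q σ • gLp d (kap β z σ) →
      Tendsto (fun x => Ψ σ x - q σ * singularPart d x) (𝓝 0 ⊓ ae volume)
        (𝓝 (pairL volume (gLp d (kap β z σ)) (Ξ σ - z • Ψ σ) + q σ * greg d (kap β z σ))) := by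
    intro σ h
    have h1 := (tendsto_freeRes (hz.kap_re σ) (Ξ σ - z • Ψ σ)).add
      ((tendsto_gLp (hz.kap_re σ)).const_mul (q σ))
    refine h1.congr' ?_
    have h2 : ∀ᶠ x in ae volume, Ψ σ x = freeRes d (kap β z σ) (Ξ σ - z • Ψ σ) x +
        q σ * gLp d (kap β z σ) x := by
      filter_upwards [Lp.coeFn_add (freeRes d (kap β z σ) (Ξ σ - z • Ψ σ))
        (q σ • gLp d (kap β z σ)), Lp.coeFn_smul (q σ) (gLp d (kap β z σ))] with x a1 a2
      conv_lhs => rw [h]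
      rw [a1, Pi.add_apply, a2, Pi.smul_apply, smul_eq_mul]
    filter_upwards [h2.filter_mono inf_le_right] with x hx
    rw [hx]; ring
  have hfour : ∀ σ, (𝓕 (Ξ σ) : L2 d) =ᵐ[volume]
        (fun ξ => ((symb ξ : ℂ) + (β * sgn σ : ℝ)) * (𝓕 (Ψ σ) : L2 d) ξ - q σ) ↔
      Ψ σ = freeRes d (kap β z σ) (Ξ σ - z • Ψ σ) + q σ • gLp d (kap β z σ) := by
    intro σ
    have e1 : (𝓕 (Ξ σ - z • Ψ σ) : L2 d) =ᵐ[volume]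
        fun ξ => (𝓕 (Ξ σ) : L2 d) ξ - z * (𝓕 (Ψ σ) : L2 d) ξ := by
      rw [sub_eq_add_neg, ← neg_smul, FourierTransform.fourier_add, FourierTransform.fourier_smul]
      filter_upwards [Lp.coeFn_add (𝓕 (Ξ σ) : L2 d) ((-z) • 𝓕 (Ψ σ)),
        Lp.coeFn_smul (-z) (𝓕 (Ψ σ) : L2 d)] with ξ a1 a2
      rw [a1, Pi.add_apply, a2, Pi.smul_apply, smul_eq_mul]
      ring
    have e2 : (𝓕 (freeRes d (kap β z σ) (Ξ σ - z • Ψ σ) + q σ • gLp d (kap β z σ)) : L2 d)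
        =ᵐ[volume] fun ξ => ((𝓕 (Ξ σ) : L2 d) ξ - z * (𝓕 (Ψ σ) : L2 d) ξ + q σ) /
          ((symb ξ : ℂ) + kap β z σ ^ 2) := by
      rw [FourierTransform.fourier_add, FourierTransform.fourier_smul]
      filter_upwards [Lp.coeFn_add (𝓕 (freeRes d (kap β z σ) (Ξ σ - z • Ψ σ)) : L2 d)
        (q σ • 𝓕 (gLp d (kap β z σ))), Lp.coeFn_smul (q σ) (𝓕 (gLp d (kap β z σ)) : L2 d),
        fourier_gLp (d := d) (hz.kap_re σ), fourier_freeRes (hz.kap_re σ) (Ξ σ - z • Ψ σ), e1]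
        with ξ a1 a2 a3 a4 a5
      rw [a1, Pi.add_apply, a2, Pi.smul_apply, a3, a4, a5, smul_eq_mul]
      ring
    constructor
    · intro H
      refine fourier_injective (Lp.ext ?_)
      filter_upwards [H, e2] with ξ a1 a2
      rw [a2, a1, eq_div_iff (symb_add_sq_ne_zero (hz.kap_re σ) ξ), kap_sq]
      ring
    · intro H
      rw [← H] at e2
      filter_upwards [e2] with ξ a2
      rw [eq_div_iff (symb_add_sq_ne_zero (hz.kap_re σ) ξ), kap_sq] at a2
      linear_combination -a2
  rw [isHamAction_iff]
  constructor
  · rintro ⟨h1, h2⟩ σ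
    have h3 := (hfour σ).1 (h2 σ)
    exact ⟨h3, tendsto_nhds_unique (h1 σ) (hlim σ h3)⟩
  · intro H
    exact ⟨fun σ => (H σ).2 ▸ hlim σ (H σ).1, fun σ => (hfour σ).2 (H σ).1⟩

end Action

/-! ### The determinant and the boundary conditions -/

section Scalar

variable {d : ℕ}

lemma cpow_half_im (z : ℂ) (hz : z ≠ 0) :
    (z ^ (1 / 2 : ℂ)).im = Real.exp (Real.log ‖z‖ / 2) * Real.sin (z.arg / 2) := by
  have h2 : (1 / 2 : ℂ) = ((1 / 2 : ℝ) : ℂ) := by push_cast; rfl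
  rw [Complex.cpow_def_of_ne_zero hz, Complex.exp_im, h2, Complex.im_mul_ofReal,
    Complex.re_mul_ofReal, Complex.log_im, Complex.log_re]
  congr 2 <;> ring

lemma cpow_half_im_neg {z : ℂ} (hz : z.im < 0) : (z ^ (1 / 2 : ℂ)).im < 0 := by
  rw [cpow_half_im z (fun h => by rw [h] at hz; simp at hz)]
  have h1 := Complex.arg_neg_iff.2 hz
  have h2 := Complex.neg_pi_lt_arg z
  exact mul_neg_of_pos_of_neg (Real.exp_pos _)
    (Real.sin_neg_of_neg_of_neg_pi_lt (by linarith) (by linarith [Real.pi_pos]))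

lemma arg_nonpos {z : ℂ} (hz : z ∈ Complex.slitPlane) (h : z.im ≤ 0) : z.arg ≤ 0 := by
  rcases h.lt_or_eq with h | h
  · exact (Complex.arg_neg_iff.2 h).le
  · rcases Complex.mem_slitPlane_iff.1 hz with h' | h'
    · rw [Complex.arg_eq_zero_iff.2 ⟨h'.le, h⟩]
    · exact absurd h h'

lemma cpow_half_im_nonpos {z : ℂ} (hz : z ∈ Complex.slitPlane) (h : z.im ≤ 0) :
    (z ^ (1 / 2 : ℂ)).im ≤ 0 := by
  rw [cpow_half_im z (Complex.slitPlane_ne_zero hz)]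
  have h1 := arg_nonpos hz h
  have h2 := Complex.neg_pi_lt_arg z
  exact mul_nonpos_of_nonneg_of_nonpos (Real.exp_pos _).le
    (Real.sin_nonpos_of_nonpos_of_neg_pi_le (by linarith) (by linarith [Real.pi_pos]))

/-- Products of numbers in the lower half-plane are not positive. -/
lemma mul_ne_sq_of_im {a b : ℂ} {ε : ℝ} (hε : 0 < ε) (ha : a.im ≤ 0) (hb : b.im < 0) :
    a * b - (ε : ℂ) ^ 2 ≠ 0 := by
  intro h
  have h1 : a * b = ((ε ^ 2 : ℝ) : ℂ) := by push_cast; linear_combination h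
  have hre := congrArg Complex.re h1
  have him := congrArg Complex.im h1
  rw [Complex.mul_re, Complex.ofReal_re] at hre
  rw [Complex.mul_im, Complex.ofReal_im] at him
  have h2 : ε ^ 2 * b.im = -a.im * (b.re ^ 2 + b.im ^ 2) := by
    linear_combination (-b.im) * hre + b.re * him
  have h3 : ε ^ 2 * b.im < 0 := mul_neg_of_pos_of_neg (by positivity) hb
  have h4 : 0 ≤ -a.im * (b.re ^ 2 + b.im ^ 2) := mul_nonneg (by linarith) (by positivity)
  linarith

/-- The function `n(κ)` for which `α + n(κ)` vanishes at a bound state of a single point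
interaction of strength `α`. -/
def nfun (d : ℕ) (κ : ℂ) : ℂ :=
  match d with
  | 1 => 2 * κ
  | _ => -greg d κ

/-- The amplitude relating the boundary data to the charges: `2κ` in dimension one, where the
boundary condition is solved for the values `f` at the origin, and `1` otherwise. -/
def ampl (d : ℕ) (κ : ℂ) : ℂ :=
  match d with
  | 1 => 2 * κ
  | _ => 1

/-- The part of the charge matrix independent of the interaction. -/
def shift (d : ℕ) (κ : ℂ) : ℂ :=
  match d with
  | 1 => 2 * κ
  | _ => 0

lemma nfun_im_nonpos [hd : LowDim d] {κ : ℂ} (hκ : κ ∈ Complex.slitPlane) (h : κ.im ≤ 0) :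
    (nfun d κ).im ≤ 0 := by
  have hpi := Real.pi_pos
  rcases hd.cases with rfl | rfl | rfl
  · simp [nfun]; linarith
  · have h1 : nfun 2 κ = (Complex.log (κ / 2) + Real.eulerMascheroniConstant) *
        ((1 / (2 * Real.pi) : ℝ) : ℂ) := by
      simp only [nfun, greg]; push_cast; ring
    have h2 : (κ / 2).arg = κ.arg := by
      have : κ / 2 = ((1 / 2 : ℝ) : ℂ) * κ := by push_cast; ring
      rw [this, Complex.arg_real_mul _ (by norm_num)]
    rw [h1, Complex.im_mul_ofReal, Complex.add_im, Complex.log_im, Complex.ofReal_im, add_zero, h2]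
    exact mul_nonpos_of_nonpos_of_nonneg (arg_nonpos hκ h) (by positivity)
  · have h1 : nfun 3 κ = κ * ((1 / (4 * Real.pi) : ℝ) : ℂ) := by
      simp only [nfun, greg]; push_cast; ring
    rw [h1, Complex.im_mul_ofReal]
    exact mul_nonpos_of_nonpos_of_nonneg h (by positivity)

lemma nfun_im_neg [hd : LowDim d] {κ : ℂ} (h : κ.im < 0) : (nfun d κ).im < 0 := by
  have hpi := Real.pi_pos
  rcases hd.cases with rfl | rfl | rfl
  · simp [nfun]; linarith
  · have h1 : nfun 2 κ = (Complex.log (κ / 2) + Real.eulerMascheroniConstant) *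
        ((1 / (2 * Real.pi) : ℝ) : ℂ) := by
      simp only [nfun, greg]; push_cast; ring
    have h2 : (κ / 2).arg = κ.arg := by
      have : κ / 2 = ((1 / 2 : ℝ) : ℂ) * κ := by push_cast; ring
      rw [this, Complex.arg_real_mul _ (by norm_num)]
    rw [h1, Complex.im_mul_ofReal, Complex.add_im, Complex.log_im, Complex.ofReal_im, add_zero, h2]
    exact mul_neg_of_neg_of_pos (Complex.arg_neg_iff.2 h) (by positivity)
  · have h1 : nfun 3 κ = κ * ((1 / (4 * Real.pi) : ℝ) : ℂ) := by
      simp only [nfun, greg]; push_cast; ring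
    rw [h1, Complex.im_mul_ofReal]
    exact mul_neg_of_neg_of_pos h (by positivity)

lemma greg_conj [hd : LowDim d] {κ : ℂ} (hκ : κ ∈ Complex.slitPlane) :
    greg d ((starRingEnd ℂ) κ) = (starRingEnd ℂ) (greg d κ) := by
  rcases hd.cases with rfl | rfl | rfl
  · simp [greg, Complex.conj_ofNat]
  · have h0 : (starRingEnd ℂ) κ / 2 = (starRingEnd ℂ) (κ / 2) := by simp [Complex.conj_ofNat]
    have h1 : (κ / 2).arg ≠ Real.pi := by
      have : κ / 2 = ((1 / 2 : ℝ) : ℂ) * κ := by push_cast; ring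
      rw [this, Complex.arg_real_mul _ (by norm_num)]
      exact arg_ne_pi_of_mem hκ
    simp only [greg]
    rw [h0, Complex.log_conj _ h1]
    simp [Complex.conj_ofNat]
  · simp [greg, Complex.conj_ofNat]

lemma nfun_conj [hd : LowDim d] {κ : ℂ} (hκ : κ ∈ Complex.slitPlane) :
    nfun d ((starRingEnd ℂ) κ) = (starRingEnd ℂ) (nfun d κ) := by
  rcases hd.cases with rfl | rfl | rfl
  · simp [nfun, Complex.conj_ofNat]
  · simp only [nfun]; rw [greg_conj hκ, map_neg]
  · simp only [nfun]; rw [greg_conj hκ, map_neg]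

lemma ampl_conj [hd : LowDim d] (κ : ℂ) :
    ampl d ((starRingEnd ℂ) κ) = (starRingEnd ℂ) (ampl d κ) := by
  rcases hd.cases with rfl | rfl | rfl <;> simp [ampl, Complex.conj_ofNat]

lemma shift_conj [hd : LowDim d] (κ : ℂ) :
    shift d ((starRingEnd ℂ) κ) = (starRingEnd ℂ) (shift d κ) := by
  rcases hd.cases with rfl | rfl | rfl <;> simp [shift, Complex.conj_ofNat]

/-- The determinant of the boundary value problem; its zeros are eigenvalues and resonances. -/
def kdet (d : ℕ) (α ε : ℝ) (k : Fin 2 → ℂ) : ℂ :=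
  (α + nfun d (k 0)) * (α + nfun d (k 1)) - (ε : ℂ) ^ 2

/-- The adjugate of the matrix with diagonal `α + n(κ_σ)` and off-diagonal entries `ε`. -/
def kadj (d : ℕ) (α ε : ℝ) (k : Fin 2 → ℂ) : Matrix (Fin 2) (Fin 2) ℂ :=
  !![α + nfun d (k 1), -ε; -ε, α + nfun d (k 0)]

/-- The matrix expressing the charges through the values at the origin of the free resolvent. -/
def qmat (d : ℕ) (α ε : ℝ) (k : Fin 2 → ℂ) : Matrix (Fin 2) (Fin 2) ℂ := fun σ τ =>
  (kdet d α ε k)⁻¹ * (ampl d (k σ) * ampl d (k τ) * kadj d α ε k σ τ) -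
    if σ = τ then shift d (k σ) else 0

lemma qmat_symm (α ε : ℝ) (k : Fin 2 → ℂ) (σ τ : Fin 2) :
    qmat d α ε k σ τ = qmat d α ε k τ σ := by
  fin_cases σ <;> fin_cases τ <;> simp [qmat, kadj, mul_comm]

lemma kdet_conj [LowDim d] {α ε : ℝ} {k : Fin 2 → ℂ} (hk : ∀ σ, k σ ∈ Complex.slitPlane) :
    kdet d α ε (fun σ => (starRingEnd ℂ) (k σ)) = (starRingEnd ℂ) (kdet d α ε k) := by
  simp only [kdet, nfun_conj (hk _), map_sub, map_mul, map_add, map_pow, Complex.conj_ofReal]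

lemma qmat_conj [LowDim d] {α ε : ℝ} {k : Fin 2 → ℂ} (hk : ∀ σ, k σ ∈ Complex.slitPlane)
    (σ τ : Fin 2) : qmat d α ε (fun σ => (starRingEnd ℂ) (k σ)) σ τ =
      (starRingEnd ℂ) (qmat d α ε k σ τ) := by
  have h1 : kadj d α ε (fun σ => (starRingEnd ℂ) (k σ)) σ τ =
      (starRingEnd ℂ) (kadj d α ε k σ τ) := by
    fin_cases σ <;> fin_cases τ <;> simp [kadj, nfun_conj (hk _)]
  simp only [qmat, kdet_conj hk, ampl_conj, shift_conj, h1, map_sub, map_mul, map_inv₀]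
  split_ifs <;> simp

lemma two_by_two {a b c x y u v D : ℂ} (hD : D ≠ 0) (h : a * b - c ^ 2 = D) :
    (a * x + c * y = u ∧ b * y + c * x = v) ↔
      (x = D⁻¹ * (b * u - c * v) ∧ y = D⁻¹ * (a * v - c * u)) := by
  constructor
  · rintro ⟨h1, h2⟩
    constructor
    · rw [eq_inv_mul_iff_mul_eq₀ hD, ← h]; linear_combination b * h1 - c * h2
    · rw [eq_inv_mul_iff_mul_eq₀ hD, ← h]; linear_combination a * h2 - c * h1
  · rintro ⟨rfl, rfl⟩
    constructor <;> field_simp <;> rw [← h] <;> ring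

/-- The solution of the boundary conditions. -/
lemma boundaryCondition_iff [hd : LowDim d] {α ε : ℝ} {k : Fin 2 → ℂ} (hk : ∀ σ, k σ ≠ 0)
    (hD : kdet d α ε k ≠ 0) {q v : Fin 2 → ℂ} :
    BoundaryCondition d α ε q (fun σ => v σ + q σ * greg d (k σ)) ↔
      ∀ σ, q σ = ∑ τ, qmat d α ε k σ τ * v τ := by
  have h0 := hk 0
  have h1 := hk 1
  have hiff : ∀ d', LowDim d' → d' ≠ 1 → kdet d' α ε k ≠ 0 → (BoundaryCondition d' α ε q
      (fun σ => v σ + q σ * greg d' (k σ)) ↔ ∀ σ, q σ = ∑ τ, qmat d' α ε k σ τ * v τ) := by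
    intro d' hd' hd1 hD
    have hn : ∀ κ, nfun d' κ = -greg d' κ := by
      rcases hd'.cases with rfl | rfl | rfl
      · exact absurd rfl hd1
      · intro κ; rfl
      · intro κ; rfl
    have ha : ∀ κ, ampl d' κ = 1 := by
      rcases hd'.cases with rfl | rfl | rfl
      · exact absurd rfl hd1
      · intro κ; rfl
      · intro κ; rfl
    have hs : ∀ κ, shift d' κ = 0 := by
      rcases hd'.cases with rfl | rfl | rfl
      · exact absurd rfl hd1
      · intro κ; rfl
      · intro κ; rfl
    have hb : BoundaryCondition d' α ε q (fun σ => v σ + q σ * greg d' (k σ)) ↔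
        ((α + nfun d' (k 0)) * q 0 + ε * q 1 = v 0 ∧
          (α + nfun d' (k 1)) * q 1 + ε * q 0 = v 1) := by
      have : BoundaryCondition d' α ε q (fun σ => v σ + q σ * greg d' (k σ)) ↔
        (α * q 0 + ε * q 1 = v 0 + q 0 * greg d' (k 0) ∧
          α * q 1 + ε * q 0 = v 1 + q 1 * greg d' (k 1)) := by
        rcases hd'.cases with rfl | rfl | rfl
        · exact absurd rfl hd1
        · rfl
        · rfl
      rw [this, hn, hn]
      constructor <;> rintro ⟨e1, e2⟩ <;>
        exact ⟨by linear_combination e1, by linear_combination e2⟩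
    rw [hb, two_by_two hD rfl, Fin.forall_fin_two]
    simp only [Fin.sum_univ_two, qmat, ha, hs, kadj, kdet]
    simp only [Matrix.of_apply, Matrix.cons_val_zero, Matrix.cons_val_one, Matrix.cons_val',
      Matrix.cons_val_fin_one, ite_self, sub_zero]
    refine and_congr (Eq.congr_right ?_) (Eq.congr_right ?_) <;> ring
  by_cases hd1 : d = 1
  · subst hd1
    have hb : BoundaryCondition 1 α ε q (fun σ => v σ + q σ * greg 1 (k σ)) ↔
        ((α + nfun 1 (k 0)) * (q 0 / (2 * k 0)) + ε * (q 1 / (2 * k 1)) = -α * v 0 - ε * v 1 ∧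
          (α + nfun 1 (k 1)) * (q 1 / (2 * k 1)) + ε * (q 0 / (2 * k 0)) =
            -α * v 1 - ε * v 0) := by
      simp only [BoundaryCondition, nfun, greg]
      have e0 : q 0 = 2 * k 0 * (q 0 / (2 * k 0)) := by field_simp
      have e1 : q 1 = 2 * k 1 * (q 1 / (2 * k 1)) := by field_simp
      constructor <;> rintro ⟨a1, a2⟩
      · exact ⟨by linear_combination a1 - e0, by linear_combination a2 - e1⟩
      · exact ⟨by linear_combination a1 + e0, by linear_combination a2 + e1⟩
    rw [hb, two_by_two hD rfl, Fin.forall_fin_two]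
    simp only [Fin.sum_univ_two, qmat, ampl, shift, kadj]
    simp only [Matrix.of_apply, Matrix.cons_val_zero, Matrix.cons_val_one, Matrix.cons_val',
      Matrix.cons_val_fin_one, if_true, Fin.reduceEq, if_false, sub_zero]
    have hd0 : (2 * k 0) ≠ 0 := mul_ne_zero two_ne_zero h0
    have hd1 : (2 * k 1) ≠ 0 := mul_ne_zero two_ne_zero h1
    have hinv : kdet 1 α ε k * (kdet 1 α ε k)⁻¹ = 1 := mul_inv_cancel₀ hD
    simp only [kdet, nfun] at hinv ⊢
    rw [div_eq_iff hd0, div_eq_iff hd1]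
    refine and_congr (Eq.congr_right ?_) (Eq.congr_right ?_)
    · linear_combination (-(2 * k 0) * v 0) * hinv
    · linear_combination (-(2 * k 1) * v 1) * hinv
  · exact hiff d hd hd1 hD

lemma kap_conj {β : ℝ} {z : ℂ} (hz : IsClosedAt β z) :
    kap β ((starRingEnd ℂ) z) = fun σ => (starRingEnd ℂ) (kap β z σ) := by
  ext σ
  have h1 := Complex.conj_cpow _ (1 / 2 : ℂ) (arg_ne_pi_of_mem (hz σ))
  simp only [map_sub, Complex.conj_ofReal, map_div₀, map_one, Complex.conj_ofNat] at h1
  rw [kap, kap, h1]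

lemma kap_mem {β : ℝ} {z : ℂ} (hz : IsClosedAt β z) (σ : Fin 2) : kap β z σ ∈ Complex.slitPlane :=
  re_pos_mem_slitPlane (hz.kap_re σ)

lemma kdet_ne_zero_of_im_pos [LowDim d] {β α ε : ℝ} (hε : 0 < ε) {z : ℂ} (hz : 0 < z.im) :
    kdet d α ε (kap β z) ≠ 0 := by
  have h : ∀ σ, (α + nfun d (kap β z σ)).im < 0 := by
    intro σ
    have h1 : (kap β z σ).im < 0 := cpow_half_im_neg (by simpa using hz)
    simpa using nfun_im_neg (d := d) h1
  exact mul_ne_sq_of_im hε (h 0).le (h 1)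

lemma kdet_ne_zero_of_im [LowDim d] {β α ε : ℝ} (hε : 0 < ε) {z : ℂ} (hz : z.im ≠ 0) :
    kdet d α ε (kap β z) ≠ 0 := by
  rcases lt_or_gt_of_ne hz with h | h
  · have h1 := kdet_ne_zero_of_im_pos (d := d) (β := β) (α := α) hε (z := (starRingEnd ℂ) z)
      (by simpa using h)
    have hc := IsClosedAt.of_im (β := β) hz
    rw [kap_conj hc, kdet_conj (kap_mem hc)] at h1
    simpa using h1
  · exact kdet_ne_zero_of_im_pos hε h

end Scalar

/-! ### Krein's formula -/

section Krein

open FourierTransform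

variable {d : ℕ}

/-- The projection to a channel. -/
def chanOut (d : ℕ) (σ : Fin 2) : State d →L[ℂ] L2 d := PiLp.proj 2 (fun _ : Fin 2 => L2 d) σ

/-- The inclusion of a channel. -/
def chanIn (d : ℕ) (σ : Fin 2) : L2 d →L[ℂ] State d :=
  ((PiLp.continuousLinearEquiv 2 ℂ (fun _ : Fin 2 => L2 d)).symm :
    (Fin 2 → L2 d) →L[ℂ] State d) ∘L ContinuousLinearMap.single ℂ (fun _ : Fin 2 => L2 d) σ

lemma chanOut_apply (σ : Fin 2) (Ψ : State d) : chanOut d σ Ψ = Ψ σ := rfl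

lemma chanIn_apply (σ τ : Fin 2) (u : L2 d) : chanIn d σ u τ = if τ = σ then u else 0 := by
  have : chanIn d σ u τ = Pi.single (M := fun _ : Fin 2 => L2 d) σ u τ := rfl
  rw [this, Pi.single_apply]

/-- The operator with diagonal part `B` and finite rank part `∑ Q_{στ} g_σ ⟨ḡ_τ, ·⟩`. -/
def blockOp (B : Fin 2 → L2 d →L[ℂ] L2 d) (g : Fin 2 → L2 d) (Q : Matrix (Fin 2) (Fin 2) ℂ) :
    State d →L[ℂ] State d :=
  ∑ σ, chanIn d σ ∘L B σ ∘L chanOut d σ +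
    ∑ σ, ∑ τ, Q σ τ • ((pairL volume (g τ) ∘L chanOut d τ).smulRight (chanIn d σ (g σ)))

lemma blockOp_apply (B : Fin 2 → L2 d →L[ℂ] L2 d) (g : Fin 2 → L2 d)
    (Q : Matrix (Fin 2) (Fin 2) ℂ) (Ψ : State d) (σ : Fin 2) :
    blockOp B g Q Ψ σ = B σ (Ψ σ) + (∑ τ, Q σ τ * pairL volume (g τ) (Ψ τ)) • g σ := by
  fin_cases σ <;>
  simp [blockOp, Fin.sum_univ_two, chanIn_apply, chanOut_apply, add_smul, mul_smul]

/-- Krein's formula for the resolvent. -/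
def kreinOp (d : ℕ) (β α ε : ℝ) (z : ℂ) : State d →L[ℂ] State d :=
  blockOp (fun σ => freeRes d (kap β z σ)) (fun σ => gLp d (kap β z σ)) (qmat d α ε (kap β z))

lemma isHamAction_zero_left [LowDim d] {β : ℝ} {Ξ : State d} {q f : Fin 2 → ℂ}
    (h : IsHamAction d β 0 Ξ q f) : Ξ = 0 ∧ q = 0 := by
  have h1 := (isHamAction_iff.1 h).2
  have h2 : ∀ σ, (𝓕 (Ξ σ) : L2 d) =ᵐ[volume] fun _ => -q σ := by
    intro σ
    have h0 : (𝓕 ((0 : State d) σ) : L2 d) = 0 := (Lp.fourierTransformₗᵢ _ ℂ).map_zero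
    have h3 := h1 σ
    rw [h0] at h3
    filter_upwards [h3, Lp.coeFn_zero ℂ 2 (volume : Measure (EuclideanSpace ℝ (Fin d)))]
      with ξ a1 a2
    rw [a1, a2]
    simp
  have hq : ∀ σ, q σ = 0 := by
    intro σ
    have h3 : MemLp (fun _ : EuclideanSpace ℝ (Fin d) => -q σ) 2 volume :=
      (memLp_congr_ae (h2 σ)).1 (Lp.memLp _)
    rw [memLp_const_iff (by norm_num) (by norm_num)] at h3
    have h4 : (volume : Measure (EuclideanSpace ℝ (Fin d))) Set.univ = ⊤ :=
      measure_univ_of_isAddLeftInvariant _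
    rw [h4] at h3
    simpa using h3
  refine ⟨?_, funext hq⟩
  ext σ : 1
  refine fourier_injective (Lp.ext ?_)
  have h0 : (𝓕 ((0 : State d) σ) : L2 d) = 0 := (Lp.fourierTransformₗᵢ _ ℂ).map_zero
  rw [h0]
  filter_upwards [h2 σ, Lp.coeFn_zero ℂ 2 (volume : Measure (EuclideanSpace ℝ (Fin d)))]
    with ξ a1 a2
  rw [a1, a2, hq σ]
  simp

lemma mem_hamiltonian_graph [LowDim d] {β α ε : ℝ} {Ψ Ξ : State d} :
    (Ψ, Ξ) ∈ (hamiltonian d β α ε).graph ↔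
      ∃ q f : Fin 2 → ℂ, BoundaryCondition d α ε q f ∧ IsHamAction d β Ψ Ξ q f := by
  rw [hamiltonian, Submodule.toLinearPMap_graph_eq]
  · rfl
  · rintro ⟨x, y⟩ ⟨q, f, _, h⟩ hx
    simp only at hx h ⊢
    rw [hx] at h
    exact (isHamAction_zero_left h).1

/-- Krein's formula: the resolvent of the Hamiltonian. -/
lemma isResolventAt_kreinOp [LowDim d] {β α ε : ℝ} {z : ℂ} (hz : IsClosedAt β z)
    (hD : kdet d α ε (kap β z) ≠ 0) :
    IsResolventAt (hamiltonian d β α ε) z (kreinOp d β α ε z) := by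
  have hk : ∀ σ, kap β z σ ≠ 0 := fun σ => Complex.slitPlane_ne_zero (kap_mem hz σ)
  rw [isResolventAt_iff_graph]
  constructor
  · intro ψ
    let v : Fin 2 → ℂ := fun σ => pairL volume (gLp d (kap β z σ)) (ψ σ)
    let q : Fin 2 → ℂ := fun σ => ∑ τ, qmat d α ε (kap β z) σ τ * v τ
    refine mem_hamiltonian_graph.2 ⟨q, fun σ => v σ + q σ * greg d (kap β z σ),
      (boundaryCondition_iff hk hD).2 fun σ => rfl, (isHamAction_iff_freeRes hz).2 fun σ => ?_⟩
    have h1 : (ψ + z • kreinOp d β α ε z ψ) σ - z • (kreinOp d β α ε z ψ) σ = ψ σ := by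
      rw [PiLp.add_apply, PiLp.smul_apply, add_sub_cancel_right]
    rw [h1]
    exact ⟨blockOp_apply _ _ _ _ _, rfl⟩
  · intro x y hxy
    obtain ⟨q, f, hb, ha⟩ := mem_hamiltonian_graph.1 hxy
    have ha' := (isHamAction_iff_freeRes hz).1 ha
    have hf : f = fun σ => pairL volume (gLp d (kap β z σ)) (y σ - z • x σ) +
        q σ * greg d (kap β z σ) := funext fun σ => (ha' σ).2
    rw [hf, boundaryCondition_iff hk hD] at hb
    ext σ : 1
    rw [kreinOp, blockOp_apply, (ha' σ).1, hb σ]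
    rfl

lemma inner_freeRes [LowDim d] {κ : ℂ} (hκ : 0 < κ.re) (u v : L2 d) :
    inner ℂ (freeRes d ((starRingEnd ℂ) κ) u) v = inner ℂ u (freeRes d κ v) := by
  have hκ' : 0 < ((starRingEnd ℂ) κ).re := by simpa using hκ
  rw [← Lp.inner_fourier_eq, ← Lp.inner_fourier_eq u, L2.inner_def, L2.inner_def]
  refine integral_congr_ae ?_
  filter_upwards [fourier_freeRes hκ' u, fourier_freeRes hκ v] with ξ h1 h2
  rw [h1, h2, RCLike.inner_apply, RCLike.inner_apply]
  simp only [map_div₀, map_mul, map_one, map_add, map_pow, Complex.conj_ofReal, Complex.conj_conj]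
  ring

lemma inner_kreinOp [LowDim d] {β α ε : ℝ} {z : ℂ} (hz : IsClosedAt β z) (Φ Ψ : State d) :
    inner ℂ (kreinOp d β α ε ((starRingEnd ℂ) z) Φ) Ψ = inner ℂ Φ (kreinOp d β α ε z Ψ) := by
  have hpair : ∀ σ (v : L2 d), pairL volume (gLp d (kap β z σ)) v =
      inner ℂ (gLp d ((starRingEnd ℂ) (kap β z σ))) v := fun σ v =>
    pairL_eq_inner (gLp_conj (hz.kap_re σ)) v
  have hpair' : ∀ σ (v : L2 d), pairL volume (gLp d ((starRingEnd ℂ) (kap β z σ))) v =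
      inner ℂ (gLp d (kap β z σ)) v := by
    intro σ v
    have h := pairL_eq_inner (gLp_conj (d := d) (κ := (starRingEnd ℂ) (kap β z σ))
      (by simpa using hz.kap_re σ)) v
    rwa [Complex.conj_conj] at h
  simp only [PiLp.inner_apply, kreinOp, blockOp_apply, kap_conj hz]
  simp only [inner_add_left, inner_add_right, inner_smul_left, inner_smul_right,
    inner_freeRes (hz.kap_re _), Finset.sum_add_distrib]
  congr 1
  simp only [Fin.sum_univ_two, qmat_conj (kap_mem hz), hpair, hpair', map_add, map_mul,
    Complex.conj_conj, inner_conj_symm]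
  have h1 := qmat_symm (d := d) α ε (kap β z) 0 1
  rw [h1]
  ring

lemma isSelfAdjoint_hamiltonian [LowDim d] (β α : ℝ) {ε : ℝ} (hε : 0 < ε) :
    IsSelfAdjoint (hamiltonian d β α ε) := by
  have hI : Complex.I.im ≠ 0 := by simp
  have hI' : ((starRingEnd ℂ) Complex.I).im ≠ 0 := by simp
  exact isSelfAdjoint_of_resolvent
    (isResolventAt_kreinOp (.of_im hI) (kdet_ne_zero_of_im hε hI))
    (isResolventAt_kreinOp (.of_im hI') (kdet_ne_zero_of_im hε hI'))
    fun Φ Ψ => inner_kreinOp (.of_im hI) Φ Ψ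

end Krein

/-! ### Eigenvalues -/

section Eigenvalues

open FourierTransform

variable {d : ℕ}

lemma LowDim.le_three [hd : LowDim d] : d ≤ 3 := by rcases hd.cases with h | h | h <;> omega

lemma ae_symb_ne [LowDim d] (s : ℝ) : ∀ᵐ ξ : EuclideanSpace ℝ (Fin d), symb ξ ≠ s := by
  rw [ae_iff]
  refine measure_mono_null (t := Metric.sphere 0 (√s / (2 * Real.pi))) (fun ξ hξ => ?_)
    (Measure.addHaar_sphere volume _ _)
  simp only [ne_eq, not_not, Set.mem_ofPred_eq] at hξ
  rw [mem_sphere_zero_iff_norm, ← hξ, symb, ← mul_pow,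
    Real.sqrt_sq (mul_nonneg (by positivity) (norm_nonneg ξ))]
  have := Real.pi_pos
  field_simp

/-- The function `1 / (p - s)` is not square integrable for `s ≥ 0`: there is no square integrable
Green function at energies in the spectrum of the free Laplacian. -/
lemma charge_eq_zero [LowDim d] {u : L2 d} {s : ℝ} (hs : 0 ≤ s) {q : ℂ}
    (h : ∀ᵐ ξ, ((symb ξ : ℂ) - s) * u ξ = q) : q = 0 := by
  by_contra hq
  have hpi := Real.pi_pos
  have hu : Integrable (fun ξ => ‖u ξ‖ ^ 2) :=
    (memLp_two_iff_integrable_sq_norm (Lp.aestronglyMeasurable u)).1 (Lp.memLp u)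
  have h1 : Integrable (fun ξ : EuclideanSpace ℝ (Fin d) => (1 / (symb ξ - s)) ^ 2) := by
    refine (hu.const_mul (1 / ‖q‖ ^ 2)).mono' ?_ ?_
    · have : Measurable fun ξ : EuclideanSpace ℝ (Fin d) => (1 / (symb ξ - s)) ^ 2 := by
        unfold symb; fun_prop
      exact this.aestronglyMeasurable
    · filter_upwards [h] with ξ hξ
      have hnq : 0 < ‖q‖ := norm_pos_iff.2 hq
      rw [Real.norm_of_nonneg (sq_nonneg _)]
      by_cases h0 : symb ξ - s = 0
      · rw [h0, div_zero, zero_pow two_ne_zero]; positivity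
      · have h2 : ‖q‖ = |symb ξ - s| * ‖u ξ‖ := by
          rw [← hξ, norm_mul, ← Complex.ofReal_sub, Complex.norm_real, Real.norm_eq_abs]
        have h3 : ‖u ξ‖ ≠ 0 := by
          intro h4; rw [h4, mul_zero] at h2; exact hnq.ne' h2
        rw [h2, mul_pow, sq_abs]
        refine le_of_eq ?_
        field_simp
  set ρ := √s / (2 * Real.pi) with hρ
  have hρ0 : 0 ≤ ρ := by positivity
  have hsρ : s = (2 * Real.pi) ^ 2 * ρ ^ 2 := by
    rw [hρ, div_pow, Real.sq_sqrt hs]; field_simp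
  -- in polar coordinates the integrand is bounded below by a multiple of `(y - ρ)⁻²` near the sphere
  -- of radius `ρ`; for `s = 0` this needs `d ≤ 3`, to bound `y ^ (d - 1) / y ^ 4` below by `y ^ (-2)`
  have h2 := (integrable_fun_norm_addHaar (volume : Measure (EuclideanSpace ℝ (Fin d)))
    (f := fun y : ℝ => (1 / ((2 * Real.pi) ^ 2 * y ^ 2 - s)) ^ 2)).1 h1
  rw [finrank_euclideanSpace_fin] at h2
  have h3 : IntegrableOn (fun y : ℝ => y ^ (d - 1) • (1 / ((2 * Real.pi) ^ 2 * y ^ 2 - s)) ^ 2)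
      (Set.Ioc ρ (ρ + 1)) := h2.mono_set fun y hy => hρ0.trans_lt hy.1
  have h4 : IntegrableOn (fun y : ℝ => (y - ρ)⁻¹) (Set.Ioc ρ (ρ + 1)) := by
    refine (h3.const_mul ((2 * Real.pi) ^ 4 * 4 * (1 + ρ) ^ 2)).mono' ?_ ?_
    · exact (by fun_prop : Measurable fun y : ℝ => (y - ρ)⁻¹).aestronglyMeasurable
    · filter_upwards [self_mem_ae_restrict measurableSet_Ioc] with y hy
      obtain ⟨hy1, hy2⟩ := hy
      have hy0 : 0 < y := hρ0.trans_lt hy1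
      have hyρ : 0 < y - ρ := by linarith
      rw [Real.norm_of_nonneg (inv_nonneg.2 hyρ.le), smul_eq_mul]
      have e1 : (2 * Real.pi) ^ 2 * y ^ 2 - s = (2 * Real.pi) ^ 2 * ((y - ρ) * (y + ρ)) := by
        rw [hsρ]; ring
      have e2 : (y + ρ) ^ 2 ≤ 4 * y ^ 2 := by nlinarith
      have e3 : y ^ 2 ≤ (1 + ρ) ^ 2 * y ^ (d - 1) := by
        have hd3 := LowDim.le_three (d := d)
        have h5 : y ^ 2 = y ^ (3 - d) * y ^ (d - 1) := by
          rw [← pow_add]; congr 1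
          have := LowDim.one_le (d := d)
          omega
        rw [h5]
        refine mul_le_mul_of_nonneg_right ?_ (by positivity)
        calc y ^ (3 - d) ≤ (1 + ρ) ^ (3 - d) := by gcongr; linarith
          _ ≤ (1 + ρ) ^ 2 := pow_le_pow_right₀ (by linarith)
            (by have := LowDim.one_le (d := d); omega)
      rw [e1]
      have e4 : (2 * Real.pi) ^ 4 * 4 * (1 + ρ) ^ 2 *
          (y ^ (d - 1) * (1 / ((2 * Real.pi) ^ 2 * ((y - ρ) * (y + ρ)))) ^ 2) =
          (4 * ((1 + ρ) ^ 2 * y ^ (d - 1)) / (y + ρ) ^ 2) * ((y - ρ)⁻¹ * (y - ρ)⁻¹) := by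
        have : y + ρ ≠ 0 := by positivity
        have := hyρ.ne'
        field_simp
      rw [e4]
      have e5 : 1 ≤ 4 * ((1 + ρ) ^ 2 * y ^ (d - 1)) / (y + ρ) ^ 2 := by
        rw [le_div_iff₀ (by positivity)]; linarith
      have e6 : 1 ≤ (y - ρ)⁻¹ := (one_le_inv₀ hyρ).2 (by linarith)
      have e7 := inv_pos.2 hyρ
      calc (y - ρ)⁻¹ ≤ (y - ρ)⁻¹ * (y - ρ)⁻¹ := le_mul_of_one_le_left e7.le e6
        _ ≤ _ := le_mul_of_one_le_left (by positivity) e5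
  have h5 : IntervalIntegrable (fun y : ℝ => (y - ρ)⁻¹) volume ρ (ρ + 1) :=
    (intervalIntegrable_iff_integrableOn_Ioc_of_le (by linarith)).2 h4
  rw [intervalIntegrable_sub_inv_iff] at h5
  rcases h5 with h5 | h5
  · linarith
  · exact h5 Set.left_mem_uIcc

lemma eq_zero_of_symb_mul [LowDim d] {u : L2 d} {s : ℝ}
    (h : ∀ᵐ ξ, ((symb ξ : ℂ) - s) * (𝓕 u : L2 d) ξ = 0) : u = 0 := by
  refine fourier_injective (Lp.ext ?_)
  have h0 : (𝓕 (0 : L2 d) : L2 d) = 0 := (Lp.fourierTransformₗᵢ _ ℂ).map_zero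
  rw [h0]
  filter_upwards [h, ae_symb_ne s, Lp.coeFn_zero ℂ 2 (volume : Measure (EuclideanSpace ℝ (Fin d)))]
    with ξ h1 h2 h3
  rw [h3, Pi.zero_apply]
  refine (mul_eq_zero.1 h1).resolve_left ?_
  rw [← Complex.ofReal_sub]
  exact Complex.ofReal_ne_zero.2 (sub_ne_zero.2 h2)

/-- There are no eigenvalues embedded in the essential spectrum. -/
lemma notMem_pointSpectrum_of_le [hd : LowDim d] {β α ε t : ℝ} (hε : 0 < ε) (ht : -β ≤ t) :
    (t : ℂ) ∉ pointSpectrum (hamiltonian d β α ε) := by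
  rw [mem_pointSpectrum_iff]
  rintro ⟨u, hu0, hu⟩
  obtain ⟨q, f, hb, ha⟩ := mem_hamiltonian_graph.1 hu
  obtain ⟨h1, h2⟩ := isHamAction_iff.1 ha
  have key : ∀ σ, ∀ᵐ ξ, ((symb ξ : ℂ) - ((t - β * sgn σ : ℝ) : ℂ)) * (𝓕 (u σ) : L2 d) ξ = q σ := by
    intro σ
    have e : (𝓕 (((t : ℂ) • u) σ) : L2 d) = (t : ℂ) • 𝓕 (u σ) := by
      rw [PiLp.smul_apply, FourierTransform.fourier_smul]
    have h3 := h2 σ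
    rw [e] at h3
    filter_upwards [h3, Lp.coeFn_smul (t : ℂ) (𝓕 (u σ) : L2 d)] with ξ a1 a2
    rw [a2, Pi.smul_apply, smul_eq_mul] at a1
    push_cast at a1 ⊢
    linear_combination -a1
  -- at energies `≥ -β` the lower channel carries no charge and is empty
  have hq1 : q 1 = 0 := charge_eq_zero (by simp [sgn]; linarith) (key 1)
  have hu1 : u 1 = 0 := eq_zero_of_symb_mul (s := t - β * sgn 1) (by simpa [hq1] using key 1)
  have hf1 : f 1 = 0 := by
    refine tendsto_nhds_unique (h1 1) ?_
    refine (tendsto_const_nhds (x := (0 : ℂ))).congr' ?_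
    refine Eventually.filter_mono inf_le_right ?_
    rw [hu1, hq1]
    filter_upwards [Lp.coeFn_zero ℂ 2 (volume : Measure (EuclideanSpace ℝ (Fin d)))] with x hx
    simp
  have hε' : (ε : ℂ) ≠ 0 := Complex.ofReal_ne_zero.2 hε.ne'
  -- the lower component of the boundary condition leaves `ε f₊ = 0` or `ε q₊ = 0`
  have hq0 : q 0 = 0 := by
    rcases hd.cases with rfl | rfl | rfl
    · obtain ⟨b1, b2⟩ := hb
      have hf0 : f 0 = 0 := by
        rw [hq1, hf1] at b2
        have : (ε : ℂ) * f 0 = 0 := by linear_combination b2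
        exact (mul_eq_zero.1 this).resolve_left hε'
      rw [b1, hf0, hf1]; ring
    · obtain ⟨b1, b2⟩ := hb
      rw [hq1, hf1] at b2
      have : (ε : ℂ) * q 0 = 0 := by linear_combination b2
      exact (mul_eq_zero.1 this).resolve_left hε'
    · obtain ⟨b1, b2⟩ := hb
      rw [hq1, hf1] at b2
      have : (ε : ℂ) * q 0 = 0 := by linear_combination b2
      exact (mul_eq_zero.1 this).resolve_left hε'
  have hu00 : u 0 = 0 := eq_zero_of_symb_mul (s := t - β * sgn 0) (by simpa [hq0] using key 0)
  refine hu0 ?_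
  ext σ : 1
  fin_cases σ
  · exact hu00
  · exact hu1

/-- Eigenvectors below the essential spectrum are combinations of Green functions. -/
lemma eigenvector_eq [LowDim d] {β α ε E : ℝ} (hβ : 0 < β) (hE : E < -β) {u : State d}
    (hu : (u, (E : ℂ) • u) ∈ (hamiltonian d β α ε).graph) :
    ∃ q : Fin 2 → ℂ, ∀ σ, u σ = q σ • gLp d (kap β E σ) := by
  obtain ⟨q, f, hb, ha⟩ := mem_hamiltonian_graph.1 hu
  refine ⟨q, fun σ => ?_⟩
  have h := ((isHamAction_iff_freeRes (.of_lt hβ hE)).1 ha σ).1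
  rwa [PiLp.smul_apply, sub_self, map_zero, zero_add] at h

lemma finiteDimensional_eigenKer [LowDim d] {β α ε E : ℝ} (hβ : 0 < β) (hE : E < -β) :
    FiniteDimensional ℂ (eigenKer (hamiltonian d β α ε) E) := by
  let W : Submodule ℂ (State d) :=
    Submodule.span ℂ (Set.range fun σ => chanIn d σ (gLp d (kap β E σ)))
  have hW : FiniteDimensional ℂ W := FiniteDimensional.span_of_finite ℂ (Set.finite_range _)
  have hmem : ∀ u : eigenKer (hamiltonian d β α ε) E,
      ((u : (hamiltonian d β α ε).domain) : State d) ∈ W := by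
    intro u
    have hg := (hamiltonian d β α ε).mem_graph (u : (hamiltonian d β α ε).domain)
    rw [mem_eigenKer_iff.1 u.2] at hg
    obtain ⟨q, hq⟩ := eigenvector_eq hβ hE hg
    have : ((u : (hamiltonian d β α ε).domain) : State d) =
        ∑ σ, q σ • chanIn d σ (gLp d (kap β E σ)) := by
      ext τ : 1
      rw [hq τ]
      fin_cases τ <;> simp [Fin.sum_univ_two, chanIn_apply]
    rw [this]
    exact Submodule.sum_mem _ fun σ _ =>
      Submodule.smul_mem _ _ (Submodule.subset_span (Set.mem_range_self σ))
  let F : eigenKer (hamiltonian d β α ε) E →ₗ[ℂ] W :=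
    LinearMap.codRestrict W ((hamiltonian d β α ε).domain.subtype ∘ₗ
      (eigenKer (hamiltonian d β α ε) E).subtype) hmem
  refine FiniteDimensional.of_injective F fun u v huv => ?_
  have := congrArg Subtype.val huv
  exact Subtype.ext (Subtype.ext this)

/-- Zeros of the determinant below the essential spectrum are eigenvalues. -/
lemma mem_pointSpectrum_of_kdet [hd : LowDim d] {β α ε E : ℝ} (hβ : 0 < β) (hε : 0 < ε)
    (hE : E < -β) (h : kdet d α ε (kap β E) = 0) :
    (E : ℂ) ∈ pointSpectrum (hamiltonian d β α ε) := by
  have hz := IsClosedAt.of_lt hβ hE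
  have hk : ∀ σ, kap β E σ ≠ 0 := fun σ => Complex.slitPlane_ne_zero (kap_mem hz σ)
  let q : Fin 2 → ℂ := ![ampl d (kap β E 0) * (α + nfun d (kap β E 1)), -(ampl d (kap β E 1) * ε)]
  have hε' : (ε : ℂ) ≠ 0 := Complex.ofReal_ne_zero.2 hε.ne'
  have hq : q 1 ≠ 0 := by
    have : ampl d (kap β E 1) ≠ 0 := by
      rcases hd.cases with rfl | rfl | rfl
      · exact mul_ne_zero two_ne_zero (hk 1)
      · exact one_ne_zero
      · exact one_ne_zero
    exact neg_ne_zero.2 (mul_ne_zero this hε')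
  have hbc : BoundaryCondition d α ε q (fun σ => q σ * greg d (kap β E σ)) := by
    unfold kdet at h
    rcases hd.cases with rfl | rfl | rfl
    · have e0 : q 0 * greg 1 (kap β E 0) = α + nfun 1 (kap β E 1) := by
        simp only [q, greg, ampl, Matrix.cons_val_zero]
        have := hk 0
        field_simp
      have e1 : q 1 * greg 1 (kap β E 1) = -ε := by
        simp only [q, greg, ampl, Matrix.cons_val_one, Matrix.cons_val_fin_one]
        have := hk 1
        field_simp
      simp only [BoundaryCondition, e0, e1]
      simp only [q, ampl, Matrix.cons_val_zero, Matrix.cons_val_one, Matrix.cons_val_fin_one]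
      constructor
      · simp only [nfun] at h ⊢; linear_combination h
      · simp only [nfun]; ring
    · simp only [BoundaryCondition, q, ampl, Matrix.cons_val_zero, Matrix.cons_val_one,
        Matrix.cons_val_fin_one, nfun] at h ⊢
      exact ⟨by linear_combination h, by ring⟩
    · simp only [BoundaryCondition, q, ampl, Matrix.cons_val_zero, Matrix.cons_val_one,
        Matrix.cons_val_fin_one, nfun] at h ⊢
      exact ⟨by linear_combination h, by ring⟩
  let u : State d := WithLp.toLp 2 fun σ => q σ • gLp d (kap β E σ)
  have hact : IsHamAction d β u ((E : ℂ) • u) q (fun σ => q σ * greg d (kap β E σ)) := by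
    refine (isHamAction_iff_freeRes hz).2 fun σ => ?_
    rw [PiLp.smul_apply, sub_self, map_zero, map_zero, zero_add, zero_add]
    exact ⟨rfl, rfl⟩
  refine mem_pointSpectrum_iff.2 ⟨u, fun hu => ?_, mem_hamiltonian_graph.2 ⟨q, _, hbc, hact⟩⟩
  rw [hu] at hact
  exact hq (congrFun (isHamAction_zero_left hact).2 1)

end Eigenvalues

/-! ### Weyl vectors -/

section WeylVectors

open FourierTransform

variable {d : ℕ}

/-- The state in the lower channel with Fourier transform `w`; used for odd `w`, when the state
vanishes at the origin. -/
def oddState (w : L2 d) : State d := chanIn d 1 ((Lp.fourierTransformₗᵢ _ ℂ).symm w)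

lemma fourier_oddState (w : L2 d) : (𝓕 (oddState w 1) : L2 d) = w := by
  rw [oddState, chanIn_apply, if_pos rfl]
  exact (Lp.fourierTransformₗᵢ _ ℂ).apply_symm_apply w

lemma oddState_zero (w : L2 d) : oddState w 0 = 0 := by
  rw [oddState, chanIn_apply, if_neg (by decide)]

lemma norm_oddState (w : L2 d) : ‖oddState w‖ = ‖w‖ := by
  rw [PiLp.norm_eq_of_L2, Fin.sum_univ_two, oddState_zero, norm_zero,
    ← Lp.norm_fourier_eq (oddState w 1), fourier_oddState, zero_pow two_ne_zero, zero_add,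
    Real.sqrt_sq (norm_nonneg w)]

lemma oddState_sub_smul (w w' : L2 d) (c : ℂ) :
    oddState w' - c • oddState w = oddState (w' - c • w) := by
  simp only [oddState, map_sub, map_smul]

lemma integral_eq_zero_of_odd {w : EuclideanSpace ℝ (Fin d) → ℂ} (h : ∀ᵐ ξ, w (-ξ) = -w ξ) :
    ∫ ξ, w ξ = 0 := by
  have h1 : ∫ ξ, w ξ = -∫ ξ, w ξ := by
    rw [← integral_neg, ← integral_neg_eq_self]
    exact integral_congr_ae h
  exact self_eq_neg.1 h1

/-- Odd states do not feel the point interaction. -/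
lemma oddState_mem_graph [LowDim d] {β α ε : ℝ} {w w' : L2 d} (hint : Integrable w)
    (hodd : ∀ᵐ ξ, w (-ξ) = -w ξ) (hw : w' =ᵐ[volume] fun ξ => ((symb ξ - β : ℝ) : ℂ) * w ξ) :
    (oddState w, oddState w') ∈ (hamiltonian d β α ε).graph := by
  refine mem_hamiltonian_graph.2 ⟨0, 0, BoundaryCondition.zero d α ε, isHamAction_iff.2 ⟨?_, ?_⟩⟩
  · intro σ
    simp only [Pi.zero_apply, zero_mul, sub_zero]
    fin_cases σ
    · refine (tendsto_const_nhds (x := (0 : ℂ))).congr' ?_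
      refine Eventually.filter_mono inf_le_right ?_
      simp only [Fin.zero_eta, oddState_zero]
      filter_upwards [Lp.coeFn_zero ℂ 2 (volume : Measure (EuclideanSpace ℝ (Fin d)))] with x hx
      rw [hx, Pi.zero_apply]
    · have h := tendsto_zero_of_integrable_fourier (oddState w 1) (by rwa [fourier_oddState])
      rw [fourier_oddState, integral_eq_zero_of_odd hodd] at h
      exact h
  · intro σ
    fin_cases σ
    · have h0 : (𝓕 (0 : L2 d) : L2 d) = 0 := (Lp.fourierTransformₗᵢ _ ℂ).map_zero
      simp only [Fin.zero_eta, oddState_zero, h0]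
      filter_upwards [Lp.coeFn_zero ℂ 2 (volume : Measure (EuclideanSpace ℝ (Fin d)))] with x hx
      simp
    · simp only [Fin.mk_one, fourier_oddState]
      filter_upwards [hw] with ξ hξ
      have hs : sgn 1 = -1 := rfl
      rw [hξ, hs, Pi.zero_apply]
      push_cast
      ring

lemma oddState_mem_orthogonal [LowDim d] {β α ε E : ℝ} (hβ : 0 < β) (hE : E < -β) {w : L2 d}
    (hodd : ∀ᵐ ξ, w (-ξ) = -w ξ) :
    oddState w ∈ (eigenspaceOf (hamiltonian d β α ε) E)ᗮ := by
  rw [Submodule.mem_orthogonal]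
  intro u hu
  obtain ⟨q, hq⟩ := eigenvector_eq hβ hE (mem_eigenspaceOf.1 hu)
  rw [PiLp.inner_apply, Fin.sum_univ_two, oddState_zero, inner_zero_right, zero_add, hq 1,
    inner_smul_left, ← Lp.inner_fourier_eq, fourier_oddState, L2.inner_def]
  rw [integral_eq_zero_of_odd, mul_zero]
  -- the Fourier transform of the Green function is even
  have hg := fourier_gLp (d := d) ((IsClosedAt.of_lt hβ hE).kap_re 1)
  have hneg := (Measure.measurePreserving_neg
    (volume : Measure (EuclideanSpace ℝ (Fin d)))).quasiMeasurePreserving.ae hg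
  filter_upwards [hodd, hg, hneg] with ξ h1 h2 h3
  rw [h2, h3, h1, RCLike.inner_apply, RCLike.inner_apply]
  simp only [symb, norm_neg]
  ring

/-- Approximate eigenvectors at every point of the essential spectrum, orthogonal to the bound
states. -/
lemma exists_weyl_vector [LowDim d] {β α ε E t : ℝ} (hβ : 0 < β) (hE : E < -β) (ht : -β ≤ t)
    {η : ℝ} (hη : 0 < η) : ∃ u v : State d, u ≠ 0 ∧ (u, v) ∈ (hamiltonian d β α ε).graph ∧
      u ∈ (eigenspaceOf (hamiltonian d β α ε) E)ᗮ ∧ v ∈ (eigenspaceOf (hamiltonian d β α ε) E)ᗮ ∧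
      ‖v - (t : ℂ) • u‖ ≤ η * ‖u‖ := by
  have hpi := Real.pi_pos
  have hd0 : 0 < d := LowDim.one_le
  set i : Fin d := ⟨0, hd0⟩
  have hs : 0 ≤ t + β := by linarith
  -- the Fourier transform of the Weyl vector is the first coordinate, an odd function, on a thin
  -- shell around the energy surface
  let M : Set (EuclideanSpace ℝ (Fin d)) := {ξ | t + β < symb ξ ∧ symb ξ < t + β + η}
  have hsymb : Continuous (symb : EuclideanSpace ℝ (Fin d) → ℝ) := by unfold symb; fun_prop
  have hMo : IsOpen M := (isOpen_lt continuous_const hsymb).inter (isOpen_lt hsymb continuous_const)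
  let R := √(t + β + η) / (2 * Real.pi)
  have hMb : ∀ ξ ∈ M, ‖ξ‖ ≤ R := by
    intro ξ hξ
    rw [le_div_iff₀ (by positivity)]
    refine Real.le_sqrt_of_sq_le ?_
    have := hξ.2.le
    rw [symb] at this
    nlinarith
  have hMfin : volume M < ⊤ :=
    (measure_mono fun ξ hξ => mem_closedBall_zero_iff.2 (hMb ξ hξ)).trans_lt
      (measure_closedBall_lt_top (x := (0 : EuclideanSpace ℝ (Fin d))) (r := R))
  have hMneg : ∀ ξ, -ξ ∈ M ↔ ξ ∈ M := by
    intro ξ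
    simp [M, symb]
  -- bounded functions on the shell are in every `Lᵖ`
  have hmem : ∀ (p : ENNReal) (m : EuclideanSpace ℝ (Fin d) → ℂ) (C : ℝ), Continuous m →
      (∀ ξ ∈ M, ‖m ξ‖ ≤ C) → MemLp (M.indicator m) p := by
    intro p m C hm hC
    rw [memLp_indicator_iff_restrict hMo.measurableSet]
    have : IsFiniteMeasure (volume.restrict M) := ⟨by simpa using hMfin⟩
    refine MemLp.of_bound hm.aestronglyMeasurable C ?_
    filter_upwards [self_mem_ae_restrict hMo.measurableSet] with ξ hξ using hC ξ hξ
  let m : EuclideanSpace ℝ (Fin d) → ℂ := fun ξ => ((ξ i : ℝ) : ℂ)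
  let m' : EuclideanSpace ℝ (Fin d) → ℂ := fun ξ => ((symb ξ - β : ℝ) : ℂ) * m ξ
  have hm : Continuous m := by fun_prop
  have hm' : Continuous m' := by fun_prop
  have hmb : ∀ ξ ∈ M, ‖m ξ‖ ≤ R := by
    intro ξ hξ
    rw [Complex.norm_real]
    exact (PiLp.norm_apply_le ξ i).trans (hMb ξ hξ)
  have hmb' : ∀ ξ ∈ M, ‖m' ξ‖ ≤ (|t| + η) * R := by
    intro ξ hξ
    rw [norm_mul, Complex.norm_real, Real.norm_eq_abs]
    have h1 : |symb ξ - β| ≤ |t| + η := by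
      have := neg_abs_le t
      have := le_abs_self t
      rw [abs_le]
      constructor <;> linarith [hξ.1, hξ.2]
    exact mul_le_mul h1 (hmb ξ hξ) (norm_nonneg _) (by positivity)
  have hw2 := hmem 2 m R hm hmb
  have hw1 := memLp_one_iff_integrable.1 (hmem 1 m R hm hmb)
  have hw2' := hmem 2 m' _ hm' hmb'
  have hw1' := memLp_one_iff_integrable.1 (hmem 1 m' _ hm' hmb')
  have hneg : ∀ {w : L2 d} {f : EuclideanSpace ℝ (Fin d) → ℂ}, w =ᵐ[volume] f →
      (∀ ξ, f (-ξ) = -f ξ) → ∀ᵐ ξ, w (-ξ) = -w ξ := by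
    intro w f h1 h2
    have h3 := (Measure.measurePreserving_neg
      (volume : Measure (EuclideanSpace ℝ (Fin d)))).quasiMeasurePreserving.ae h1
    filter_upwards [h1, h3] with ξ a1 a2
    rw [a1, a2, h2]
  have hodd : ∀ ξ, M.indicator m (-ξ) = -M.indicator m ξ := by
    intro ξ
    by_cases h : ξ ∈ M
    · rw [Set.indicator_of_mem h, Set.indicator_of_mem ((hMneg ξ).2 h)]
      simp [m]
    · rw [Set.indicator_of_notMem h, Set.indicator_of_notMem (fun h' => h ((hMneg ξ).1 h')),
        neg_zero]
  have hodd' : ∀ ξ, M.indicator m' (-ξ) = -M.indicator m' ξ := by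
    intro ξ
    by_cases h : ξ ∈ M
    · rw [Set.indicator_of_mem h, Set.indicator_of_mem ((hMneg ξ).2 h)]
      simp [m', m, symb]
    · rw [Set.indicator_of_notMem h, Set.indicator_of_notMem (fun h' => h ((hMneg ξ).1 h')),
        neg_zero]
  set w : L2 d := hw2.toLp _ with hwdef
  set w' : L2 d := hw2'.toLp _ with hwdef'
  have hwe : w =ᵐ[volume] M.indicator m := hw2.coeFn_toLp
  have hwe' : w' =ᵐ[volume] M.indicator m' := hw2'.coeFn_toLp
  refine ⟨oddState w, oddState w', ?_, ?_, oddState_mem_orthogonal hβ hE (hneg hwe hodd),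
    oddState_mem_orthogonal hβ hE (hneg hwe' hodd'), ?_⟩
  · rw [← norm_ne_zero_iff, norm_oddState, norm_ne_zero_iff]
    intro h0
    rw [h0] at hwe
    have hopen : IsOpen (M ∩ {ξ | ξ i ≠ 0}) :=
      hMo.inter (isOpen_ne_fun (by fun_prop) continuous_const)
    have hnull : volume (M ∩ {ξ | ξ i ≠ 0}) = 0 := by
      have h2 : ∀ᵐ ξ, ξ ∉ M ∩ {ξ | ξ i ≠ 0} := by
        filter_upwards [hwe, Lp.coeFn_zero ℂ 2 (volume : Measure (EuclideanSpace ℝ (Fin d)))]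
          with ξ a1 a2 hξ
        rw [a2, Pi.zero_apply, Set.indicator_of_mem hξ.1] at a1
        exact hξ.2 (Complex.ofReal_eq_zero.1 a1.symm)
      have h3 := ae_iff.1 h2
      simp only [not_not] at h3
      exact h3
    rw [hopen.measure_eq_zero_iff volume] at hnull
    -- the shell contains a point of the first coordinate axis
    let ρ := √(t + β + η / 2) / (2 * Real.pi)
    have hρ : 0 < ρ := by positivity
    have hmemM : EuclideanSpace.single i ρ ∈ M ∩ {ξ | ξ i ≠ 0} := by
      have h1 : symb (EuclideanSpace.single i ρ) = t + β + η / 2 := by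
        rw [symb, PiLp.norm_single, Real.norm_of_nonneg hρ.le, div_pow,
          Real.sq_sqrt (by positivity)]
        field_simp
      refine ⟨⟨by rw [h1]; linarith, by rw [h1]; linarith⟩, ?_⟩
      simp only [Set.mem_ofPred_eq, PiLp.single_apply, if_true]
      exact hρ.ne'
    rw [hnull] at hmemM
    exact hmemM
  · refine oddState_mem_graph (hw1.congr hwe.symm) (hneg hwe hodd) ?_
    filter_upwards [hwe, hwe'] with ξ a1 a2
    rw [a1, a2]
    by_cases h : ξ ∈ M
    · rw [Set.indicator_of_mem h, Set.indicator_of_mem h]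
    · rw [Set.indicator_of_notMem h, Set.indicator_of_notMem h, mul_zero]
  · rw [oddState_sub_smul, norm_oddState, norm_oddState]
    refine Lp.norm_le_mul_norm_of_ae_le_mul ?_
    filter_upwards [hwe, hwe', Lp.coeFn_sub w' ((t : ℂ) • w), Lp.coeFn_smul (t : ℂ) w]
      with ξ a1 a2 a3 a4
    rw [a3, Pi.sub_apply, a4, Pi.smul_apply, a1, a2, smul_eq_mul]
    by_cases h : ξ ∈ M
    · rw [Set.indicator_of_mem h, Set.indicator_of_mem h]
      have h1 : m' ξ - (t : ℂ) * m ξ = ((symb ξ - β - t : ℝ) : ℂ) * m ξ := by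
        simp only [m']; push_cast; ring
      rw [h1, norm_mul, Complex.norm_real, Real.norm_of_nonneg (by linarith [h.1])]
      exact mul_le_mul_of_nonneg_right (by linarith [h.2]) (norm_nonneg _)
    · rw [Set.indicator_of_notMem h, Set.indicator_of_notMem h]
      simp

end WeylVectors

/-! ### The resolvent between cut-offs -/

section CutOff

variable {d : ℕ}

/-- The Green function restricted to the ball of radius `r`, as an element of `Lᵖ`. -/
def cutGreen (p : ENNReal) (d : ℕ) (r : ℝ) (κ : ℂ) :
    Lp ℂ p (volume : Measure (EuclideanSpace ℝ (Fin d))) :=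
  lpClass p volume ((Metric.ball 0 r).indicator (gk d κ))

lemma memLp_cutGreen [LowDim d] {p : ENNReal} (hp : MemLp (envelope d 1) p) {κ : ℂ}
    (hκ : κ ∈ Complex.slitPlane) (r : ℝ) :
    MemLp ((Metric.ball 0 r).indicator (gk d κ)) p := by
  obtain ⟨ρ, hρ, C, hC, h⟩ := exists_norm_gk_le_of_norm_lt (d := d) hκ r
  refine (hp.const_mul C).mono ((measurable_gk hκ).indicator measurableSet_ball).aestronglyMeasurable ?_
  filter_upwards [ae_ne_zero] with x hx
  by_cases hxr : x ∈ Metric.ball 0 r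
  · rw [Set.indicator_of_mem hxr]
    exact ((h κ (Metric.mem_ball_self hρ)).2 x hx (mem_ball_zero_iff.1 hxr)).trans (le_abs_self _)
  · rw [Set.indicator_of_notMem hxr, norm_zero]
    exact norm_nonneg _

lemma differentiableAt_cutGreen [LowDim d] {p : ENNReal} [Fact (1 ≤ p)]
    (hp : MemLp (envelope d 1) p) {κ : ℂ} (hκ : κ ∈ Complex.slitPlane) (r : ℝ) :
    DifferentiableAt ℂ (cutGreen p d r) κ := by
  obtain ⟨ρ, hρ, C, hC, h⟩ := exists_norm_gk_le_of_norm_lt (d := d) hκ r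
  refine differentiableAt_lpClass hρ (hp.const_mul C) (fun z hz =>
    ((measurable_gk (h z hz).1).indicator measurableSet_ball).aestronglyMeasurable) ?_ ?_
  · filter_upwards [ae_ne_zero] with x hx z hz
    refine DifferentiableAt.differentiableWithinAt ?_
    by_cases hxr : x ∈ Metric.ball 0 r
    · simpa only [Set.indicator_of_mem hxr] using differentiableAt_gk (h z hz).1 hx
    · simp only [Set.indicator_of_notMem hxr]
      exact differentiableAt_const _
  · filter_upwards [ae_ne_zero] with x hx z hz
    by_cases hxr : x ∈ Metric.ball 0 r
    · rw [Set.indicator_of_mem hxr]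
      exact (h z hz).2 x hx (mem_ball_zero_iff.1 hxr)
    · rw [Set.indicator_of_notMem hxr, norm_zero]
      exact mul_nonneg hC (envelope_nonneg _ _)

lemma memLp_one_envelope [LowDim d] : MemLp (envelope d 1) 1 :=
  memLp_one_iff_integrable.2 (integrable_envelope one_pos)

lemma cutGreen_ae_eq [LowDim d] {κ : ℂ} (hκ : κ ∈ Complex.slitPlane) (r : ℝ) :
    cutGreen 2 d r κ =ᵐ[volume] (Metric.ball 0 r).indicator (gk d κ) := by
  rw [cutGreen, lpClass_eq (memLp_cutGreen (memLp_two_envelope one_pos) hκ r)]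
  exact MemLp.coeFn_toLp _

/-- The free resolvent between cut-offs, continued to the plane cut along the negative real
axis in `κ`. -/
def cutRes (d : ℕ) (r : ℝ) (κ : ℂ) : L2 d →L[ℂ] L2 d :=
  cutL r ∘L convOp (cutGreen 1 d (2 * r) κ) ∘L cutL r

lemma differentiableAt_cutRes [LowDim d] {κ : ℂ} (hκ : κ ∈ Complex.slitPlane) (r : ℝ) :
    DifferentiableAt ℂ (cutRes d r) κ := by
  have h := differentiableAt_convOp
    (differentiableAt_cutGreen (d := d) memLp_one_envelope hκ (2 * r))
  exact (differentiableAt_const _).clm_comp (h.clm_comp (differentiableAt_const _))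

lemma cutRes_apply [LowDim d] {κ : ℂ} (hκ : 0 < κ.re) (r : ℝ) (u : L2 d) :
    cutRes d r κ u = cutL r (freeRes d κ (cutL r u)) := by
  have hs := re_pos_mem_slitPlane hκ
  have h1 : lpClass 1 volume (gk d κ) =
      cutGreen 1 d (2 * r) κ + (lpClass 1 volume (gk d κ) - cutGreen 1 d (2 * r) κ) := by abel
  have h2 : cutL r (convOp (lpClass 1 volume (gk d κ) - cutGreen 1 d (2 * r) κ) (cutL r u)) = 0 := by
    refine cutL_convOp_cutL_eq_zero ?_ u
    rw [cutGreen, lpClass_eq (memLp_cutGreen memLp_one_envelope hs (2 * r)),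
      lpClass_eq (memLp_one_iff_integrable.2 (integrable_gk hκ))]
    filter_upwards [Lp.coeFn_sub ((memLp_one_iff_integrable.2 (integrable_gk hκ)).toLp (gk d κ))
      ((memLp_cutGreen memLp_one_envelope hs (2 * r)).toLp _),
      (memLp_one_iff_integrable.2 (integrable_gk hκ)).coeFn_toLp,
      (memLp_cutGreen memLp_one_envelope hs (2 * r)).coeFn_toLp] with x a1 a2 a3 hx
    rw [a1, Pi.sub_apply, a2, a3, Set.indicator_of_mem (mem_ball_zero_iff.2 hx), sub_self]
  rw [freeRes, h1, convOp_add, add_apply, map_add, h2, add_zero]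
  rfl

lemma cutL_gLp [LowDim d] {κ : ℂ} (hκ : 0 < κ.re) (r : ℝ) :
    cutL r (gLp d κ) = cutGreen 2 d r κ := by
  refine Lp.ext ?_
  filter_upwards [cutL_ae_eq r (gLp d κ), gLp_ae_eq (d := d) hκ,
    cutGreen_ae_eq (re_pos_mem_slitPlane hκ) r] with x h1 h2 h3
  rw [h1, h3]
  by_cases hx : x ∈ Metric.ball 0 r
  · rw [Set.indicator_of_mem hx, Set.indicator_of_mem hx, h2]
  · rw [Set.indicator_of_notMem hx, Set.indicator_of_notMem hx]

lemma pairL_cutL (r : ℝ) (u v : L2 d) :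
    pairL volume u (cutL r v) = pairL volume (cutL r u) v := by
  rw [pairL_eq_integral, pairL_eq_integral]
  refine integral_congr_ae ?_
  filter_upwards [cutL_ae_eq r u, cutL_ae_eq r v] with x h1 h2
  rw [h1, h2]
  by_cases hx : x ∈ Metric.ball 0 r
  · rw [Set.indicator_of_mem hx, Set.indicator_of_mem hx]
  · rw [Set.indicator_of_notMem hx, Set.indicator_of_notMem hx, mul_zero, zero_mul]

lemma cutoff_apply (r : ℝ) (Ψ : State d) (σ : Fin 2) : cutoff r Ψ σ = cutL r (Ψ σ) := by
  refine Lp.ext ?_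
  refine EventuallyEq.trans ?_ (cutL_ae_eq r (Ψ σ)).symm
  exact ((Lp.memLp (Ψ σ)).indicator measurableSet_ball).coeFn_toLp

/-- The cut-off Green function does not vanish, because the singularity of the Green function at
the origin, or its value there for `d = 1`, does not. -/
lemma cutGreen_ne_zero [hd : LowDim d] {κ : ℂ} (hκ : κ ∈ Complex.slitPlane) {r : ℝ} (hr : 0 < r) :
    cutGreen 2 d r κ ≠ 0 := by
  intro h0
  have h1 := cutGreen_ae_eq (d := d) hκ r
  rw [h0] at h1
  have hle := nhds_inf_ae_le (d := d)
  have h2 : ∀ᶠ x in 𝓝 (0 : EuclideanSpace ℝ (Fin d)) ⊓ ae volume, gk d κ x = 0 := by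
    have ha := (h1.symm.trans (Lp.coeFn_zero ℂ 2 (volume : Measure (EuclideanSpace ℝ (Fin d)))))
    have hb : ∀ᶠ x in 𝓝 (0 : EuclideanSpace ℝ (Fin d)), x ∈ Metric.ball 0 r :=
      Metric.ball_mem_nhds _ hr
    filter_upwards [ha.filter_mono inf_le_right, hb.filter_mono inf_le_left] with x a1 a2
    rwa [Set.indicator_of_mem a2] at a1
  have h3 : Tendsto (fun x => singularPart d x)
      (𝓝 (0 : EuclideanSpace ℝ (Fin d)) ⊓ ae volume) (𝓝 (-greg d κ)) := by
    refine ((tendsto_gk_sub_singularPart hκ).neg.mono_left hle).congr' ?_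
    filter_upwards [h2] with x hx
    rw [hx]; ring
  have hn : Tendsto (fun x : EuclideanSpace ℝ (Fin d) => ‖x‖) (𝓝 0 ⊓ ae volume) (𝓝[>] 0) :=
    tendsto_norm_nhdsNE_zero.mono_left hle
  have hpi := Real.pi_pos
  rcases hd.cases with rfl | rfl | rfl
  · have h4 := tendsto_nhds_unique h3 tendsto_const_nhds
    have h5 : greg 1 κ ≠ 0 :=
      one_div_ne_zero (mul_ne_zero two_ne_zero (Complex.slitPlane_ne_zero hκ))
    exact h5 (neg_eq_zero.1 h4)
  · refine not_tendsto_nhds_of_tendsto_atTop ?_ _ h3.norm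
    have h4 : Tendsto (fun x : EuclideanSpace ℝ (Fin 2) => -Real.log ‖x‖ / (2 * Real.pi))
        (𝓝 0 ⊓ ae volume) atTop :=
      (tendsto_neg_atBot_atTop.comp (Real.tendsto_log_nhdsGT_zero.comp hn)).atTop_div_const
        (by positivity)
    refine tendsto_atTop_mono (fun x => ?_) h4
    rw [singularPart, Complex.norm_real]
    exact le_abs_self _
  · refine not_tendsto_nhds_of_tendsto_atTop ?_ _ h3.norm
    have h4 : Tendsto (fun x : EuclideanSpace ℝ (Fin 3) => ‖x‖⁻¹ / (4 * Real.pi))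
        (𝓝 0 ⊓ ae volume) atTop :=
      (tendsto_inv_nhdsGT_zero.comp hn).atTop_div_const (by positivity)
    refine tendsto_atTop_mono (fun x => ?_) h4
    rw [singularPart, Complex.norm_real]
    refine le_trans (le_of_eq ?_) (le_abs_self _)
    rw [one_div, mul_inv_rev, div_eq_mul_inv]

lemma pairL_cutGreen_ne_zero [LowDim d] {κ : ℂ} (hκ : κ ∈ Complex.slitPlane) {r : ℝ}
    (hr : 0 < r) : pairL volume (cutGreen 2 d r κ) ≠ 0 := by
  intro h
  have hκ' := conj_mem_slitPlane hκ
  have h1 := pairL_eq_inner (u := cutGreen 2 d r κ) (u' := cutGreen 2 d r ((starRingEnd ℂ) κ)) (by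
    filter_upwards [cutGreen_ae_eq (d := d) hκ r, cutGreen_ae_eq (d := d) hκ' r, ae_ne_zero]
      with x a1 a2 a3
    rw [a1, a2]
    by_cases hx : x ∈ Metric.ball 0 r
    · rw [Set.indicator_of_mem hx, Set.indicator_of_mem hx, gk_conj hκ a3]
    · rw [Set.indicator_of_notMem hx, Set.indicator_of_notMem hx, map_zero])
    (cutGreen 2 d r ((starRingEnd ℂ) κ))
  rw [h, zero_apply] at h1
  exact cutGreen_ne_zero hκ' hr (inner_self_eq_zero.1 h1.symm)

/-- The resolvent of the Hamiltonian between cut-offs, as a function of the two square roots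
`κ_σ`, which may lie on either sheet. -/
def cutKrein (d : ℕ) (α ε r : ℝ) (k : Fin 2 → ℂ) : State d →L[ℂ] State d :=
  blockOp (fun σ => cutRes d r (k σ)) (fun σ => cutGreen 2 d r (k σ)) (qmat d α ε k)

lemma cutoff_kreinOp [LowDim d] {β α ε : ℝ} {z : ℂ} (hz : IsClosedAt β z) (r : ℝ) (Ψ : State d) :
    cutoff r (kreinOp d β α ε z (cutoff r Ψ)) = cutKrein d α ε r (kap β z) Ψ := by
  ext σ : 1
  simp only [cutoff_apply, kreinOp, cutKrein, blockOp_apply, cutRes_apply (hz.kap_re _),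
    ← cutL_gLp (hz.kap_re _), pairL_cutL, map_add, map_smul]

/-- The part of the continued resolvent that stays regular at zeros of the determinant. -/
def regularPart (d : ℕ) (r : ℝ) (k : Fin 2 → ℂ) : State d →L[ℂ] State d :=
  blockOp (fun σ => cutRes d r (k σ)) (fun σ => cutGreen 2 d r (k σ))
    (Matrix.of fun σ τ => -if σ = τ then shift d (k σ) else 0)

/-- The numerator of the finite rank part of the continued resolvent. -/
def polarPart (d : ℕ) (α ε r : ℝ) (k : Fin 2 → ℂ) : State d →L[ℂ] State d :=
  blockOp 0 (fun σ => cutGreen 2 d r (k σ))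
    (Matrix.of fun σ τ => ampl d (k σ) * ampl d (k τ) * kadj d α ε k σ τ)

lemma cutKrein_eq (α ε r : ℝ) (k : Fin 2 → ℂ) :
    cutKrein d α ε r k = regularPart d r k + (kdet d α ε k)⁻¹ • polarPart d α ε r k := by
  ext Ψ σ : 2
  rw [add_apply, PiLp.add_apply, smul_apply,
    PiLp.smul_apply, cutKrein, regularPart, polarPart, blockOp_apply, blockOp_apply, blockOp_apply,
    Pi.zero_apply, zero_apply, zero_add, add_assoc, smul_smul, ← add_smul]
  congr 2
  simp only [qmat, Fin.sum_univ_two, Matrix.of_apply]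
  ring

lemma differentiableAt_blockOp {B : ℂ → Fin 2 → L2 d →L[ℂ] L2 d} {g : ℂ → Fin 2 → L2 d}
    {Q : ℂ → Matrix (Fin 2) (Fin 2) ℂ} {z : ℂ} (hB : ∀ σ, DifferentiableAt ℂ (fun z => B z σ) z)
    (hg : ∀ σ, DifferentiableAt ℂ (fun z => g z σ) z)
    (hQ : ∀ σ τ, DifferentiableAt ℂ (fun z => Q z σ τ) z) :
    DifferentiableAt ℂ (fun z => blockOp (B z) (g z) (Q z)) z := by
  have h1 : ∀ σ τ, DifferentiableAt ℂ (fun z => (pairL volume (g z τ) ∘L chanOut d τ).smulRight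
      (chanIn d σ (g z σ))) z := by
    intro σ τ
    have ha : DifferentiableAt ℂ (fun z => pairL volume (g z τ) ∘L chanOut d τ) z :=
      ((pairL volume).differentiableAt.comp z (hg τ)).clm_comp (differentiableAt_const _)
    have hb : DifferentiableAt ℂ (fun z => chanIn d σ (g z σ)) z :=
      (chanIn d σ).differentiableAt.comp z (hg σ)
    exact ((ContinuousLinearMap.smulRightL ℂ (State d) (State d)).hasFDerivAt_of_bilinear
      ha.hasFDerivAt hb.hasFDerivAt).differentiableAt
  unfold blockOp
  simp only [Fin.sum_univ_two]
  have h2 : ∀ σ, DifferentiableAt ℂ (fun z => chanIn d σ ∘L B z σ ∘L chanOut d σ) z := fun σ =>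
    (differentiableAt_const _).clm_comp ((hB σ).clm_comp (differentiableAt_const _))
  exact ((h2 0).add (h2 1)).add ((((hQ 0 0).smul (h1 0 0)).add ((hQ 0 1).smul (h1 0 1))).add
    (((hQ 1 0).smul (h1 1 0)).add ((hQ 1 1).smul (h1 1 1))))

lemma differentiableAt_nfun [hd : LowDim d] {κ : ℂ} (hκ : κ ∈ Complex.slitPlane) :
    DifferentiableAt ℂ (nfun d) κ := by
  rcases hd.cases with rfl | rfl | rfl
  · exact differentiableAt_id.const_mul (2 : ℂ)
  · have h1 : κ / 2 ∈ Complex.slitPlane := by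
      have : κ / 2 = ((1 / 2 : ℝ) : ℂ) * κ := by push_cast; ring
      rw [this, mul_comm]
      exact mem_slitPlane_mul_pos hκ (by norm_num)
    have h2 : DifferentiableAt ℂ (fun κ : ℂ => Complex.log (κ / 2)) κ :=
      (differentiableAt_id.div_const 2).clog h1
    exact ((h2.add_const _).neg.div_const _).neg
  · exact (differentiableAt_id.neg.div_const _).neg

variable {k : ℂ → Fin 2 → ℂ} {z : ℂ}

lemma differentiableAt_kdet [LowDim d] (α ε : ℝ) (hk : ∀ σ, DifferentiableAt ℂ (fun z => k z σ) z)
    (hm : ∀ σ, k z σ ∈ Complex.slitPlane) :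
    DifferentiableAt ℂ (fun z => kdet d α ε (k z)) z := by
  have hn : ∀ σ, DifferentiableAt ℂ (fun z => nfun d (k z σ)) z := fun σ =>
    (differentiableAt_nfun (hm σ)).fun_comp' z (hk σ)
  exact (((hn 0).const_add _).mul ((hn 1).const_add _)).sub_const _

lemma differentiableAt_regularPart [hd : LowDim d] (r : ℝ)
    (hk : ∀ σ, DifferentiableAt ℂ (fun z => k z σ) z) (hm : ∀ σ, k z σ ∈ Complex.slitPlane) :
    DifferentiableAt ℂ (fun z => regularPart d r (k z)) z := by
  have hs : ∀ σ, DifferentiableAt ℂ (fun z => shift d (k z σ)) z := fun σ => by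
    rcases hd.cases with rfl | rfl | rfl
    · exact (hk σ).const_mul 2
    · exact differentiableAt_const _
    · exact differentiableAt_const _
  have hg : ∀ σ, DifferentiableAt ℂ (fun z => cutGreen 2 d r (k z σ)) z := fun σ =>
    (differentiableAt_cutGreen (memLp_two_envelope one_pos) (hm σ) r).fun_comp' z (hk σ)
  refine differentiableAt_blockOp
    (fun σ => (differentiableAt_cutRes (hm σ) r).fun_comp' z (hk σ))
    (fun σ => hg σ)
    fun σ τ => ?_
  simp only [Matrix.of_apply]
  by_cases h : σ = τ
  · simpa only [if_pos h] using (hs σ).fun_neg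
  · simp only [if_neg h]
    exact differentiableAt_const _

lemma differentiableAt_polarPart [hd : LowDim d] (α ε r : ℝ)
    (hk : ∀ σ, DifferentiableAt ℂ (fun z => k z σ) z) (hm : ∀ σ, k z σ ∈ Complex.slitPlane) :
    DifferentiableAt ℂ (fun z => polarPart d α ε r (k z)) z := by
  have ha : ∀ σ, DifferentiableAt ℂ (fun z => ampl d (k z σ)) z := fun σ => by
    rcases hd.cases with rfl | rfl | rfl
    · exact (hk σ).const_mul 2
    · exact differentiableAt_const _
    · exact differentiableAt_const _
  have hn : ∀ σ, DifferentiableAt ℂ (fun z => nfun d (k z σ)) z := fun σ =>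
    (differentiableAt_nfun (hm σ)).fun_comp' z (hk σ)
  have hg : ∀ σ, DifferentiableAt ℂ (fun z => cutGreen 2 d r (k z σ)) z := fun σ =>
    (differentiableAt_cutGreen (memLp_two_envelope one_pos) (hm σ) r).fun_comp' z (hk σ)
  refine differentiableAt_blockOp (fun σ => differentiableAt_const _)
    (fun σ => hg σ)
    fun σ τ => ((ha σ).mul (ha τ)).mul ?_
  fin_cases σ <;> fin_cases τ
  · exact (hn 1).const_add _
  · exact differentiableAt_const _
  · exact differentiableAt_const _
  · exact (hn 0).const_add _

/-- The off-diagonal entry of the numerator does not vanish: applied to a state in the lower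
channel, it yields a multiple of the Green function in the upper channel. -/
lemma polarPart_ne_zero [hd : LowDim d] {α ε r : ℝ} (hε : 0 < ε) (hr : 0 < r) {k : Fin 2 → ℂ}
    (hm : ∀ σ, k σ ∈ Complex.slitPlane) : polarPart d α ε r k ≠ 0 := by
  intro h0
  obtain ⟨u, hu⟩ : ∃ u, pairL volume (cutGreen 2 d r (k 1)) u ≠ 0 := by
    by_contra! h
    exact pairL_cutGreen_ne_zero (hm 1) hr (ContinuousLinearMap.ext h)
  have ha : ∀ σ, ampl d (k σ) ≠ 0 := by
    intro σ
    rcases hd.cases with rfl | rfl | rfl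
    · exact mul_ne_zero two_ne_zero (Complex.slitPlane_ne_zero (hm σ))
    · exact one_ne_zero
    · exact one_ne_zero
  have h1 : polarPart d α ε r k (chanIn d 1 u) 0 = 0 := by rw [h0]; rfl
  rw [polarPart, blockOp_apply, Fin.sum_univ_two, chanIn_apply, chanIn_apply, if_neg (by decide),
    if_pos rfl, map_zero, map_zero, Matrix.of_apply, Matrix.of_apply, mul_zero, zero_add,
    zero_add] at h1
  refine smul_ne_zero (mul_ne_zero (mul_ne_zero (mul_ne_zero (ha 0) (ha 1)) ?_) hu)
    (cutGreen_ne_zero (hm 0) hr) h1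
  simp [kadj, hε.ne']

end CutOff

/-! ### Continuation to the second sheet -/

section Continuation

variable {d : ℕ}

/-- A holomorphic choice of the square roots. -/
structure IsBranch (U : Set ℂ) (k : ℂ → Fin 2 → ℂ) : Prop where
  isOpen : IsOpen U
  differentiableAt : ∀ z ∈ U, ∀ σ, DifferentiableAt ℂ (fun z => k z σ) z
  mem : ∀ z ∈ U, ∀ σ, k z σ ∈ Complex.slitPlane

variable {U : Set ℂ} {k : ℂ → Fin 2 → ℂ} {z : ℂ}

lemma IsBranch.analyticAt {F : Type*} [NormedAddCommGroup F] [NormedSpace ℂ F] [CompleteSpace F]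
    (hU : IsBranch U k) {f : ℂ → F} (hf : ∀ z ∈ U, DifferentiableAt ℂ f z) (hz : z ∈ U) :
    AnalyticAt ℂ f z :=
  DifferentiableOn.analyticAt (fun w hw => (hf w hw).differentiableWithinAt)
    (hU.isOpen.mem_nhds hz)

lemma IsBranch.analyticAt_kdet [LowDim d] (hU : IsBranch U k) (α ε : ℝ) (hz : z ∈ U) :
    AnalyticAt ℂ (fun z => kdet d α ε (k z)) z :=
  hU.analyticAt (fun w hw => differentiableAt_kdet α ε (hU.differentiableAt w hw) (hU.mem w hw)) hz

lemma IsBranch.analyticAt_regularPart [LowDim d] (hU : IsBranch U k) (r : ℝ) (hz : z ∈ U) :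
    AnalyticAt ℂ (fun z => regularPart d r (k z)) z :=
  hU.analyticAt (fun w hw => differentiableAt_regularPart r (hU.differentiableAt w hw)
    (hU.mem w hw)) hz

lemma IsBranch.analyticAt_polarPart [LowDim d] (hU : IsBranch U k) (α ε r : ℝ) (hz : z ∈ U) :
    AnalyticAt ℂ (fun z => polarPart d α ε r (k z)) z :=
  hU.analyticAt (fun w hw => differentiableAt_polarPart α ε r (hU.differentiableAt w hw)
    (hU.mem w hw)) hz

lemma IsBranch.meromorphicAt [LowDim d] (hU : IsBranch U k) (α ε r : ℝ) (hz : z ∈ U) :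
    MeromorphicAt (fun z => cutKrein d α ε r (k z)) z := by
  simp only [cutKrein_eq]
  exact (hU.analyticAt_regularPart r hz).meromorphicAt.add
    ((hU.analyticAt_kdet α ε hz).meromorphicAt.inv.smul
      (hU.analyticAt_polarPart α ε r hz).meromorphicAt)

lemma IsBranch.analyticAt_cutKrein [LowDim d] (hU : IsBranch U k) {α ε : ℝ} (r : ℝ) (hz : z ∈ U)
    (hD : kdet d α ε (k z) ≠ 0) : AnalyticAt ℂ (fun z => cutKrein d α ε r (k z)) z := by
  simp only [cutKrein_eq]
  exact (hU.analyticAt_regularPart r hz).add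
    (((hU.analyticAt_kdet α ε hz).inv hD).smul (hU.analyticAt_polarPart α ε r hz))

/-- Simple zeros of the determinant are simple poles of the continued resolvent. -/
lemma IsBranch.meromorphicOrderAt_eq [LowDim d] (hU : IsBranch U k) {α ε r : ℝ} (hε : 0 < ε)
    (hr : 0 < r) (hz : z ∈ U) (hD : kdet d α ε (k z) = 0)
    (hD' : deriv (fun z => kdet d α ε (k z)) z ≠ 0) :
    meromorphicOrderAt (fun z => cutKrein d α ε r (k z)) z = ((-1 : ℤ) : WithTop ℤ) := by
  have h1 := hU.analyticAt_kdet (d := d) α ε hz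
  have h2 := hU.analyticAt_regularPart (d := d) r hz
  have h3 := hU.analyticAt_polarPart (d := d) α ε r hz
  have h4 : meromorphicOrderAt (fun z => kdet d α ε (k z)) z = 1 := by
    rw [h1.meromorphicOrderAt_eq, h1.analyticOrderAt_eq_one_of_zero_deriv_ne_zero hD hD']
    rfl
  have h5 : meromorphicOrderAt (fun z => polarPart d α ε r (k z)) z = 0 := by
    rw [h3.meromorphicOrderAt_eq, h3.analyticOrderAt_eq_zero.2 (polarPart_ne_zero hε hr (hU.mem z hz))]
    rfl
  have h6 : meromorphicOrderAt (fun z => (kdet d α ε (k z))⁻¹ • polarPart d α ε r (k z)) z =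
      ((-1 : ℤ) : WithTop ℤ) := by
    have := meromorphicOrderAt_smul (f := fun z => (kdet d α ε (k z))⁻¹)
      h1.meromorphicAt.fun_inv h3.meromorphicAt
    rw [show (fun z => (kdet d α ε (k z))⁻¹) = (fun z => kdet d α ε (k z))⁻¹ from rfl,
      meromorphicOrderAt_inv, h4, h5] at this
    exact this
  simp only [cutKrein_eq]
  rw [← h6]
  refine meromorphicOrderAt_add_eq_right_of_lt h2.meromorphicAt ?_
  rw [h6]
  refine lt_of_lt_of_le ?_ h2.meromorphicOrderAt_nonneg
  exact_mod_cast (by norm_num : (-1 : ℤ) < 0)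

/-- The square roots continued from the upper half-plane to the cut plane: the threshold `β` stays
closed while the threshold `-β` opens. -/
def kres (β : ℝ) (z : ℂ) : Fin 2 → ℂ :=
  ![(β - z) ^ (1 / 2 : ℂ), -Complex.I * (z + β) ^ (1 / 2 : ℂ)]

lemma mem_slitPlane_of_im_neg {κ : ℂ} (h : κ.im < 0) : κ ∈ Complex.slitPlane :=
  Complex.mem_slitPlane_iff.2 (Or.inr h.ne)

lemma kres_one_im {β : ℝ} {z : ℂ} (hz : z + β ∈ Complex.slitPlane) : (kres β z 1).im < 0 := by
  have := cpow_half_re_pos hz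
  simpa [kres] using this

lemma isOpen_cutPlane (β : ℝ) : IsOpen (cutPlane β) :=
  (isOpen_ne_fun Complex.continuous_im continuous_const).union
    (isOpen_lt Complex.continuous_re.abs continuous_const)

lemma sub_mem_of_mem_cutPlane {β : ℝ} {z : ℂ} (hz : z ∈ cutPlane β) :
    (β : ℂ) - z ∈ Complex.slitPlane := by
  rw [Complex.mem_slitPlane_iff]
  rcases hz with h | h
  · right; simpa using h
  · left; simpa using (abs_lt.1 h).2

lemma add_mem_of_mem_cutPlane {β : ℝ} {z : ℂ} (hz : z ∈ cutPlane β) :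
    z + (β : ℂ) ∈ Complex.slitPlane := by
  rw [Complex.mem_slitPlane_iff]
  rcases hz with h | h
  · right; simpa using h
  · left
    have := (abs_lt.1 h).1
    simp only [Complex.add_re, Complex.ofReal_re]
    linarith

lemma hasDerivAt_cpow_half {w : ℂ} (hw : w ∈ Complex.slitPlane) :
    HasDerivAt (fun w : ℂ => w ^ (1 / 2 : ℂ)) (1 / (2 * w ^ (1 / 2 : ℂ))) w := by
  have h : HasDerivAt (fun w : ℂ => w ^ (1 / 2 : ℂ)) _ w :=
    (hasDerivAt_id w).cpow_const (c := (1 / 2 : ℂ)) hw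
  refine h.congr_deriv ?_
  have hw0 := Complex.slitPlane_ne_zero hw
  rw [id_eq, mul_one, Complex.cpow_sub _ _ hw0, Complex.cpow_one]
  have h2 := cpow_half_sq w
  have h3 : w ^ (1 / 2 : ℂ) ≠ 0 := fun h => by rw [h] at h2; exact hw0 (by simpa using h2.symm)
  field_simp
  rw [h2]

lemma isBranch_kres (β : ℝ) : IsBranch (cutPlane β) (kres β) where
  isOpen := isOpen_cutPlane β
  differentiableAt z hz σ := by
    fin_cases σ
    · exact (hasDerivAt_cpow_half (sub_mem_of_mem_cutPlane hz)).differentiableAt.comp z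
        (differentiableAt_id.const_sub _)
    · exact ((hasDerivAt_cpow_half (add_mem_of_mem_cutPlane hz)).differentiableAt.comp z
        (differentiableAt_id.add_const _)).const_mul _
  mem z hz σ := by
    fin_cases σ
    · exact re_pos_mem_slitPlane (cpow_half_re_pos (sub_mem_of_mem_cutPlane hz))
    · exact mem_slitPlane_of_im_neg (kres_one_im (add_mem_of_mem_cutPlane hz))

lemma eq_of_sq_eq_of_re_pos {a b : ℂ} (h : a ^ 2 = b ^ 2) (ha : 0 < a.re) (hb : 0 < b.re) :
    a = b := by
  rcases sq_eq_sq_iff_eq_or_eq_neg.1 h with h | h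
  · exact h
  · rw [h, Complex.neg_re] at ha; linarith

lemma cpow_half_im_pos {z : ℂ} (hz : 0 < z.im) : 0 < (z ^ (1 / 2 : ℂ)).im := by
  rw [cpow_half_im z (fun h => by rw [h] at hz; simp at hz)]
  have h1 : 0 < z.arg := lt_of_le_of_ne (Complex.arg_nonneg_iff.2 hz.le) fun h => by
    have := Complex.arg_eq_zero_iff.1 h.symm
    linarith [this.2]
  exact mul_pos (Real.exp_pos _) (Real.sin_pos_of_pos_of_lt_pi (by linarith)
    (by linarith [Complex.arg_le_pi z, Real.pi_pos]))

/-- Above the real axis, opening a channel does not change the square root. -/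
lemma neg_I_mul_cpow_half {w : ℂ} (hw : 0 < w.im) :
    -Complex.I * w ^ (1 / 2 : ℂ) = (-w) ^ (1 / 2 : ℂ) := by
  refine eq_of_sq_eq_of_re_pos ?_ ?_ (cpow_half_re_pos ?_)
  · rw [mul_pow, cpow_half_sq, cpow_half_sq, neg_sq, Complex.I_sq]; ring
  · simpa using cpow_half_im_pos hw
  · exact Complex.mem_slitPlane_iff.2 (Or.inr (by simpa using hw.ne'))

lemma kres_eq_kap {β : ℝ} {z : ℂ} (hz : 0 < z.im) : kres β z = kap β z := by
  have h0 : sgn 0 = 1 := rfl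
  have h1 : sgn 1 = -1 := rfl
  ext σ
  fin_cases σ
  · simp [kres, kap, h0]
  · have h2 := neg_I_mul_cpow_half (w := z + β) (by simpa using hz)
    simp only [kres, kap, h1, Fin.mk_one, Matrix.cons_val_one, Matrix.cons_val_fin_one]
    rw [h2]
    congr 1
    push_cast
    ring

lemma kdet_kres_ne_zero [LowDim d] {β α ε : ℝ} (hε : 0 < ε) {z : ℂ} (hz : z ∈ cutPlane β)
    (hi : 0 ≤ z.im) : kdet d α ε (kres β z) ≠ 0 := by
  have h0 : (α + nfun d (kres β z 0)).im ≤ 0 := by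
    have h1 : (kres β z 0).im ≤ 0 :=
      cpow_half_im_nonpos (sub_mem_of_mem_cutPlane hz) (by simpa using hi)
    simpa using nfun_im_nonpos (d := d) ((isBranch_kres β).mem z hz 0) h1
  have h1 : (α + nfun d (kres β z 1)).im < 0 := by
    simpa using nfun_im_neg (d := d) (kres_one_im (add_mem_of_mem_cutPlane hz))
  exact mul_ne_sq_of_im hε h0 h1

/-- Krein's formula on the second sheet continues the resolvent. -/
lemma isResolventContinuation_cutKrein [LowDim d] (β α : ℝ) {ε : ℝ} (hε : 0 < ε) (r : ℝ) :
    IsResolventContinuation (hamiltonian d β α ε) β r (fun z => cutKrein d α ε r (kres β z)) := by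
  refine ⟨fun z hz => (isBranch_kres β).meromorphicAt α ε r hz, fun z hz hi =>
    (isBranch_kres β).analyticAt_cutKrein r hz (kdet_kres_ne_zero hε hz hi), fun z hz => ?_⟩
  refine ⟨_, isResolventAt_kreinOp (.of_im hz.ne') (kdet_ne_zero_of_im_pos hε hz), fun Ψ => ?_⟩
  rw [cutoff_kreinOp (.of_im hz.ne'), ← kres_eq_kap hz]

end Continuation

/-! ### The limiting absorption principle -/

section LimitingAbsorption

variable {d : ℕ}

lemma inner_cutL (r : ℝ) (u v : L2 d) : inner ℂ (cutL r u) v = inner ℂ u (cutL r v) := by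
  rw [L2.inner_def, L2.inner_def]
  refine integral_congr_ae ?_
  filter_upwards [cutL_ae_eq r u, cutL_ae_eq r v] with x h1 h2
  rw [h1, h2]
  by_cases hx : x ∈ Metric.ball 0 r
  · rw [Set.indicator_of_mem hx, Set.indicator_of_mem hx]
  · rw [Set.indicator_of_notMem hx, Set.indicator_of_notMem hx, inner_zero_left, inner_zero_right]

lemma cutL_cutL_of_le {r s : ℝ} (h : r ≤ s) (u : L2 d) : cutL s (cutL r u) = cutL r u := by
  refine Lp.ext ?_
  filter_upwards [cutL_ae_eq r u, cutL_ae_eq s (cutL r u)] with x h1 h2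
  rw [h2]
  by_cases hx : x ∈ Metric.ball 0 s
  · rw [Set.indicator_of_mem hx]
  · rw [Set.indicator_of_notMem hx, h1,
      Set.indicator_of_notMem fun h' => hx (Metric.ball_subset_ball h h')]

lemma inner_cutoff (r : ℝ) (Φ Ψ : State d) :
    inner ℂ (cutoff r Φ) Ψ = inner ℂ Φ (cutoff r Ψ) := by
  simp only [PiLp.inner_apply, cutoff_apply, inner_cutL]

lemma eq_zero_of_cutL_eq_zero {u : L2 d} (h : ∀ r : ℝ, 0 < r → cutL r u = 0) : u = 0 := by
  have h1 : ∀ n : ℕ, ∀ᵐ x, x ∈ Metric.ball (0 : EuclideanSpace ℝ (Fin d)) (n + 1) → u x = 0 := by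
    intro n
    have h2 := cutL_ae_eq ((n : ℝ) + 1) u
    rw [h _ (by positivity)] at h2
    filter_upwards [h2, Lp.coeFn_zero ℂ 2 (volume : Measure (EuclideanSpace ℝ (Fin d)))]
      with x a1 a2 hx
    rw [a2, Set.indicator_of_mem hx] at a1
    exact a1.symm
  refine Lp.ext ?_
  filter_upwards [ae_all_iff.2 h1, Lp.coeFn_zero ℂ 2 (volume : Measure (EuclideanSpace ℝ (Fin d)))]
    with x a1 a2
  obtain ⟨n, hn⟩ := exists_nat_gt ‖x‖
  rw [a2, a1 n (mem_ball_zero_iff.2 (by linarith)), Pi.zero_apply]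

/-- States of bounded support. -/
def boundedSupport (d : ℕ) : Submodule ℂ (State d) where
  carrier := {Ψ | ∃ r : ℝ, 0 < r ∧ cutoff r Ψ = Ψ}
  zero_mem' := ⟨1, one_pos, by ext σ : 1; rw [cutoff_apply, PiLp.zero_apply, map_zero]⟩
  smul_mem' := by
    rintro c Ψ ⟨r, hr, h⟩
    refine ⟨r, hr, ?_⟩
    ext σ : 1
    rw [cutoff_apply, PiLp.smul_apply, map_smul, ← cutoff_apply, h]
  add_mem' := by
    have key : ∀ {r s : ℝ} {Ψ : State d}, r ≤ s → cutoff r Ψ = Ψ → cutoff s Ψ = Ψ := by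
      intro r s Ψ hrs h
      ext σ : 1
      rw [← h, cutoff_apply, cutoff_apply, cutL_cutL_of_le hrs]
    rintro Φ Ψ ⟨r, hr, h⟩ ⟨s, hs, h'⟩
    refine ⟨max r s, lt_max_of_lt_left hr, ?_⟩
    ext σ : 1
    rw [cutoff_apply, PiLp.add_apply, map_add, ← cutoff_apply, ← cutoff_apply,
      key (le_max_left r s) h, key (le_max_right r s) h']

lemma dense_boundedSupport : Dense (boundedSupport d : Set (State d)) := by
  rw [Submodule.dense_iff_topologicalClosure_eq_top, Submodule.topologicalClosure_eq_top_iff,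
    Submodule.eq_bot_iff]
  intro Ψ hΨ
  ext σ : 1
  refine eq_zero_of_cutL_eq_zero fun r hr => ?_
  have hcc : ∀ Φ : State d, cutoff r (cutoff r Φ) = cutoff r Φ := fun Φ => by
    ext τ : 1
    rw [cutoff_apply, cutoff_apply, cutL_cutL_of_le le_rfl]
  have h1 : inner ℂ (cutoff r Ψ) Ψ = 0 :=
    (Submodule.mem_orthogonal _ _).1 hΨ _ ⟨r, hr, hcc Ψ⟩
  rw [← hcc, inner_cutoff, inner_self_eq_zero] at h1
  rw [← cutoff_apply, h1, PiLp.zero_apply]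

/-- At a real energy away from the thresholds, the square roots continue from above, channel by
channel: with a negative imaginary part in the open channels. -/
lemma exists_isBranch {β y : ℝ} (h1 : y ≠ β) (h2 : y ≠ -β) : ∃ U k, IsBranch U k ∧ (y : ℂ) ∈ U ∧
    (∀ z : ℂ, 0 < z.im → k z = kap β z) ∧
    ∀ σ, (y < β * sgn σ → k y σ = kap β y σ) ∧ (β * sgn σ < y → (k y σ).im < 0) := by
  have hne : ∀ σ, y ≠ β * sgn σ := by
    intro σ
    fin_cases σ
    · simpa [sgn] using h1
    · simpa [sgn] using h2
  let w : Fin 2 → ℂ → ℂ := fun σ z =>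
    if y < β * sgn σ then (β * sgn σ : ℝ) - z else z - (β * sgn σ : ℝ)
  have hw : ∀ σ, Differentiable ℂ (w σ) := by
    intro σ
    by_cases h : y < β * sgn σ
    · simp only [w, if_pos h]; fun_prop
    · simp only [w, if_neg h]; fun_prop
  let k : ℂ → Fin 2 → ℂ := fun z σ =>
    (if y < β * sgn σ then 1 else -Complex.I) * w σ z ^ (1 / 2 : ℂ)
  have hkre : ∀ σ z, y < β * sgn σ → k z σ = kap β z σ := by
    intro σ z h
    simp only [k, w, if_pos h, one_mul, kap]
  have hkim : ∀ σ z, ¬ y < β * sgn σ → k z σ = -Complex.I * (z - (β * sgn σ : ℝ)) ^ (1 / 2 : ℂ) := by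
    intro σ z h
    simp only [k, w, if_neg h]
  have hneg : ∀ σ z, w σ z ∈ Complex.slitPlane → ¬ y < β * sgn σ → (k z σ).im < 0 := by
    intro σ z hz h
    rw [hkim σ z h]
    simp only [w, if_neg h] at hz
    simpa using cpow_half_re_pos hz
  refine ⟨{z | ∀ σ, w σ z ∈ Complex.slitPlane}, k, ⟨?_, ?_, ?_⟩, ?_, ?_, ?_⟩
  · have : {z | ∀ σ, w σ z ∈ Complex.slitPlane} = ⋂ σ, w σ ⁻¹' Complex.slitPlane := by
      ext z; simp
    rw [this]
    exact isOpen_iInter_of_finite fun σ => Complex.isOpen_slitPlane.preimage (hw σ).continuous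
  · intro z hz σ
    exact ((hasDerivAt_cpow_half (hz σ)).differentiableAt.fun_comp' z (hw σ z)).const_mul _
  · intro z hz σ
    by_cases h : y < β * sgn σ
    · rw [hkre σ z h]
      have hz' := hz σ
      simp only [w, if_pos h] at hz'
      exact re_pos_mem_slitPlane (cpow_half_re_pos hz')
    · exact mem_slitPlane_of_im_neg (hneg σ z (hz σ) h)
  · intro σ
    by_cases h : y < β * sgn σ
    · simp only [w, if_pos h]
      exact Complex.mem_slitPlane_iff.2 (Or.inl (by
        rw [← Complex.ofReal_sub, Complex.ofReal_re]; linarith))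
    · simp only [w, if_neg h]
      have := lt_of_le_of_ne (not_lt.1 h) (hne σ).symm
      exact Complex.mem_slitPlane_iff.2 (Or.inl (by
        rw [← Complex.ofReal_sub, Complex.ofReal_re]; linarith))
  · intro z hz
    ext σ
    by_cases h : y < β * sgn σ
    · exact hkre σ z h
    · rw [hkim σ z h, neg_I_mul_cpow_half (by simpa using hz), kap, neg_sub]
  · intro σ
    refine ⟨hkre σ y, fun h => hneg σ y ?_ (not_lt.2 h.le)⟩
    simp only [w, if_neg (not_lt.2 h.le)]
    exact Complex.mem_slitPlane_iff.2 (Or.inl (by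
      rw [← Complex.ofReal_sub, Complex.ofReal_re]; linarith))

lemma kap_im_of_lt {β y : ℝ} {σ : Fin 2} (h : y < β * sgn σ) :
    kap β y σ ∈ Complex.slitPlane ∧ (kap β y σ).im ≤ 0 := by
  have hm : ((β * sgn σ : ℝ) : ℂ) - (y : ℂ) ∈ Complex.slitPlane :=
    Complex.mem_slitPlane_iff.2 (Or.inl (by
      rw [← Complex.ofReal_sub, Complex.ofReal_re]; linarith))
  exact ⟨re_pos_mem_slitPlane (cpow_half_re_pos hm), cpow_half_im_nonpos hm (by simp)⟩

/-- The limiting absorption principle: on states of bounded support, the resolvent form stays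
bounded on approach to the real axis from above, away from the thresholds and the eigenvalues. -/
lemma exists_bound_inner_resolvent [LowDim d] {β α ε y : ℝ} (hβ : 0 < β) (hε : 0 < ε) (h1 : y ≠ β)
    (h2 : y ≠ -β) (h3 : y < -β → kdet d α ε (kap β y) ≠ 0) {ψ : State d}
    (hψ : ψ ∈ boundedSupport d) :
    ∃ C : ℝ, ∀ᶠ η : ℝ in 𝓝[>] 0, ∀ R, IsResolventAt (hamiltonian d β α ε) (y + Complex.I * η) R →
      (inner ℂ ψ (R ψ)).im ≤ C := by
  obtain ⟨r, hr, hrψ⟩ := hψ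
  obtain ⟨U, k, hU, hy, hk, hkσ⟩ := exists_isBranch h1 h2
  have hs0 : sgn 0 = 1 := rfl
  have hs1 : sgn 1 = -1 := rfl
  have hD : kdet d α ε (k y) ≠ 0 := by
    rcases lt_or_gt_of_ne h2 with h | h
    · have h0 : k y = kap β y := by
        ext σ
        refine (hkσ σ).1 ?_
        fin_cases σ
        · simp only [Fin.zero_eta, hs0]; linarith
        · simp only [Fin.mk_one, hs1]; linarith
      rw [h0]
      exact h3 h
    -- the lower channel is open
    · have hb : (α + nfun d (k y 1)).im < 0 := by
        simpa using nfun_im_neg (d := d) ((hkσ 1).2 (by rw [hs1]; linarith))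
      have ha : (α + nfun d (k y 0)).im ≤ 0 := by
        rcases lt_or_gt_of_ne h1 with h' | h'
        · have h4 : y < β * sgn 0 := by rw [hs0]; linarith
          rw [(hkσ 0).1 h4]
          simpa using nfun_im_nonpos (d := d) (kap_im_of_lt h4).1 (kap_im_of_lt h4).2
        · have h5 := nfun_im_neg (d := d) ((hkσ 0).2 (by rw [hs0]; linarith))
          simpa using h5.le
      exact mul_ne_sq_of_im hε ha hb
  have hcont : Tendsto (fun η : ℝ => (inner ℂ ψ (cutKrein d α ε r (k (y + Complex.I * η)) ψ)).im)
      (𝓝[>] 0) (𝓝 (inner ℂ ψ (cutKrein d α ε r (k y) ψ)).im) := by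
    have hc := (hU.analyticAt_cutKrein r hy hD).continuousAt
    have hl : Tendsto (fun η : ℝ => (y : ℂ) + Complex.I * η) (𝓝[>] 0) (𝓝 y) := by
      have : Continuous fun η : ℝ => (y : ℂ) + Complex.I * η := by fun_prop
      have h := this.tendsto 0
      simp only [Complex.ofReal_zero, mul_zero, add_zero] at h
      exact h.mono_left nhdsWithin_le_nhds
    have h6 : Tendsto (fun η : ℝ => cutKrein d α ε r (k (y + Complex.I * η)) ψ) (𝓝[>] 0)
        (𝓝 (cutKrein d α ε r (k y) ψ)) :=
      (((ContinuousLinearMap.apply ℂ (State d) ψ).continuous.tendsto _).comp hc).comp hl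
    exact (Complex.continuous_im.tendsto _).comp (tendsto_const_nhds.inner h6)
  refine ⟨(inner ℂ ψ (cutKrein d α ε r (k y) ψ)).im + 1, ?_⟩
  filter_upwards [hcont.eventually_lt_const (lt_add_one _), self_mem_nhdsWithin] with η hη hη0 R hR
  have him : 0 < ((y : ℂ) + Complex.I * η).im := by simpa using hη0
  have hcl := IsClosedAt.of_im (β := β) him.ne'
  rw [hR.unique (isResolventAt_kreinOp hcl (kdet_ne_zero_of_im_pos hε him))]
  refine le_trans (le_of_eq ?_) hη.le
  rw [hk _ him, ← cutoff_kreinOp hcl, ← inner_cutoff, hrψ]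

end LimitingAbsorption

/-! ### Bound states -/

section BoundState

variable {d : ℕ}

/-- The function `nfun` on the positive half-line. -/
def nReal (d : ℕ) (s : ℝ) : ℝ :=
  match d with
  | 1 => 2 * s
  | 2 => (Real.log (s / 2) + Real.eulerMascheroniConstant) / (2 * Real.pi)
  | _ => s / (4 * Real.pi)

lemma nfun_ofReal [hd : LowDim d] {s : ℝ} (hs : 0 < s) : nfun d s = nReal d s := by
  rcases hd.cases with rfl | rfl | rfl
  · simp [nfun, nReal]
  · have h : Complex.log ((s : ℂ) / 2) = (Real.log (s / 2) : ℝ) := by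
      rw [Complex.ofReal_log (by positivity)]; push_cast; rfl
    simp only [nfun, greg, nReal, h]
    push_cast
    ring
  · simp only [nfun, greg, nReal]
    push_cast
    ring

lemma strictMonoOn_nReal [hd : LowDim d] : StrictMonoOn (nReal d) (Set.Ioi 0) := by
  have hpi := Real.pi_pos
  intro s hs t ht hst
  simp only [Set.mem_Ioi] at hs ht
  rcases hd.cases with rfl | rfl | rfl
  · simp only [nReal]; linarith
  · have := Real.log_lt_log (half_pos hs) ((div_lt_div_iff_of_pos_right two_pos).2 hst)
    simp only [nReal]
    gcongr
  · simp only [nReal]; gcongr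

lemma continuousOn_nReal [hd : LowDim d] : ContinuousOn (nReal d) (Set.Ioi 0) := by
  rcases hd.cases with rfl | rfl | rfl
  · exact (continuous_const.mul continuous_id).continuousOn
  · refine ContinuousOn.div_const (ContinuousOn.add ?_ continuousOn_const) _
    exact ContinuousOn.log (by fun_prop) fun s hs => (half_pos hs).ne'
  · exact (continuous_id.div_const _).continuousOn

lemma tendsto_nReal_atTop [hd : LowDim d] : Tendsto (nReal d) atTop atTop := by
  have hpi := Real.pi_pos
  rcases hd.cases with rfl | rfl | rfl
  · exact tendsto_id.const_mul_atTop two_pos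
  · exact (tendsto_atTop_add_const_right _ _ (Real.tendsto_log_atTop.comp
      (tendsto_id.atTop_div_const two_pos))).atTop_div_const (by positivity)
  · exact tendsto_id.atTop_div_const (by positivity)

lemma cpow_half_ofReal {t : ℝ} (ht : 0 ≤ t) : (t : ℂ) ^ (1 / 2 : ℂ) = (√t : ℝ) := by
  rw [Real.sqrt_eq_rpow, Complex.ofReal_cpow ht]
  norm_num

lemma kap_ofReal {β E : ℝ} (σ : Fin 2) (h : E < β * sgn σ) :
    kap β E σ = (√(β * sgn σ - E) : ℝ) := by
  rw [kap, ← Complex.ofReal_sub, cpow_half_ofReal (by linarith)]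

lemma kdet_kap_ofReal [LowDim d] {β E : ℝ} (α ε : ℝ) (hβ : 0 < β) (hE : E < -β) :
    kdet d α ε (kap β E) =
      (((α + nReal d √(β - E)) * (α + nReal d √(-β - E)) - ε ^ 2 : ℝ) : ℂ) := by
  have h0 : sgn 0 = 1 := rfl
  have h1 : sgn 1 = -1 := rfl
  rw [kdet, kap_ofReal 0 (by rw [h0]; linarith), kap_ofReal 1 (by rw [h1]; linarith), h0, h1,
    nfun_ofReal (Real.sqrt_pos.2 (by linarith)), nfun_ofReal (Real.sqrt_pos.2 (by linarith)),
    mul_one, mul_neg_one]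
  push_cast
  ring

/-- Below the essential spectrum the determinant has exactly one zero, if the single point
interaction has a bound state `-s²` with `s² < 2β`: there the first factor is positive, and both
factors are decreasing in the energy. -/
lemma existsUnique_kdet_eq_zero [LowDim d] {β α ε s : ℝ} (hβ : 0 < β) (hε : 0 < ε) (hs : 0 < s)
    (hs2 : s ^ 2 < 2 * β) (hn : nReal d s = -α) :
    ∃ E : ℝ, E < -β ∧ ∀ E' : ℝ, E' < -β → (kdet d α ε (kap β E') = 0 ↔ E' = E) := by
  have hmono := strictMonoOn_nReal (d := d)
  -- the determinant at the energy `-β - t²` is `p t - ε ^ 2`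
  let p : ℝ → ℝ := fun t => (α + nReal d √(t ^ 2 + 2 * β)) * (α + nReal d t)
  have hpos : ∀ t : ℝ, 0 < t → 0 < α + nReal d √(t ^ 2 + 2 * β) := by
    intro t ht
    have h1 : s < √(t ^ 2 + 2 * β) := Real.lt_sqrt_of_sq_lt (by nlinarith)
    have := hmono hs (hs.trans h1) h1
    linarith
  obtain ⟨S, hSs, hS⟩ : ∃ S, s ≤ S ∧ ε - α ≤ nReal d S :=
    ((eventually_ge_atTop s).and (tendsto_nReal_atTop.eventually_ge_atTop (ε - α))).exists
  have hS0 : 0 < S := hs.trans_le hSs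
  have hcont : ContinuousOn p (Set.Icc s S) := by
    have hsub : Set.Icc s S ⊆ Set.Ioi 0 := fun t ht => hs.trans_le ht.1
    refine ContinuousOn.mul (continuousOn_const.add ?_)
      (continuousOn_const.add (continuousOn_nReal.mono hsub))
    exact continuousOn_nReal.comp (by fun_prop) fun t _ => Real.sqrt_pos.2 (by positivity)
  have hp0 : p s = 0 := by simp [p, hn]
  have hpS : ε ^ 2 ≤ p S := by
    have h1 : S ≤ √(S ^ 2 + 2 * β) := Real.le_sqrt_of_sq_le (by linarith)
    have h2 := hmono.monotoneOn hS0 (hS0.trans_le h1) h1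
    have h3 : ε ≤ α + nReal d √(S ^ 2 + 2 * β) := by linarith
    have h4 : ε ≤ α + nReal d S := by linarith
    calc ε ^ 2 = ε * ε := sq ε
      _ ≤ p S := mul_le_mul h3 h4 hε.le (hε.le.trans h3)
  obtain ⟨t₀, ht₀, hpt₀⟩ := intermediate_value_Icc hSs hcont
    (show ε ^ 2 ∈ Set.Icc (p s) (p S) from ⟨by rw [hp0]; positivity, hpS⟩)
  have ht₀' : 0 < t₀ := hs.trans_le ht₀.1
  have huniq : ∀ t t' : ℝ, 0 < t → t < t' → p t = ε ^ 2 → p t' ≠ ε ^ 2 := by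
    intro t t' ht htt h h'
    have h1 : 0 < α + nReal d t := by
      refine (mul_pos_iff_of_pos_left (hpos t ht)).1 ?_
      rw [show _ * _ = ε ^ 2 from h]; positivity
    have h2 := hmono ht (ht.trans htt) htt
    have h3 : √(t ^ 2 + 2 * β) < √(t' ^ 2 + 2 * β) := by
      refine Real.sqrt_lt_sqrt (by positivity) ?_
      have := pow_lt_pow_left₀ htt ht.le two_ne_zero
      linarith
    have h4 := hmono (Real.sqrt_pos.2 (by positivity)) (Real.sqrt_pos.2 (by positivity)) h3
    have h5 : p t < p t' := mul_lt_mul'' (by linarith) (by linarith) (hpos t ht).le h1.le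
    linarith
  refine ⟨-β - t₀ ^ 2, by nlinarith, fun E' hE' => ?_⟩
  set t := √(-β - E') with ht
  have ht0 : 0 < t := Real.sqrt_pos.2 (by linarith)
  have htsq : t ^ 2 = -β - E' := Real.sq_sqrt (by linarith)
  have h1 : kdet d α ε (kap β E') = ((p t - ε ^ 2 : ℝ) : ℂ) := by
    rw [kdet_kap_ofReal α ε hβ hE', ← ht, show β - E' = t ^ 2 + 2 * β by linarith]
  rw [h1, Complex.ofReal_eq_zero, sub_eq_zero]
  constructor
  · intro h
    have : t = t₀ := by
      rcases lt_trichotomy t t₀ with h' | h' | h'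
      · exact absurd hpt₀ (huniq _ _ ht0 h' h)
      · exact h'
      · exact absurd h (huniq _ _ ht₀' h' hpt₀)
    rw [← this]; linarith
  · intro h
    have : t = t₀ := by
      refine (sq_eq_sq₀ ht0.le ht₀'.le).1 ?_
      linarith
    rw [this, hpt₀]

/-- The bound state `-s²` of the single point interaction of strength `α`. -/
lemma exists_boundState {β α : ℝ}
    (hparam : (d = 1 ∧ -2 * √(2 * β) < α ∧ α < 0) ∨ (d = 2 ∧ 1 < 2 * β * muConst α) ∨
      (d = 3 ∧ -√(2 * β) / (4 * Real.pi) < α ∧ α < 0)) :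
    ∃ s : ℝ, 0 < s ∧ s ^ 2 < 2 * β ∧ nReal d s = -α ∧ upperEigenvalue d β α = β - s ^ 2 := by
  have hpi := Real.pi_pos
  have hsq : ∀ s : ℝ, 0 < s → s < √(2 * β) → s ^ 2 < 2 * β := fun s hs h =>
    (Real.lt_sqrt hs.le).1 h
  rcases hparam with ⟨rfl, h1, h2⟩ | ⟨rfl, h1⟩ | ⟨rfl, h1, h2⟩
  · refine ⟨-α / 2, by linarith, hsq _ (by linarith) (by linarith), ?_, ?_⟩
    · simp only [nReal]; ring
    · simp only [upperEigenvalue]; ring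
  · set c := Real.eulerMascheroniConstant + 2 * Real.pi * α with hc
    have hmu : muConst α = Real.exp c ^ 2 / 4 := by
      rw [muConst, ← hc, ← Real.exp_nat_mul]; norm_num
    have hs2 : (2 * Real.exp (-c)) ^ 2 = 1 / muConst α := by
      rw [hmu, Real.exp_neg]
      field_simp
      norm_num
    refine ⟨2 * Real.exp (-c), by positivity, ?_, ?_, ?_⟩
    · have hmu0 : 0 < muConst α := by rw [hmu]; positivity
      rw [hs2, div_lt_iff₀ hmu0]
      exact h1
    · simp only [nReal]
      rw [mul_div_cancel_left₀ _ two_ne_zero, Real.log_exp, hc]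
      field_simp
      ring
    · simp only [upperEigenvalue, hs2]
  · have h3 : -√(2 * β) < α * (4 * Real.pi) := (div_lt_iff₀ (by positivity)).1 h1
    have h4 : 0 < -(4 * Real.pi * α) := by nlinarith
    refine ⟨-(4 * Real.pi * α), h4, hsq _ h4 (by linarith), ?_, ?_⟩
    · simp only [nReal]; field_simp
    · simp only [upperEigenvalue]; ring

end BoundState

/-! ### The spectrum of the Hamiltonian -/

section Spectrum

variable {d : ℕ} {β α ε E : ℝ}

lemma isClosedAt_of_ofReal_notMem (hβ : 0 < β) {z : ℂ}
    (hz : z ∉ Complex.ofReal '' Set.Ici (-β)) : IsClosedAt β z := by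
  by_cases him : z.im = 0
  · obtain ⟨t, rfl⟩ : ∃ t : ℝ, (t : ℂ) = z := ⟨z.re, Complex.ext rfl him.symm⟩
    exact .of_lt hβ (not_le.1 fun h => hz ⟨t, h, rfl⟩)
  · exact .of_im him

lemma opSpectrum_hamiltonian [LowDim d] (hβ : 0 < β) (hε : 0 < ε) (hE : E < -β)
    (huniq : ∀ E' : ℝ, E' < -β → (kdet d α ε (kap β E') = 0 ↔ E' = E)) :
    opSpectrum (hamiltonian d β α ε) = insert (E : ℂ) (Complex.ofReal '' Set.Ici (-β)) := by
  ext z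
  constructor
  · intro hz
    by_contra hn
    rw [Set.mem_insert_iff, not_or] at hn
    have hcl := isClosedAt_of_ofReal_notMem hβ hn.2
    refine hz ⟨_, isResolventAt_kreinOp hcl ?_⟩
    by_cases him : z.im = 0
    · obtain ⟨t, rfl⟩ : ∃ t : ℝ, (t : ℂ) = z := ⟨z.re, Complex.ext rfl him.symm⟩
      have ht : t < -β := not_le.1 fun h => hn.2 ⟨t, h, rfl⟩
      exact fun h => hn.1 (congrArg _ ((huniq t ht).1 h))
    · exact kdet_ne_zero_of_im hε him
  · rintro (rfl | ⟨t, ht, rfl⟩)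
    · exact pointSpectrum_subset_opSpectrum _
        (mem_pointSpectrum_of_kdet hβ hε hE ((huniq E hE).2 rfl))
    · refine mem_opSpectrum_of_approx fun η hη => ?_
      obtain ⟨u, v, hu, huv, -, -, h⟩ := exists_weyl_vector (d := d) (α := α) (ε := ε) hβ hE ht hη
      exact ⟨u, v, hu, huv, h⟩

lemma pointSpectrum_hamiltonian [LowDim d] (hβ : 0 < β) (hε : 0 < ε) (hE : E < -β)
    (huniq : ∀ E' : ℝ, E' < -β → (kdet d α ε (kap β E') = 0 ↔ E' = E)) :
    pointSpectrum (hamiltonian d β α ε) = {(E : ℂ)} := by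
  refine Set.Subset.antisymm (fun z hz => ?_) ?_
  · have h := pointSpectrum_subset_opSpectrum _ hz
    rw [opSpectrum_hamiltonian hβ hε hE huniq] at h
    rcases h with h | ⟨t, ht, rfl⟩
    · exact h
    · exact absurd hz (notMem_pointSpectrum_of_le hε ht)
  · rintro z rfl
    exact mem_pointSpectrum_of_kdet hβ hε hE ((huniq E hE).2 rfl)

lemma spectral_types_hamiltonian [LowDim d] (hβ : 0 < β) (hε : 0 < ε) (hE : E < -β)
    (huniq : ∀ E' : ℝ, E' < -β → (kdet d α ε (kap β E') = 0 ↔ E' = E)) :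
    essentialSpectrum (hamiltonian d β α ε) = Complex.ofReal '' Set.Ici (-β) ∧
      acSpectrum (hamiltonian d β α ε) = Complex.ofReal '' Set.Ici (-β) ∧
      scSpectrum (hamiltonian d β α ε) = ∅ := by
  have hT : IsResolventAt (hamiltonian d β α ε) ((E - 1 : ℝ) : ℂ)
      (kreinOp d β α ε ((E - 1 : ℝ) : ℂ)) := by
    refine isResolventAt_kreinOp (.of_lt hβ (by linarith)) fun h => ?_
    have := (huniq (E - 1) (by linarith)).1 h
    linarith
  refine spectral_types (isSelfAdjoint_hamiltonian β α hε) (by linarith : E - 1 ≠ E) hT ?_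
    (opSpectrum_hamiltonian hβ hε hE huniq) (δ := -β - E) (by linarith) ?_
    (pointSpectrum_hamiltonian hβ hε hE huniq) (finiteDimensional_eigenKer hβ hE)
    (Z := {β, -β, E}) (Set.toFinite _).countable ?_ ?_
  · rintro z ⟨t, -, rfl⟩
    exact Complex.ofReal_im t
  · rintro z ⟨t, ht, rfl⟩
    rw [Complex.dist_of_im_eq (by simp), Real.dist_eq, Complex.ofReal_re, Complex.ofReal_re]
    refine le_trans ?_ (le_abs_self _)
    simp only [Set.mem_Ici] at ht
    linarith
  · refine dense_boundedSupport.mono fun ψ hψ y hy => ?_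
    simp only [Set.mem_compl_iff, Set.mem_insert_iff, Set.mem_singleton_iff, not_or] at hy
    exact exists_bound_inner_resolvent hβ hε hy.1 hy.2.1
      (fun h h' => hy.2.2 ((huniq y h).1 h')) hψ
  · rintro z ⟨t, ht, rfl⟩ η hη
    exact exists_weyl_vector hβ hE ht hη

end Spectrum

/-! ### The resonance -/

section Resonance

variable {d : ℕ}

lemma hasDerivAt_nfun_ne_zero [hd : LowDim d] {κ : ℂ} (hκ : κ ∈ Complex.slitPlane) :
    ∃ n', n' ≠ 0 ∧ HasDerivAt (nfun d) n' κ := by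
  have hpi : (Real.pi : ℂ) ≠ 0 := Complex.ofReal_ne_zero.2 Real.pi_ne_zero
  have hκ0 := Complex.slitPlane_ne_zero hκ
  rcases hd.cases with rfl | rfl | rfl
  · exact ⟨2 * 1, by norm_num, (hasDerivAt_id κ).const_mul 2⟩
  · have h1 : κ / 2 ∈ Complex.slitPlane := by
      have : κ / 2 = ((1 / 2 : ℝ) : ℂ) * κ := by push_cast; ring
      rw [this, mul_comm]
      exact mem_slitPlane_mul_pos hκ (by norm_num)
    have h2 : HasDerivAt (fun κ : ℂ => Complex.log (κ / 2)) (1 / 2 / (κ / 2)) κ :=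
      ((hasDerivAt_id κ).div_const 2).clog h1
    refine ⟨_, ?_, ((h2.add_const _).neg.div_const _).neg⟩
    rw [← neg_div, neg_neg]
    exact div_ne_zero (div_ne_zero (by norm_num) (div_ne_zero hκ0 two_ne_zero))
      (mul_ne_zero two_ne_zero hpi)
  · exact ⟨_, by simp [hpi], ((hasDerivAt_id κ).neg.div_const _).neg⟩

/-- For small `ε` the continued determinant has a simple zero within `O(ε²)` of the upper
eigenvalue `β - s²` of the decoupled system, by the inverse function theorem. -/
lemma exists_resonance [LowDim d] {β α s : ℝ} (hs : 0 < s) (hs2 : s ^ 2 < 2 * β)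
    (hn : nReal d s = -α) : ∃ ε₀ : ℝ, 0 < ε₀ ∧ ∃ C : ℝ, 0 < C ∧ ∀ ε : ℝ, 0 < ε → ε < ε₀ →
      ∃ z ∈ cutPlane β, kdet d α ε (kres β z) = 0 ∧
        deriv (fun z => kdet d α ε (kres β z)) z ≠ 0 ∧
        ‖z - ((β - s ^ 2 : ℝ) : ℂ)‖ ≤ C * ε ^ 2 := by
  set E₀ : ℂ := ((β - s ^ 2 : ℝ) : ℂ) with hE₀
  -- `h` is the determinant for `ε = 0`, and zeros of the determinant are solutions of `h z = ε²`
  let h : ℂ → ℂ := fun z => kdet d α 0 (kres β z)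
  have hkd : ∀ ε : ℝ, (fun z => kdet d α ε (kres β z)) = fun z => h z - (ε : ℂ) ^ 2 := by
    intro ε; funext z; simp [h, kdet]
  have hmem : E₀ ∈ cutPlane β := by
    right
    rw [hE₀, Complex.ofReal_re, abs_lt]
    constructor <;> nlinarith
  have hbr := isBranch_kres β
  have hk0 : kres β E₀ 0 = (s : ℂ) := by
    have : (β : ℂ) - E₀ = ((s ^ 2 : ℝ) : ℂ) := by rw [hE₀]; push_cast; ring
    simp only [kres, Matrix.cons_val_zero]
    rw [this, cpow_half_ofReal (by positivity), Real.sqrt_sq hs.le]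
  -- at the upper eigenvalue the factor of the upper channel vanishes, and that of the open lower
  -- channel does not
  have hN0 : (α : ℂ) + nfun d (kres β E₀ 0) = 0 := by
    rw [hk0, nfun_ofReal hs, hn]; push_cast; ring
  have hN1 : (α : ℂ) + nfun d (kres β E₀ 1) ≠ 0 := by
    intro h0
    have := nfun_im_neg (d := d) (kres_one_im (add_mem_of_mem_cutPlane hmem))
    have h1 := congrArg Complex.im h0
    simp only [Complex.add_im, Complex.ofReal_im, zero_add, Complex.zero_im] at h1
    linarith
  have hh0 : h E₀ = 0 := by simp only [h, kdet, hN0]; simp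
  have hana : ∀ z ∈ cutPlane β, AnalyticAt ℂ h z := fun z hz => hbr.analyticAt_kdet α 0 hz
  have hderiv : deriv h E₀ ≠ 0 := by
    obtain ⟨n', hn', hnd⟩ := hasDerivAt_nfun_ne_zero (d := d) (hbr.mem E₀ hmem 0)
    have hkd0 : HasDerivAt (fun z => kres β z 0) (1 / (2 * kres β E₀ 0) * -1) E₀ :=
      HasDerivAt.comp (h := fun z : ℂ => (β : ℂ) - z) E₀
        (hasDerivAt_cpow_half (sub_mem_of_mem_cutPlane hmem)) ((hasDerivAt_id E₀).const_sub _)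
    have hd0 := (HasDerivAt.comp E₀ hnd hkd0).const_add (α : ℂ)
    have hd1 : DifferentiableAt ℂ (fun z => (α : ℂ) + nfun d (kres β z 1)) E₀ :=
      ((differentiableAt_nfun (hbr.mem E₀ hmem 1)).fun_comp' E₀
        (hbr.differentiableAt E₀ hmem 1)).const_add _
    have hd2 := (hd0.mul hd1.hasDerivAt).sub_const (((0 : ℝ) : ℂ) ^ 2)
    have hd3 : HasDerivAt h _ E₀ := hd2
    rw [hd3.deriv]
    simp only [Function.comp_apply, hN0, zero_mul, add_zero]
    refine mul_ne_zero (mul_ne_zero hn' (mul_ne_zero (one_div_ne_zero (mul_ne_zero two_ne_zero ?_))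
      (by norm_num))) hN1
    exact Complex.slitPlane_ne_zero (hbr.mem E₀ hmem 0)
  have hstrict : HasStrictDerivAt h (deriv h E₀) E₀ := (hana E₀ hmem).hasStrictDerivAt
  let g := hstrict.localInverse h (deriv h E₀) E₀ hderiv
  have hg : HasStrictDerivAt g (deriv h E₀)⁻¹ 0 := by
    have := hstrict.to_localInverse hderiv
    rwa [hh0] at this
  have hg0 : g 0 = E₀ := by
    have := HasStrictFDerivAt.localInverse_apply_image
      (hstrict.hasStrictFDerivAt_equiv hderiv)
    rwa [hh0] at this
  have hgr : ∀ᶠ w in 𝓝 (0 : ℂ), h (g w) = w := by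
    have := HasStrictFDerivAt.eventually_right_inverse (hstrict.hasStrictFDerivAt_equiv hderiv)
    rwa [hh0] at this
  have hgc : Tendsto g (𝓝 0) (𝓝 E₀) := by
    have := hg.hasDerivAt.continuousAt.tendsto
    rwa [hg0] at this
  obtain ⟨C, hC, hCb⟩ := (hg.hasDerivAt.isBigO_sub).exists_pos
  have hdc : ∀ᶠ z in 𝓝 E₀, deriv h z ≠ 0 :=
    (hana E₀ hmem).deriv.continuousAt.eventually_ne hderiv
  have hev : ∀ᶠ w in 𝓝 (0 : ℂ), h (g w) = w ∧ g w ∈ cutPlane β ∧ deriv h (g w) ≠ 0 ∧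
      ‖g w - E₀‖ ≤ C * ‖w‖ := by
    have hb := hCb.bound
    filter_upwards [hgr, hgc.eventually ((isOpen_cutPlane β).mem_nhds hmem), hgc.eventually hdc, hb]
      with w h1 h2 h3 h4
    rw [hg0, sub_zero] at h4
    exact ⟨h1, h2, h3, h4⟩
  have hsq : Tendsto (fun ε : ℝ => (ε : ℂ) ^ 2) (𝓝 0) (𝓝 0) := by
    have : Continuous fun ε : ℝ => (ε : ℂ) ^ 2 := by fun_prop
    simpa using this.tendsto 0
  obtain ⟨ε₀, hε₀, hball⟩ := Metric.eventually_nhds_iff.1 (hsq.eventually hev)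
  refine ⟨ε₀, hε₀, C, hC, fun ε hε hlt => ?_⟩
  obtain ⟨h1, h2, h3, h4⟩ := hball (y := ε) (by rw [Real.dist_eq, sub_zero, abs_of_pos hε]; exact hlt)
  refine ⟨g ((ε : ℂ) ^ 2), h2, ?_, ?_, ?_⟩
  · have := congrFun (hkd ε) (g ((ε : ℂ) ^ 2))
    rw [this, h1, sub_self]
  · rw [hkd ε, deriv_sub_const]
    exact h3
  · rw [norm_pow, Complex.norm_real, Real.norm_of_nonneg hε.le] at h4
    exact h4

end Resonance

end TwoChannel

end

theorem theorem3 (d : ℕ) (β α : ℝ) (hβ : 0 < β)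
    (hparam : (d = 1 ∧ -2 * √(2 * β) < α ∧ α < 0) ∨
      (d = 2 ∧ 1 < 2 * β * TwoChannel.muConst α) ∨
      (d = 3 ∧ -√(2 * β) / (4 * Real.pi) < α ∧ α < 0)) :
    ∃ ε₀ : ℝ, 0 < ε₀ ∧ ∃ C : ℝ, 0 < C ∧ ∀ ε : ℝ, 0 < ε → ε < ε₀ →
      IsSelfAdjoint (TwoChannel.hamiltonian d β α ε) ∧
      TwoChannel.essentialSpectrum (TwoChannel.hamiltonian d β α ε) =
        Complex.ofReal '' Set.Ici (-β) ∧
      TwoChannel.acSpectrum (TwoChannel.hamiltonian d β α ε) =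
        Complex.ofReal '' Set.Ici (-β) ∧
      TwoChannel.scSpectrum (TwoChannel.hamiltonian d β α ε) = ∅ ∧
      (∃ E : ℝ, E < -β ∧
        TwoChannel.pointSpectrum (TwoChannel.hamiltonian d β α ε) = {(E : ℂ)}) ∧
      ∃ Eres : ℂ, Eres.im < 0 ∧
        ‖Eres - (TwoChannel.upperEigenvalue d β α : ℂ)‖ ≤ C * ε ^ 2 ∧
        ∀ r : ℝ, 0 < r →
          ∃ F : ℂ → TwoChannel.State d →L[ℂ] TwoChannel.State d,
            TwoChannel.IsResolventContinuation
              (TwoChannel.hamiltonian d β α ε) β r F ∧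
            meromorphicOrderAt F Eres = ((-1 : ℤ) : WithTop ℤ) := by
  have : TwoChannel.LowDim d := ⟨by
    rcases hparam with h | h | h
    · exact Or.inl h.1
    · exact Or.inr (Or.inl h.1)
    · exact Or.inr (Or.inr h.1)⟩
  obtain ⟨s, hs, hs2, hn, hE₀⟩ := TwoChannel.exists_boundState hparam
  obtain ⟨ε₀, hε₀, C, hC, hres⟩ := TwoChannel.exists_resonance (d := d) hs hs2 hn
  refine ⟨ε₀, hε₀, C, hC, fun ε hε hlt => ?_⟩
  obtain ⟨E, hE, huniq⟩ := TwoChannel.existsUnique_kdet_eq_zero (d := d) hβ hε hs hs2 hn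
  obtain ⟨h1, h2, h3⟩ := TwoChannel.spectral_types_hamiltonian hβ hε hE huniq
  obtain ⟨z, hz, hz0, hz1, hz2⟩ := hres ε hε hlt
  refine ⟨TwoChannel.isSelfAdjoint_hamiltonian β α hε, h1, h2, h3,
    ⟨E, hE, TwoChannel.pointSpectrum_hamiltonian hβ hε hE huniq⟩, z, ?_, ?_, fun r hr => ?_⟩
  -- the continued determinant has no zero with `Im z ≥ 0`
  · by_contra hi
    exact TwoChannel.kdet_kres_ne_zero hε hz (not_lt.1 hi) hz0
  · rw [hE₀]
    exact hz2
  · exact ⟨_, TwoChannel.isResolventContinuation_cutKrein β α hε r,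
      (TwoChannel.isBranch_kres β).meromorphicOrderAt_eq hε hr hz hz0 hz1⟩
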